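/- **Conventions.** A *Boolean constraint language* $\Gamma$ is a set of relations $R\subseteq\{0,1\}^r$ of finite arity. An operation $f\colon\{0,1\}^m\to\{0,1\}$ is in $\mathrm{Pol}(\Gamma)$ if for every $R\in\Gamma$, applying $f$ columnwise to any $m$ tuples of $R$ gives a tuple of $R$. A clause $\ell_1\vee\dots\vee\ell_r$ is identified with the atom $R(x_1,\dots,x_r)$ where $R$ is the set of its satisfying assignments. $\mathrm{IHSB}_+$ is the language of positive clauses $(x_1\vee\dots\vee x_r)$, $r\ge 1$, unit clauses $(x)$, $(\neg x)$, and implications $(x\to y)$; $d$-$\mathrm{IHSB}_+$ consists of its clauses of arity at most $d$. $\Gamma$ is an *$\mathrm{IHSB}_+$-language* if $\mathrm{Pol}(\mathrm{IHSB}_+)\subseteq\mathrm{Pol}(\Gamma)$. For $d\ge 3$, $t_d(x_1,\dots,x_d)$ is $1$ if $x_1+\dots+x_d\ge 2$ and $0$ otherwise (so $t_3$ is the ternary majority operation). For a language $\Gamma$, let $\Gamma\text{-EV}$ be the following parameterized problem. An input consists of a quantified Boolean formula $\Phi=Q_1x_1\cdots Q_nx_n.\,\varphi$, where $\varphi$ is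 a finite conjunction of clauses (of any arity) and of atoms $R(x_{i_1},\dots,x_{i_r})$ with $R\in\Gamma$, and of a *clause covering (CC-) backdoor* $B$ of $\Phi$ into $\Gamma$, i.e. a set $B$ of variables such that $B$ is exactly the set of variables of some set $C\subseteq\varphi$ of clauses for which all atoms of $\varphi\setminus C$ use relations from $\Gamma$. The parameter is $k=|B|$, and the question is whether $\Phi$ is true. A parameterized problem $L\subseteq\Sigma^*\times\mathbb N$ is FPT if it is decidable by a (deterministic) Turing machine in time $f(k)\cdot(|I|+1)^{c}$ for a computable $f$ and a constant $c$. $L$ is FPT-reducible to $L'$ if there is a map $P$, computable within such a time bound, with $(I,k)\in L\iff P(I,k)=(I',k')\in L'$ and $k'\le p(k)$ for a computable $p$. $L$ and $L'$ are FPT-equivalent if each is FPT-reducible to the other. **Theorem.** Let $\Gamma$ be a finite $\mathrm{IHSB}_+$-language. 1. If $x\vee(y\wedge\neg z)\in\mathrm{Pol}(\Gamma)$ or $t_3\in\mathrm{Pol}(\Gamma)$, then $\Gamma\text{-EV}$, parameterized by the size of the CC-backdoor, is FPT. 2. Otherwise there is some $d\ge 3$, at most the maximum arity of a relation in $\Gamma$,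 such that $\Gamma\text{-EV}$ is FPT-equivalent to $(d\text{-}\mathrm{IHSB}_+)\text{-EV}$. -/

import Mathlib

namespace CCBackdoor

/-! ### Boolean relations, constraint languages and polymorphisms -/

/-- A Boolean relation `R ⊆ {0,1}^r` together with its arity `r`. A Boolean constraint language
is a `Set BoolRel`. -/
structure BoolRel where
  arity : ℕ
  tuples : Set (Fin arity → Bool)

/-- The operation `f` preserves `R`: whenever all rows of a `(d × r)`-matrix `A` belong to `R`,
so does the tuple obtained by applying `f` to the columns of `A`. -/
def Preserves {d : ℕ} (f : (Fin d → Bool) → Bool) (R : BoolRel) : Prop :=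
  ∀ A : Fin d → Fin R.arity → Bool, (∀ i, A i ∈ R.tuples) → (fun j => f fun i => A i j) ∈ R.tuples

/-- `f ∈ Pol(Γ)`. -/
def IsPol {d : ℕ} (f : (Fin d → Bool) → Bool) (Γ : Set BoolRel) : Prop :=
  ∀ R ∈ Γ, Preserves f R

/-- The relation of the clause `ℓ₁ ∨ … ∨ ℓᵣ` on `r` variables, where `ℓᵢ` is the positive literal
`xᵢ` if `s i = true` and the negative literal `¬ xᵢ` if `s i = false`. -/
def clauseRel {r : ℕ} (s : Fin r → Bool) : BoolRel where
  arity := r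
  tuples := {t | ∃ i, t i = s i}

/-- The language `IHSB₊`: positive clauses of every arity, unit clauses, implications. -/
def ihsbPlus : Set BoolRel :=
  {R | (∃ r : ℕ, 0 < r ∧ R = clauseRel fun _ : Fin r => true) ∨
    R = clauseRel ![false] ∨ R = clauseRel ![false, true] ∨ R = clauseRel ![true, false]}

/-- The language `d-IHSB₊`: the clauses of `IHSB₊` that are at most `d`-ary. -/
def dIhsbPlus (d : ℕ) : Set BoolRel :=
  {R | R ∈ ihsbPlus ∧ R.arity ≤ d}

/-- `Γ` is an `IHSB₊`-language: `Pol(IHSB₊) ⊆ Pol(Γ)`. -/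
def IsIhsbPlusLanguage (Γ : Set BoolRel) : Prop :=
  ∀ (d : ℕ) (f : (Fin d → Bool) → Bool), IsPol f ihsbPlus → IsPol f Γ

/-- The ternary operation `x ∨ (y ∧ ¬ z)`. -/
def orAndNot (x : Fin 3 → Bool) : Bool := x 0 || (x 1 && !x 2)

/-- The `d`-ary threshold operation `t_d`: the value is `1` exactly if at least two of the
arguments are `1`. In particular `t_3` is the majority operation. -/
def threshold (d : ℕ) (x : Fin d → Bool) : Bool :=
  decide (2 ≤ (Finset.univ.filter fun i => x i = true).card)

/-! ### Quantified Boolean formulas and clause covering backdoors -/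

/-- The atom `R(x₁, …, xᵣ)` over the variables `x₀, …, xₙ₋₁`; variables may be repeated. -/
structure Atom (n : ℕ) where
  rel : BoolRel
  scope : Fin rel.arity → Fin n

/-- The assignment `σ` satisfies the atom. -/
def Atom.Sat {n : ℕ} (a : Atom n) (σ : Fin n → Bool) : Prop :=
  (fun i => σ (a.scope i)) ∈ a.rel.tuples

/-- The atom is a clause. -/
def Atom.IsClause {n : ℕ} (a : Atom n) : Prop :=
  ∃ (r : ℕ) (s : Fin r → Bool), a.rel = clauseRel s

/-- The variables of a conjunctive formula, which is a set of atoms. -/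
def vars {n : ℕ} (φ : Set (Atom n)) : Set (Fin n) :=
  {v | ∃ a ∈ φ, v ∈ Set.range a.scope}

/-- The class `𝒞_Γ` of conjunctive formulas whose atoms only use relations from `Γ`. -/
def formulaClass (Γ : Set BoolRel) (n : ℕ) : Set (Set (Atom n)) :=
  {φ | ∀ a ∈ φ, a.rel ∈ Γ}

/-- `B` is a clause covering backdoor of a formula with matrix `φ` into the class `𝒞`: there is a
set `C ⊆ φ` of clauses with `φ \ C ∈ 𝒞` and `V(C) = B`. -/
def IsCCBackdoor {n : ℕ} (𝒞 : Set (Set (Atom n))) (φ : Set (Atom n)) (B : Set (Fin n)) : Prop :=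
  ∃ C ⊆ φ, (∀ a ∈ C, a.IsClause) ∧ φ \ C ∈ 𝒞 ∧ vars C = B

inductive Quant
  | all
  | ex

/-- Truth of `Q₀ x₀ … Qₙ₋₁ xₙ₋₁ . P`, by recursion from the outermost quantifier. -/
def qbfTrue : {n : ℕ} → (Fin n → Quant) → ((Fin n → Bool) → Prop) → Prop
  | 0, _, P => P Fin.elim0
  | _ + 1, Q, P =>
    match Q 0 with
    | .all => ∀ b : Bool, qbfTrue (fun i => Q i.succ) fun σ => P (Fin.cons b σ)
    | .ex => ∃ b : Bool, qbfTrue (fun i => Q i.succ) fun σ => P (Fin.cons b σ)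

/-- How an atom of a `CNF + Γ` formula is written down: as a clause, i.e. a list of literals
(`(true, v)` is the literal `v` and `(false, v)` is `¬ v`), or as a relation of `Γ` applied to a
tuple of variables. -/
inductive Constraint (Γ : Set BoolRel) (n : ℕ)
  | clause (l : List (Bool × Fin n))
  | app (R : Γ) (x : Fin R.1.arity → Fin n)

def Constraint.toAtom {Γ : Set BoolRel} {n : ℕ} : Constraint Γ n → Atom n
  | .clause l => ⟨clauseRel fun i : Fin l.length => (l.get i).1, fun i => (l.get i).2⟩
  | .app R x => ⟨R.1, x⟩

/-- An input `(Q₀ x₀ … Qₙ₋₁ xₙ₋₁ . φ, B)` of the evaluation problem: a quantifier prefix, a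
`CNF + Γ` formula and a set of variables. -/
structure Instance (Γ : Set BoolRel) where
  n : ℕ
  quant : Fin n → Quant
  constraints : List (Constraint Γ n)
  backdoor : List (Fin n)

namespace Instance

variable {Γ : Set BoolRel} (I : Instance Γ)

/-- The matrix as a set of atoms. -/
def matrix : Set (Atom I.n) := {a | ∃ c ∈ I.constraints, a = c.toAtom}

/-- The quantified Boolean formula is true. -/
def IsTrue : Prop := qbfTrue I.quant fun σ => ∀ a ∈ I.matrix, a.Sat σ

/-- The given set of variables. -/
def backdoorSet : Finset (Fin I.n) := I.backdoor.toFinset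

end Instance

/-- The alphabet for inputs; it has one letter for each relation of `Γ`, so it is finite if `Γ`
is finite. -/
inductive Sym (Γ : Set BoolRel)
  | quant (q : Quant)
  | clause
  | lit (positive : Bool)
  | rel (R : Γ)
  | var
  | tick
  | backdoor

/-- The variable `xᵢ` is written as `i` ticks. Since `i` is less than the length of the prefix,
which is itself part of the input, the input length is polynomially related to that under binary
indices. -/
def encodeVar (Γ : Set BoolRel) {n : ℕ} (v : Fin n) : List (Sym Γ) :=
  List.replicate v.val .tick

def Constraint.encode {Γ : Set BoolRel} {n : ℕ} : Constraint Γ n → List (Sym Γ)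
  | .clause l => .clause :: l.flatMap fun p => .lit p.1 :: encodeVar Γ p.2
  | .app R x => .rel R :: (List.ofFn x).flatMap fun v => .var :: encodeVar Γ v

/-- The string that represents an input: the prefix, the constraints, the backdoor. -/
def Instance.encode {Γ : Set BoolRel} (I : Instance Γ) : List (Sym Γ) :=
  (List.ofFn I.quant).map .quant ++ I.constraints.flatMap Constraint.encode ++
    .backdoor :: I.backdoor.flatMap fun v => .var :: encodeVar Γ v

/-! ### Parameterized problems -/

/-- The string by which `(w, k) ∈ Σ* × ℕ` is given to a machine: `w`, then `k` in unary. -/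
def pairCode {α : Type} (p : List α × ℕ) : List (Option α) :=
  p.1.map some ++ List.replicate p.2 none

/-- Some Turing machine computes `g` (with output coded by `out`) in time `f(k) · (|w| + 1)^c` on
input `(w, k)`, for a computable `f` and a constant `c`. (The `+ 1` only matters for the empty
string, on which `|w|^c` would leave no time at all.) -/
def ComputableInFPTTime {α β γ : Type} (out : β → List γ) (g : List α × ℕ → β) : Prop :=
  ∃ (f : ℕ → ℕ) (c : ℕ) (M : Turing.TM2ComputableAux (Option α) γ), Computable f ∧
    ∀ p : List α × ℕ, Nonempty (Turing.TM2OutputsInTime M.tm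
      ((pairCode p).map M.inputAlphabet.invFun)
      (some ((out (g p)).map M.outputAlphabet.invFun))
      (f p.2 * (p.1.length + 1) ^ c))

/-- The parameterized problem `L ⊆ Σ* × ℕ` is fixed-parameter tractable. -/
def IsFPT {α : Type} (L : Set (List α × ℕ)) : Prop :=
  ∃ g : List α × ℕ → Bool, (∀ p, g p = true ↔ p ∈ L) ∧ ComputableInFPTTime (fun b => [b]) g

/-- There is an FPT-reduction from `L` to `L'`. -/
def FPTReducible {α β : Type} (L : Set (List α × ℕ)) (L' : Set (List β × ℕ)) : Prop :=
  ∃ P : List α × ℕ → List β × ℕ, (∀ p, p ∈ L ↔ P p ∈ L') ∧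
    (∃ h : ℕ → ℕ, Computable h ∧ ∀ p, (P p).2 ≤ h p.2) ∧ ComputableInFPTTime pairCode P

def FPTEquivalent {α β : Type} (L : Set (List α × ℕ)) (L' : Set (List β × ℕ)) : Prop :=
  FPTReducible L L' ∧ FPTReducible L' L

/-- The CC-backdoor evaluation problem for `Γ`, parameterized by the size of the backdoor: given
a quantified `CNF + Γ` formula and a CC-backdoor `B` into `𝒞_Γ` with `|B| = k`, is the formula
true? -/
def EV (Γ : Set BoolRel) : Set (List (Sym Γ) × ℕ) :=
  {p | ∃ I : Instance Γ, I.encode = p.1 ∧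
    IsCCBackdoor (formulaClass Γ I.n) I.matrix (I.backdoorSet : Set (Fin I.n)) ∧
    I.backdoorSet.card = p.2 ∧ I.IsTrue}

end CCBackdoor

/-!
The proof has a logical part, which compares relations and quantified formulas, and a
computational part, which provides Turing machines for the algorithm and for the reductions.

*Relations.* Only one consequence of the hypothesis on `Γ` is used: every relation is closed under
`x ∨ (y ∧ z)`, a polymorphism of `IHSB₊`. A nonempty relation with this closure property is
defined by its minimal positive implicates, by implications `x → y` and by negative units
(`BoolRel.OrAndClosed.mem`, `BoolRel.OrAndClosed.holds`). Majority is a polymorphism exactly if no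
minimal positive implicate has more than two variables; `x ∨ (y ∧ ¬ z)` is one exactly if there is
no strict implication, that is, every implication between variables that can be true and false is
an equivalence. Hence relations are defined by clauses of two literals, and possibly the empty
clause, in the first case, and by positive clauses, units and equivalences in the second one.

*The tractable cases.* The clauses of two literals are handled through implications between
literals. All that has to be remembered while the variables are assigned from left to right is the
set of those backdoor literals that are implied by the values chosen so far; this leads to a game
on the `4 ^ k` sets of backdoor literals (`Win`). A literal must not become true if it implies its
complement or a literal on a later universal variable. At the end, every clause over the backdoor
needs a literal that has not been refuted. A positive clause outside the backdoor is harmless if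
one of its variables implies only positive literals on existential variables outside the backdoor,
since that variable may be set to true; otherwise it is treated like a clause over the backdoor.
The formula is true exactly if the existential player wins (`win_iff`), and the winner is found by
backward induction (`winB_iff`, `isFPT_EV`).

*The remaining cases.* Let `d` be the largest size of a minimal positive implicate; then `d ≥ 3`,
and there is a strict implication. Reductions replace each constraint outside the backdoor by a
gadget, whose additional variables, one universal variable and several existential ones, are
quantified at the end of the prefix (`IsGadget`, `fptReducible_EV`). Relations of `Γ` are
conjunctions of clauses of `d`-`IHSB₊` (`exists_gadget_dIhsbPlus`). Conversely, a minimal positive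
implicate of size `d` yields the positive clauses of at most `d` literals, a strict implication
yields implications, and with a universal variable `u` the implication `x → u` says that `x` is
false (`exists_gadget_of_mem_dIhsbPlus`). The universal variable also provides a false constraint.

*Machines.* Structured programs on a fixed set of stacks are compiled to Turing machines with
several stacks (`Run.outputs`). They work on binary trees, by which pairs, lists and numbers in
unary are represented. The functions computed by such programs in polynomial time (`Poly`) are
closed under composition and under folds with polynomially bounded accumulators, and therefore
under the usual list operations, so that `fun_prop` finds the programs. Since the parameter is
given in unary, a machine can write down `4 ^ k` in unary first, and then functions that are
polynomial in the input and in `4 ^ k` are computable in FPT time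
(`computableInFPTTime_of_poly_pow`). Strings are parsed into lists of quantifiers and constraints,
on which the algorithms operate (`mem_EV`).
-/

namespace CCBackdoor

/-! ### Structured stack programs -/

/-- The stacks: input, output, the main work stack `m`, two auxiliary stacks and a counter. -/
inductive Stk
  | inp | out | m | t | u | c
  deriving DecidableEq

instance : Fintype Stk := ⟨{.inp, .out, .m, .t, .u, .c}, fun k => by cases k <;> decide⟩

/-- The alphabet of each stack. -/
abbrev Alph (A C : Type) : Stk → Type
  | .inp => A
  | .out => C
  | _ => Bool

/-- The finite control memory: two symbol registers, a flag and a bounded counter. -/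
structure St (N : ℕ) where
  r : Option Bool
  q : Option Bool
  e : Bool
  n : Fin (N + 1)
  deriving Fintype

/-- Structured stack programs. The tests of `ite` and `loop` see the control memory and the top
of one stack. -/
inductive Prog (A C : Type) (N : ℕ)
  | push (k : Stk) (f : St N → Alph A C k)
  | pop (k : Stk) (f : St N → Option (Alph A C k) → St N)
  | seq (p q : Prog A C N)
  | ite (k : Stk) (f : St N → Option (Alph A C k) → Bool) (p q : Prog A C N)
  | loop (k : Stk) (f : St N → Option (Alph A C k) → Bool) (p : Prog A C N)

/-- The memory of a structured stack program. -/
structure Mem (A C : Type) (N : ℕ) where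
  s : St N
  inp : List A
  out : List C
  m : List Bool
  t : List Bool
  u : List Bool
  c : List Bool

variable {A C : Type} {N : ℕ}

namespace Mem

/-- The content of a stack. -/
def get (a : Mem A C N) : (k : Stk) → List (Alph A C k)
  | .inp => a.inp
  | .out => a.out
  | .m => a.m
  | .t => a.t
  | .u => a.u
  | .c => a.c

/-- The memory after the content of a stack has been replaced. -/
def set (a : Mem A C N) : (k : Stk) → List (Alph A C k) → Mem A C N
  | .inp, l => { a with inp := l }
  | .out, l => { a with out := l }
  | .m, l => { a with m := l }
  | .t, l => { a with t := l }
  | .u, l => { a with u := l }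
  | .c, l => { a with c := l }

theorem get_set (a : Mem A C N) (k : Stk) (l : List (Alph A C k)) :
    (a.set k l).get = Function.update a.get k l := by
  funext j
  cases k <;> cases j <;> rfl

theorem s_set (a : Mem A C N) (k : Stk) (l : List (Alph A C k)) : (a.set k l).s = a.s := by
  cases k <;> rfl

end Mem

/-- `Run p a n b`: started in memory `a`, the program `p` stops in memory `b` after `n` steps. -/
inductive Run : Prog A C N → Mem A C N → ℕ → Mem A C N → Prop
  | push (k f a) : Run (.push k f) a 1 (a.set k (f a.s :: a.get k))
  | pop (k f) (a : Mem A C N) :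
      Run (.pop k f) a 1 (({ a with s := f a.s (a.get k).head? } : Mem A C N).set k (a.get k).tail)
  | seq {p q a n b m c} : Run p a n b → Run q b m c → Run (.seq p q) a (n + m) c
  | ite_true {k f p q a n b} : f a.s (a.get k).head? = true → Run p a n b →
      Run (.ite k f p q) a (n + 1) b
  | ite_false {k f p q a n b} : f a.s (a.get k).head? = false → Run q a n b →
      Run (.ite k f p q) a (n + 1) b
  | loop_true {k f p a n b m c} : f a.s (a.get k).head? = true → Run p a n b →
      Run (.loop k f p) b m c → Run (.loop k f p) a (n + m + 1) c
  | loop_false {k f p a} : f a.s (a.get k).head? = false → Run (.loop k f p) a 1 a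

/-! ### Compilation to Turing machines -/

namespace Prog

/-- The labels of the machine that runs a program. -/
def Lab : Prog A C N → Type
  | push _ _ => Unit
  | pop _ _ => Unit
  | seq p q => Lab p ⊕ Lab q
  | ite _ _ p q => Option (Lab p ⊕ Lab q)
  | loop _ _ p => Option (Lab p)

/-- There are finitely many labels. -/
abbrev labFintype : (p : Prog A C N) → Fintype (Lab p)
  | push _ _ => inferInstanceAs (Fintype Unit)
  | pop _ _ => inferInstanceAs (Fintype Unit)
  | seq p q => @instFintypeSum _ _ (labFintype p) (labFintype q)
  | ite _ _ p q => @instFintypeOption _ (@instFintypeSum _ _ (labFintype p) (labFintype q))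
  | loop _ _ p => @instFintypeOption _ (labFintype p)

/-- The label at which a program starts. -/
def entry : (p : Prog A C N) → Lab p
  | push _ _ => ()
  | pop _ _ => ()
  | seq p _ => Sum.inl (entry p)
  | ite _ _ _ _ => none
  | loop _ _ _ => none

/-- The statements of a program whose labels are embedded by `e`; control leaves to `x`. The
Boolean next to the control memory holds the result of the latest test, because a branching
statement of a machine sees the control memory only. -/
def code {L : Type} : (p : Prog A C N) → (Lab p → L) → L → Lab p →
    Turing.TM2.Stmt (Alph A C) L (St N × Bool)
  | push k f, _, x, _ => .push k (fun v => f v.1) (.goto fun _ => x)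
  | pop k f, _, x, _ => .pop k (fun v o => (f v.1 o, v.2)) (.goto fun _ => x)
  | seq p q, e, _, Sum.inl l => code p (fun l => e (Sum.inl l)) (e (Sum.inr (entry q))) l
  | seq _ q, e, x, Sum.inr l => code q (fun l => e (Sum.inr l)) x l
  | ite k f p q, e, _, none => .peek k (fun v o => (v.1, f v.1 o)) (.branch (fun v => v.2)
      (.goto fun _ => e (some (Sum.inl (entry p)))) (.goto fun _ => e (some (Sum.inr (entry q)))))
  | ite _ _ p _, e, x, some (Sum.inl l) => code p (fun l => e (some (Sum.inl l))) x l
  | ite _ _ _ q, e, x, some (Sum.inr l) => code q (fun l => e (some (Sum.inr l))) x l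
  | loop k f p, e, x, none => .peek k (fun v o => (v.1, f v.1 o)) (.branch (fun v => v.2)
      (.goto fun _ => e (some (entry p))) (.goto fun _ => x))
  | loop _ _ p, e, _, some l => code p (fun l => e (some l)) (e none) l

end Prog

/-- The machine `M` passes from `a` to `b` in exactly `n` steps. -/
def StepsTo {L : Type} (M : L → Turing.TM2.Stmt (Alph A C) L (St N × Bool)) (n : ℕ)
    (a b : Turing.TM2.Cfg (Alph A C) L (St N × Bool)) : Prop :=
  (flip bind (Turing.TM2.step M))^[n] (some a) = some b

theorem StepsTo.trans {L : Type} {M : L → Turing.TM2.Stmt (Alph A C) L (St N × Bool)} {n m : ℕ}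
    {a b c : Turing.TM2.Cfg (Alph A C) L (St N × Bool)} (h : StepsTo M n a b)
    (h' : StepsTo M m b c) : StepsTo M (n + m) a c := by
  unfold StepsTo at *
  rw [Nat.add_comm, Function.iterate_add_apply, h, h']

theorem StepsTo.single {L : Type} {M : L → Turing.TM2.Stmt (Alph A C) L (St N × Bool)}
    {a b : Turing.TM2.Cfg (Alph A C) L (St N × Bool)} (h : Turing.TM2.step M a = some b) :
    StepsTo M 1 a b := h

/-- A machine that contains the code of a program, with its labels embedded by `e`, simulates the
program step by step: it starts at the entry label and ends at the exit label `x`. -/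
theorem Run.stepsTo {L : Type} {M : L → Turing.TM2.Stmt (Alph A C) L (St N × Bool)}
    {p : Prog A C N} {a b : Mem A C N} {n : ℕ} (h : Run p a n b) :
    ∀ (e : p.Lab → L) (x : L), (∀ l, M (e l) = p.code e x l) → ∀ v : Bool, ∃ v' : Bool,
      StepsTo M n ⟨some (e p.entry), (a.s, v), a.get⟩ ⟨some x, (b.s, v'), b.get⟩ := by
  induction h with
  | push k f a =>
    intro e x hM v
    refine ⟨v, StepsTo.single ?_⟩
    simp only [Turing.TM2.step]
    rw [hM, Mem.get_set, Mem.s_set]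
    rfl
  | pop k f a =>
    intro e x hM v
    refine ⟨v, StepsTo.single ?_⟩
    simp only [Turing.TM2.step]
    rw [hM, Mem.get_set, Mem.s_set]
    rfl
  | seq _ _ ih₁ ih₂ =>
    intro e x hM v
    obtain ⟨v₁, h₁⟩ := ih₁ _ _ (fun l => hM (Sum.inl l)) v
    obtain ⟨v₂, h₂⟩ := ih₂ _ _ (fun l => hM (Sum.inr l)) v₁
    exact ⟨v₂, h₁.trans h₂⟩
  | @ite_true k f p q a n b hf _ ih =>
    intro e x hM v
    obtain ⟨v₁, h₁⟩ := ih _ _ (fun l => hM (some (Sum.inl l))) true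
    refine ⟨v₁, ?_⟩
    rw [Nat.add_comm]
    refine StepsTo.trans (StepsTo.single ?_) h₁
    simp only [Turing.TM2.step]
    rw [hM]
    simp [Prog.code, Prog.entry, Turing.TM2.stepAux, hf]
  | @ite_false k f p q a n b hf _ ih =>
    intro e x hM v
    obtain ⟨v₁, h₁⟩ := ih _ _ (fun l => hM (some (Sum.inr l))) false
    refine ⟨v₁, ?_⟩
    rw [Nat.add_comm]
    refine StepsTo.trans (StepsTo.single ?_) h₁
    simp only [Turing.TM2.step]
    rw [hM]
    simp [Prog.code, Prog.entry, Turing.TM2.stepAux, hf]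
  | @loop_true k f p a n b m c hf _ _ ih₁ ih₂ =>
    intro e x hM v
    obtain ⟨v₁, h₁⟩ := ih₁ _ _ (fun l => hM (some l)) true
    obtain ⟨v₂, h₂⟩ := ih₂ e x hM v₁
    refine ⟨v₂, ?_⟩
    rw [Nat.add_comm]
    refine StepsTo.trans (StepsTo.single ?_) (h₁.trans h₂)
    simp only [Turing.TM2.step]
    rw [hM]
    simp [Prog.code, Prog.entry, Turing.TM2.stepAux, hf]
  | @loop_false k f p a hf =>
    intro e x hM v
    refine ⟨false, StepsTo.single ?_⟩
    simp only [Turing.TM2.step]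
    rw [hM]
    simp [Prog.code, Prog.entry, Turing.TM2.stepAux, hf]

/-- The control memory at the start. -/
def St.init (N : ℕ) : St N := ⟨none, none, false, 0⟩

/-- The machine that runs a program, resets its control memory and halts. -/
def Prog.machine [Fintype A] (p : Prog A C N) : Turing.FinTM2 :=
  letI := p.labFintype
  letI : Fintype (Alph A C .inp) := inferInstanceAs (Fintype A)
  { K := Stk
    k₀ := .inp
    k₁ := .out
    Γ := Alph A C
    Λ := Option p.Lab
    main := some p.entry
    σ := St N × Bool
    initialState := (St.init N, false)
    m := fun l => match l with
      | some l => p.code some none l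
      | none => .load (fun _ => (St.init N, false)) .halt }

/-- A run from the initial memory that leaves all stacks but the output empty is a computation of
the machine in the sense of `Turing.TM2OutputsInTime`. The additional step resets the control memory
and halts, since a halting configuration has to hold the initial control memory. -/
theorem Run.outputs [Fintype A] {p : Prog A C N} {w : List A} {o : List C} {s : St N} {n m : ℕ}
    (h : Run p ⟨St.init N, w, [], [], [], [], []⟩ n ⟨s, [], o, [], [], [], []⟩) (hn : n + 1 ≤ m) :
    Nonempty (Turing.TM2OutputsInTime p.machine w (some o) m) := by
  obtain ⟨v', hv⟩ := h.stepsTo (M := p.machine.m) some none (fun _ => rfl) false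
  refine ⟨⟨⟨n + 1, ?_⟩, hn⟩⟩
  have h1 : Turing.initList p.machine w = ⟨some (some p.entry), (St.init N, false),
      (⟨St.init N, w, [], [], [], [], []⟩ : Mem A C N).get⟩ := by
    unfold Turing.initList
    congr 1
    funext k
    cases k <;> rfl
  have h2 : Turing.haltList p.machine o = ⟨none, (St.init N, false),
      (⟨s, [], o, [], [], [], []⟩ : Mem A C N).get⟩ := by
    unfold Turing.haltList
    congr 1
    funext k
    cases k <;> rfl
  show (flip bind _)^[n + 1] (some (Turing.initList p.machine w)) =
    some (Turing.haltList p.machine o)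
  rw [h1, h2]
  exact hv.trans (StepsTo.single rfl)

end CCBackdoor

namespace CCBackdoor

variable {A C : Type} {N : ℕ}

/-! ### Polynomial bounds -/

/-- `T` is monotone and bounded by a polynomial. -/
@[fun_prop]
def Bd (T : ℕ → ℕ) : Prop := Monotone T ∧ ∃ c, ∀ n, T n ≤ (n + 2) ^ c

@[fun_prop]
theorem Bd.const (a : ℕ) : Bd fun _ => a :=
  ⟨monotone_const, a, fun n => (Nat.lt_two_pow_self).le.trans (Nat.pow_le_pow_left (by omega) _)⟩

@[fun_prop]
theorem Bd.id : Bd fun n => n := ⟨monotone_id, 1, fun n => by simp⟩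

@[fun_prop]
theorem Bd.comp {S T : ℕ → ℕ} (hS : Bd S) (hT : Bd T) : Bd fun n => S (T n) := by
  obtain ⟨hS, c, hc⟩ := hS
  obtain ⟨hT, d, hd⟩ := hT
  refine ⟨hS.comp hT, (d + 2) * c, fun n => (hc _).trans ?_⟩
  rw [pow_mul]
  refine Nat.pow_le_pow_left ?_ _
  have h1 : 1 ≤ (n + 2) ^ d := Nat.one_le_pow _ _ (by omega)
  have h2 : 4 ≤ (n + 2) ^ 2 := Nat.pow_le_pow_left (show 2 ≤ n + 2 by omega) 2
  have := hd n
  rw [pow_add]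
  nlinarith

theorem two_mul_pow_le (n c : ℕ) : 2 * (n + 2) ^ c ≤ (n + 2) ^ (c + 1) := by
  rw [pow_succ, mul_comm]; gcongr; omega

@[fun_prop]
theorem Bd.add {S T : ℕ → ℕ} (hS : Bd S) (hT : Bd T) : Bd fun n => S n + T n := by
  obtain ⟨hS, c, hc⟩ := hS
  obtain ⟨hT, d, hd⟩ := hT
  refine ⟨fun a b h => add_le_add (hS h) (hT h), c + d + 1, fun n => ?_⟩
  have h1 : (n + 2) ^ c ≤ (n + 2) ^ (c + d) := Nat.pow_le_pow_right (by omega) (by omega)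
  have h2 : (n + 2) ^ d ≤ (n + 2) ^ (c + d) := Nat.pow_le_pow_right (by omega) (by omega)
  have := hc n
  have := hd n
  have := two_mul_pow_le n (c + d)
  dsimp only
  omega

@[fun_prop]
theorem Bd.mul {S T : ℕ → ℕ} (hS : Bd S) (hT : Bd T) : Bd fun n => S n * T n := by
  obtain ⟨hS, c, hc⟩ := hS
  obtain ⟨hT, d, hd⟩ := hT
  refine ⟨fun a b h => Nat.mul_le_mul (hS h) (hT h), c + d, fun n => ?_⟩
  rw [pow_add]
  exact Nat.mul_le_mul (hc n) (hd n)

/-! ### Binary trees on the main stack -/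

/-- Binary trees, the data on which programs work. -/
inductive BTree
  | nil
  | cons (a b : BTree)

namespace BTree

/-- The prefix code of a tree. -/
def toks : BTree → List Bool
  | nil => [false]
  | cons a b => true :: (toks a ++ toks b)

/-- The length of the prefix code, that is, the number of nodes. -/
def size (x : BTree) : ℕ := x.toks.length

@[simp] theorem size_nil : nil.size = 1 := rfl

@[simp] theorem size_cons (a b : BTree) : (cons a b).size = a.size + b.size + 1 := by
  simp [size, toks]

theorem length_toks (x : BTree) : x.toks.length = x.size := rfl

theorem size_pos (x : BTree) : 0 < x.size := by cases x <;> simp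

theorem toks_append_inj : ∀ {x y : BTree} {l l' : List Bool}, x.toks ++ l = y.toks ++ l' →
    x = y ∧ l = l'
  | nil, nil, l, l', h => by simpa [toks] using h
  | nil, cons _ _, l, l', h => by simp [toks] at h
  | cons _ _, nil, l, l', h => by simp [toks] at h
  | cons a b, cons a' b', l, l', h => by
    simp only [toks, List.cons_append, List.cons.injEq, true_and, List.append_assoc] at h
    have h₁ := toks_append_inj h
    have h₂ := toks_append_inj h₁.2
    exact ⟨by rw [h₁.1, h₂.1], h₂.2⟩

theorem toks_injective {x y : BTree} (h : x.toks = y.toks) : x = y :=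
  (toks_append_inj (l := []) (l' := []) (by simpa using h)).1

/-- The left subtree; `nil` has itself as left subtree. -/
def fst : BTree → BTree
  | nil => nil
  | cons a _ => a

/-- The right subtree; `nil` has itself as right subtree. -/
def snd : BTree → BTree
  | nil => nil
  | cons _ b => b

end BTree

/-- `Run` with an upper bound on the number of steps. -/
def RunLe (p : Prog A C N) (a : Mem A C N) (n : ℕ) (b : Mem A C N) : Prop := ∃ m ≤ n, Run p a m b

theorem Run.le {p : Prog A C N} {a b : Mem A C N} {n m : ℕ} (h : Run p a n b) (hn : n ≤ m) :
    RunLe p a m b := ⟨n, hn, h⟩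

theorem RunLe.mono {p : Prog A C N} {a b : Mem A C N} {n m : ℕ} (h : RunLe p a n b) (hn : n ≤ m) :
    RunLe p a m b := let ⟨k, hk, h⟩ := h; ⟨k, hk.trans hn, h⟩

theorem RunLe.seq {p q : Prog A C N} {a b c : Mem A C N} {n m : ℕ} (h : RunLe p a n b)
    (h' : RunLe q b m c) : RunLe (.seq p q) a (n + m) c :=
  let ⟨_, hk, h⟩ := h; let ⟨_, hk', h'⟩ := h'; ⟨_, add_le_add hk hk', h.seq h'⟩

namespace Prog

/-- The test whether a stack is nonempty. -/
def nonempty {α : Type} (_ : St N) (o : Option α) : Bool := o.isSome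

/-- The test whether the top of a stack is `true`, that is, whether an inner node comes next. -/
def topTrue (_ : St N) (o : Option Bool) : Bool := o == some true

/-- Stores a popped symbol in the register `r`. -/
def toR (s : St N) (o : Option Bool) : St N := { s with r := o }

/-- The symbol in the register `r`. -/
def getR (s : St N) : Bool := s.r.getD false

/-- Moves the tree on top of `m` to `t`, reversing its code; `c` counts the pending subtrees. -/
def moveT : Prog A C N := .seq (.push .c fun _ => true) (.loop .c nonempty
  (.seq (.ite .m topTrue (.push .c fun _ => true) (.pop .c fun s _ => s))
    (.seq (.pop .m toR) (.push .t getR))))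

/-- Moves the tree on top of `m` to `u`, reversing its code. -/
def moveU : Prog A C N := .seq (.push .c fun _ => true) (.loop .c nonempty
  (.seq (.ite .m topTrue (.push .c fun _ => true) (.pop .c fun s _ => s))
    (.seq (.pop .m toR) (.push .u getR))))

/-- Moves the content of `t` to `m`, in reverse. -/
def flushT : Prog A C N := .loop .t nonempty (.seq (.pop .t toR) (.push .m getR))

/-- Moves the content of `u` to `m`, in reverse. -/
def flushU : Prog A C N := .loop .u nonempty (.seq (.pop .u toR) (.push .m getR))

/-- Empties `u`. -/
def clearU : Prog A C N := .loop .u nonempty (.pop .u toR)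

/-- Moves the content of `t` to both `m` and `u`, in reverse. -/
def flushBoth : Prog A C N :=
  .loop .t nonempty (.seq (.pop .t toR) (.seq (.push .m getR) (.push .u getR)))

/-- Moves the content of `u` to `t`, in reverse. -/
def flushUT : Prog A C N := .loop .u nonempty (.seq (.pop .u toR) (.push .t getR))

/-- The main loop of `moveT` handles one pending subtree. The statement has the form of a
continuation, a run of the loop on the remaining stacks, because a run of the loop ends only when no
subtree is pending. -/
theorem moveT_loop (x : BTree) : ∀ (s : St N) (i : List A) (o : List C) (m t u c : List Bool),
    ∃ s', ∀ n b, Run (.loop .c nonempty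
      (.seq (.ite .m topTrue (.push .c fun _ => true) (.pop .c fun s _ => s))
        (.seq (.pop .m toR) (.push .t getR)))) ⟨s', i, o, m, x.toks.reverse ++ t, u, c⟩ n b →
      Run (.loop .c nonempty
      (.seq (.ite .m topTrue (.push .c fun _ => true) (.pop .c fun s _ => s))
        (.seq (.pop .m toR) (.push .t getR)))) ⟨s, i, o, x.toks ++ m, t, u, true :: c⟩
        (5 * x.size + n) b := by
  induction x with
  | nil =>
    intro s i o m t u c
    refine ⟨{ s with r := some false }, fun n b h => ?_⟩
    have := Run.loop_true (k := .c) (f := nonempty)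
      (a := ⟨s, i, o, BTree.nil.toks ++ m, t, u, true :: c⟩) rfl
      (Run.seq (Run.ite_false (k := .m) (f := topTrue) rfl (Run.pop .c (fun s _ => s) _))
        (Run.seq (Run.pop .m toR _) (Run.push .t getR _))) h
    rwa [show 1 + 1 + (1 + 1) + n + 1 = 5 * BTree.nil.size + n by simp; omega] at this
  | cons x y ihx ihy =>
    intro s i o m t u c
    obtain ⟨s₁, h₁⟩ := ihx { s with r := some true } i o (y.toks ++ m) (true :: t) u (true :: c)
    obtain ⟨s₂, h₂⟩ := ihy s₁ i o m (x.toks.reverse ++ (true :: t)) u c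
    refine ⟨s₂, fun n b h => ?_⟩
    have h := h₁ _ _ (h₂ n b (by simpa [BTree.toks] using h))
    rw [← List.append_assoc] at h
    have := Run.loop_true (k := .c) (f := nonempty)
      (a := ⟨s, i, o, (BTree.cons x y).toks ++ m, t, u, true :: c⟩) rfl
      (Run.seq (Run.ite_true (k := .m) (f := topTrue) rfl (Run.push .c (fun _ => true) _))
        (Run.seq (Run.pop .m toR _) (Run.push .t getR _))) h
    rwa [show 1 + 1 + (1 + 1) + (5 * x.size + (5 * y.size + n)) + 1 =
      5 * (BTree.cons x y).size + n by simp; omega] at this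

/-- The analogue of `moveT_loop` for `moveU`. -/
theorem moveU_loop (x : BTree) : ∀ (s : St N) (i : List A) (o : List C) (m t u c : List Bool),
    ∃ s', ∀ n b, Run (.loop .c nonempty
      (.seq (.ite .m topTrue (.push .c fun _ => true) (.pop .c fun s _ => s))
        (.seq (.pop .m toR) (.push .u getR)))) ⟨s', i, o, m, t, x.toks.reverse ++ u, c⟩ n b →
      Run (.loop .c nonempty
      (.seq (.ite .m topTrue (.push .c fun _ => true) (.pop .c fun s _ => s))
        (.seq (.pop .m toR) (.push .u getR)))) ⟨s, i, o, x.toks ++ m, t, u, true :: c⟩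
        (5 * x.size + n) b := by
  induction x with
  | nil =>
    intro s i o m t u c
    refine ⟨{ s with r := some false }, fun n b h => ?_⟩
    have := Run.loop_true (k := .c) (f := nonempty)
      (a := ⟨s, i, o, BTree.nil.toks ++ m, t, u, true :: c⟩) rfl
      (Run.seq (Run.ite_false (k := .m) (f := topTrue) rfl (Run.pop .c (fun s _ => s) _))
        (Run.seq (Run.pop .m toR _) (Run.push .u getR _))) h
    rwa [show 1 + 1 + (1 + 1) + n + 1 = 5 * BTree.nil.size + n by simp; omega] at this
  | cons x y ihx ihy =>
    intro s i o m t u c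
    obtain ⟨s₁, h₁⟩ := ihx { s with r := some true } i o (y.toks ++ m) t (true :: u) (true :: c)
    obtain ⟨s₂, h₂⟩ := ihy s₁ i o m t (x.toks.reverse ++ (true :: u)) c
    refine ⟨s₂, fun n b h => ?_⟩
    have h := h₁ _ _ (h₂ n b (by simpa [BTree.toks] using h))
    rw [← List.append_assoc] at h
    have := Run.loop_true (k := .c) (f := nonempty)
      (a := ⟨s, i, o, (BTree.cons x y).toks ++ m, t, u, true :: c⟩) rfl
      (Run.seq (Run.ite_true (k := .m) (f := topTrue) rfl (Run.push .c (fun _ => true) _))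
        (Run.seq (Run.pop .m toR _) (Run.push .u getR _))) h
    rwa [show 1 + 1 + (1 + 1) + (5 * x.size + (5 * y.size + n)) + 1 =
      5 * (BTree.cons x y).size + n by simp; omega] at this

theorem run_moveT (x : BTree) (s : St N) (i : List A) (o : List C) (m t u : List Bool) :
    ∃ s', RunLe moveT ⟨s, i, o, x.toks ++ m, t, u, []⟩ (5 * x.size + 2)
      ⟨s', i, o, m, x.toks.reverse ++ t, u, []⟩ := by
  obtain ⟨s', h⟩ := moveT_loop x s i o m t u []
  exact ⟨s', ((Run.push .c _ _).seq (h _ _ (Run.loop_false rfl))).le (by omega)⟩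

theorem run_moveU (x : BTree) (s : St N) (i : List A) (o : List C) (m t u : List Bool) :
    ∃ s', RunLe moveU ⟨s, i, o, x.toks ++ m, t, u, []⟩ (5 * x.size + 2)
      ⟨s', i, o, m, t, x.toks.reverse ++ u, []⟩ := by
  obtain ⟨s', h⟩ := moveU_loop x s i o m t u []
  exact ⟨s', ((Run.push .c _ _).seq (h _ _ (Run.loop_false rfl))).le (by omega)⟩

theorem run_flushT (i : List A) (o : List C) (u c l : List Bool) : ∀ (s : St N) (m : List Bool),
    ∃ s', RunLe flushT ⟨s, i, o, m, l, u, c⟩ (3 * l.length + 1)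
      ⟨s', i, o, l.reverse ++ m, [], u, c⟩ := by
  induction l with
  | nil => exact fun s m => ⟨s, (Run.loop_false rfl).le (by omega)⟩
  | cons a l ih =>
    intro s m
    obtain ⟨s', n, hn, h⟩ := ih { s with r := some a } (a :: m)
    simp only [List.reverse_cons, List.append_assoc, List.singleton_append]
    refine ⟨s', _, ?_, Run.loop_true rfl ((Run.pop .t toR _).seq (Run.push .m getR _)) h⟩
    simp only [List.length_cons]; omega

theorem run_flushU (i : List A) (o : List C) (t c l : List Bool) : ∀ (s : St N) (m : List Bool),
    ∃ s', RunLe flushU ⟨s, i, o, m, t, l, c⟩ (3 * l.length + 1)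
      ⟨s', i, o, l.reverse ++ m, t, [], c⟩ := by
  induction l with
  | nil => exact fun s m => ⟨s, (Run.loop_false rfl).le (by omega)⟩
  | cons a l ih =>
    intro s m
    obtain ⟨s', n, hn, h⟩ := ih { s with r := some a } (a :: m)
    simp only [List.reverse_cons, List.append_assoc, List.singleton_append]
    refine ⟨s', _, ?_, Run.loop_true rfl ((Run.pop .u toR _).seq (Run.push .m getR _)) h⟩
    simp only [List.length_cons]; omega

theorem run_flushUT (i : List A) (o : List C) (m c l : List Bool) : ∀ (s : St N) (t : List Bool),
    ∃ s', RunLe flushUT ⟨s, i, o, m, t, l, c⟩ (3 * l.length + 1)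
      ⟨s', i, o, m, l.reverse ++ t, [], c⟩ := by
  induction l with
  | nil => exact fun s m => ⟨s, (Run.loop_false rfl).le (by omega)⟩
  | cons a l ih =>
    intro s t
    obtain ⟨s', n, hn, h⟩ := ih { s with r := some a } (a :: t)
    simp only [List.reverse_cons, List.append_assoc, List.singleton_append]
    refine ⟨s', _, ?_, Run.loop_true rfl ((Run.pop .u toR _).seq (Run.push .t getR _)) h⟩
    simp only [List.length_cons]; omega

theorem run_flushBoth (i : List A) (o : List C) (c l : List Bool) :
    ∀ (s : St N) (m u : List Bool),
    ∃ s', RunLe flushBoth ⟨s, i, o, m, l, u, c⟩ (4 * l.length + 1)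
      ⟨s', i, o, l.reverse ++ m, [], l.reverse ++ u, c⟩ := by
  induction l with
  | nil => exact fun s m u => ⟨s, (Run.loop_false rfl).le (by omega)⟩
  | cons a l ih =>
    intro s m u
    obtain ⟨s', n, hn, h⟩ := ih { s with r := some a } (a :: m) (a :: u)
    simp only [List.reverse_cons, List.append_assoc, List.singleton_append]
    refine ⟨s', _, ?_, Run.loop_true rfl ((Run.pop .t toR _).seq
      ((Run.push .m getR _).seq (Run.push .u getR _))) h⟩
    simp only [List.length_cons]; omega

theorem run_clearU (i : List A) (o : List C) (m t c l : List Bool) : ∀ (s : St N),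
    ∃ s', RunLe clearU ⟨s, i, o, m, t, l, c⟩ (2 * l.length + 1) ⟨s', i, o, m, t, [], c⟩ := by
  induction l with
  | nil => exact fun s => ⟨s, (Run.loop_false rfl).le (by omega)⟩
  | cons a l ih =>
    intro s
    obtain ⟨s', n, hn, h⟩ := ih { s with r := some a }
    refine ⟨s', _, ?_, Run.loop_true rfl (Run.pop .u toR _) h⟩
    simp only [List.length_cons]; omega

/-- Copies the tree on top of `m`. -/
def dup : Prog A C N := .seq moveT (.seq flushBoth (.seq flushUT flushT))

theorem run_dup (x : BTree) (s : St N) (i : List A) (o : List C) (m : List Bool) :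
    ∃ s', RunLe dup ⟨s, i, o, x.toks ++ m, [], [], []⟩ (15 * x.size + 5)
      ⟨s', i, o, x.toks ++ (x.toks ++ m), [], [], []⟩ := by
  obtain ⟨s₁, h₁⟩ := run_moveT x s i o m [] []
  obtain ⟨s₂, h₂⟩ := run_flushBoth i o [] (x.toks.reverse ++ []) s₁ m []
  obtain ⟨s₃, h₃⟩ := run_flushUT i o ((x.toks.reverse ++ []).reverse ++ m) []
    ((x.toks.reverse ++ []).reverse ++ []) s₂ []
  obtain ⟨s₄, h₄⟩ := run_flushT i o [] []
    (((x.toks.reverse ++ []).reverse ++ []).reverse ++ []) s₃ ((x.toks.reverse ++ []).reverse ++ m)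
  refine ⟨s₄, ?_⟩
  have := (h₁.seq (h₂.seq (h₃.seq h₄)))
  simp only [List.append_nil, List.reverse_reverse, List.length_reverse, BTree.length_toks] at this
  exact this.mono (by omega)

/-- Exchanges the two trees on top of `m`. -/
def swap : Prog A C N := .seq moveT (.seq moveU (.seq flushT flushU))

theorem run_swap (x y : BTree) (s : St N) (i : List A) (o : List C) (m : List Bool) :
    ∃ s', RunLe swap ⟨s, i, o, x.toks ++ (y.toks ++ m), [], [], []⟩ (8 * x.size + 8 * y.size + 6)
      ⟨s', i, o, y.toks ++ (x.toks ++ m), [], [], []⟩ := by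
  obtain ⟨s₁, h₁⟩ := run_moveT x s i o (y.toks ++ m) [] []
  obtain ⟨s₂, h₂⟩ := run_moveU y s₁ i o m (x.toks.reverse ++ []) []
  obtain ⟨s₃, h₃⟩ := run_flushT i o (y.toks.reverse ++ []) [] (x.toks.reverse ++ []) s₂ m
  obtain ⟨s₄, h₄⟩ := run_flushU i o [] [] (y.toks.reverse ++ []) s₃
    ((x.toks.reverse ++ []).reverse ++ m)
  refine ⟨s₄, ?_⟩
  have := (h₁.seq (h₂.seq (h₃.seq h₄)))
  simp only [List.append_nil, List.reverse_reverse, List.length_reverse, BTree.length_toks] at this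
  exact this.mono (by omega)

/-- Removes the tree on top of `m`. -/
def drop : Prog A C N := .seq moveU clearU

theorem run_drop (x : BTree) (s : St N) (i : List A) (o : List C) (m t : List Bool) :
    ∃ s', RunLe drop ⟨s, i, o, x.toks ++ m, t, [], []⟩ (7 * x.size + 3)
      ⟨s', i, o, m, t, [], []⟩ := by
  obtain ⟨s₁, h₁⟩ := run_moveU x s i o m t []
  obtain ⟨s₂, h₂⟩ := run_clearU i o m t [] (x.toks.reverse ++ []) s₁
  refine ⟨s₂, (h₁.seq h₂).mono ?_⟩
  simp only [List.append_nil, List.length_reverse, BTree.length_toks]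
  omega

end Prog

/-! ### Polynomial-time functions -/

/-- An injective representation of the elements of `α` by trees. -/
class Enc (α : Type) where
  enc : α → BTree
  inj : Function.Injective enc

open Enc (enc)

/-- The size of the representing tree. -/
def esize {α : Type} [Enc α] (a : α) : ℕ := (enc a).size

instance : Enc BTree := ⟨fun x => x, fun _ _ h => h⟩

instance {α β : Type} [Enc α] [Enc β] : Enc (α × β) where
  enc p := .cons (enc p.1) (enc p.2)
  inj p q h := by
    simp only [BTree.cons.injEq] at h
    exact Prod.ext (Enc.inj h.1) (Enc.inj h.2)

instance : Enc Bool where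
  enc b := cond b (.cons .nil .nil) .nil
  inj a b h := by cases a <;> cases b <;> simp_all

theorem esize_prod {α β : Type} [Enc α] [Enc β] (p : α × β) :
    esize p = esize p.1 + esize p.2 + 1 := BTree.size_cons _ _

/-- The program `p` replaces the representation of `a` on top of the main stack by that of `f a`,
in time `T` of the size of `a`. -/
def Replaces {α β : Type} [Enc α] [Enc β] (p : Prog A C N) (f : α → β) (T : ℕ → ℕ) : Prop :=
  ∀ (a : α) (s : St N) (i : List A) (o : List C) (m : List Bool),
    ∃ s', RunLe p ⟨s, i, o, (enc a).toks ++ m, [], [], []⟩ (T (esize a))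
      ⟨s', i, o, (enc (f a)).toks ++ m, [], [], []⟩

/-- `f` is computable in polynomial time, by programs with any input and output alphabet. The
bound on the size of the value is part of the definition. -/
@[fun_prop]
def Poly {α β : Type} [Enc α] [Enc β] (f : α → β) : Prop :=
  ∃ T : ℕ → ℕ, Bd T ∧ (∀ a, esize (f a) ≤ T (esize a)) ∧
    ∀ A C N, ∃ p : Prog A C N, Replaces p f T

namespace Poly

open Prog

variable {α β γ : Type} [Enc α] [Enc β] [Enc γ]

/-- Polynomial-time computability depends only on the representing trees of arguments and values. -/
theorem of_enc_eq {α' β' : Type} [Enc α'] [Enc β'] {g : α' → β'} (hg : Poly g) {f : α → β}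
    (i : α → α') (hi : ∀ a, enc (i a) = enc a) (h : ∀ a, enc (g (i a)) = enc (f a)) : Poly f := by
  obtain ⟨T, hT, hs, hp⟩ := hg
  refine ⟨T, hT, fun a => ?_, fun A C N => (hp A C N).imp fun p hp a s j o m => ?_⟩
  · rw [esize, ← h, esize, ← hi]
    exact hs _
  · rw [← h, esize, ← hi]
    exact hp _ _ _ _ _

@[fun_prop]
theorem id : Poly fun a : α => a := by
  -- There is no empty program; removing a symbol from the empty stack `u` has no effect.
  refine ⟨fun n => n + 1, by fun_prop, by simp, fun A C N =>
    ⟨.pop .u fun s _ => s, fun x s i o m => ⟨s, (Run.pop .u _ _).le (by dsimp only; omega)⟩⟩⟩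

@[fun_prop]
theorem comp {f : β → γ} {g : α → β} (hf : Poly f) (hg : Poly g) : Poly fun x => f (g x) := by
  obtain ⟨T, hT, hfT, hp⟩ := hf
  obtain ⟨S, hS, hgS, hq⟩ := hg
  refine ⟨fun n => S n + T (S n), by fun_prop, fun x => (hfT _).trans
    ((hT.1 (hgS x)).trans (by dsimp only; omega)), fun A C N => ?_⟩
  obtain ⟨p, hp⟩ := hp A C N
  obtain ⟨q, hq⟩ := hq A C N
  refine ⟨.seq q p, fun x s i o m => ?_⟩
  obtain ⟨s₁, h₁⟩ := hq x s i o m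
  obtain ⟨s₂, h₂⟩ := hp (g x) s₁ i o m
  exact ⟨s₂, (h₁.seq h₂).mono (Nat.add_le_add_left (hT.1 (hgS x)) _)⟩

/-- The argument is duplicated, and the two values are computed one after the other; the final push
is the inner node of the pair. -/
@[fun_prop]
theorem mk {f : α → β} {g : α → γ} (hf : Poly f) (hg : Poly g) : Poly fun x => (f x, g x) := by
  obtain ⟨T, hT, hfT, hp⟩ := hf
  obtain ⟨S, hS, hgS, hq⟩ := hg
  refine ⟨fun n => (15 * n + 5) + T n + (8 * T n + 8 * n + 6) + S n + (8 * S n + 8 * T n + 6) + 1,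
    by fun_prop, fun x => ?_, fun A C N => ?_⟩
  · have := hfT x
    have := hgS x
    rw [esize_prod]
    dsimp only
    omega
  obtain ⟨p, hp⟩ := hp A C N
  obtain ⟨q, hq⟩ := hq A C N
  refine ⟨.seq dup (.seq p (.seq swap (.seq q (.seq swap (.push .m fun _ => true))))),
    fun x s i o m => ?_⟩
  obtain ⟨s₁, h₁⟩ := run_dup (enc x) s i o m
  obtain ⟨s₂, h₂⟩ := hp x s₁ i o ((enc x).toks ++ m)
  obtain ⟨s₃, h₃⟩ := run_swap (enc (f x)) (enc x) s₂ i o m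
  obtain ⟨s₄, h₄⟩ := hq x s₃ i o ((enc (f x)).toks ++ m)
  obtain ⟨s₅, h₅⟩ := run_swap (enc (g x)) (enc (f x)) s₄ i o m
  have := h₁.seq (h₂.seq (h₃.seq (h₄.seq (h₅.seq ((Run.push .m (fun _ => true) _).le le_rfl)))))
  refine ⟨s₅, ?_⟩
  have e : enc (f x, g x) = .cons (enc (f x)) (enc (g x)) := rfl
  rw [e]
  simp only [BTree.toks, List.cons_append, List.append_assoc]
  refine this.mono ?_
  have := hfT x
  have := hgS x
  simp only [esize] at *
  omega

/-- The left subtree is computable in polynomial time. -/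
theorem fstD : Poly BTree.fst := by
  refine ⟨fun n => 20 * n + 20, by fun_prop, fun x => ?_, fun A C N =>
    ⟨.ite .m topTrue (.seq (.pop .m toR) (.seq moveT (.seq drop flushT))) (.pop .u fun s _ => s),
      fun x s i o m => ?_⟩⟩
  · cases x <;> simp [BTree.fst, esize, enc]; omega
  cases x with
  | nil => exact ⟨s, (Run.ite_false rfl (Run.pop .u _ _)).le (by simp)⟩
  | cons a b =>
    obtain ⟨s₁, h₁⟩ := run_moveT a { s with r := some true } i o (b.toks ++ m) [] []
    obtain ⟨s₂, h₂⟩ := run_drop b s₁ i o m (a.toks.reverse ++ [])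
    obtain ⟨s₃, h₃⟩ := run_flushT i o [] [] (a.toks.reverse ++ []) s₂ m
    obtain ⟨n, hn, h⟩ := h₁.seq (h₂.seq h₃)
    rw [← List.append_assoc, List.append_nil, List.reverse_reverse] at h
    refine ⟨s₃, _, ?_, Run.ite_true rfl ((Run.pop .m toR _).seq h)⟩
    simp only [List.append_nil, List.length_reverse, BTree.length_toks] at hn
    simp only [esize, enc, BTree.size_cons]
    omega

/-- The right subtree is computable in polynomial time. -/
theorem sndD : Poly BTree.snd := by
  refine ⟨fun n => 20 * n + 20, by fun_prop, fun x => ?_, fun A C N =>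
    ⟨.ite .m topTrue (.seq (.pop .m toR) drop) (.pop .u fun s _ => s), fun x s i o m => ?_⟩⟩
  · cases x <;> simp [BTree.snd, esize, enc]; omega
  cases x with
  | nil => exact ⟨s, (Run.ite_false rfl (Run.pop .u _ _)).le (by simp)⟩
  | cons a b =>
    obtain ⟨s₁, n, hn, h⟩ := run_drop a { s with r := some true } i o (b.toks ++ m) []
    rw [← List.append_assoc] at h
    refine ⟨s₁, _, ?_, Run.ite_true rfl ((Run.pop .m toR _).seq h)⟩
    simp only [esize, enc, BTree.size_cons]
    omega

@[fun_prop]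
theorem fst {f : α → β × γ} (hf : Poly f) : Poly fun x => (f x).1 :=
  comp (fstD.of_enc_eq (f := Prod.fst) enc (fun _ => rfl) (fun _ => rfl)) hf

@[fun_prop]
theorem snd {f : α → β × γ} (hf : Poly f) : Poly fun x => (f x).2 :=
  comp (sndD.of_enc_eq (f := Prod.snd) enc (fun _ => rfl) (fun _ => rfl)) hf

theorem constD (y : BTree) : Poly fun _ : α => y := by
  induction y with
  | nil =>
    refine ⟨fun n => 7 * n + 4, by fun_prop, by simp [esize, enc], fun A C N =>
      ⟨.seq drop (.push .m fun _ => false), fun x s i o m => ?_⟩⟩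
    obtain ⟨s', h⟩ := run_drop (enc x) s i o m []
    exact ⟨s', (h.seq ((Run.push .m _ _).le le_rfl)).mono (by simp only [esize]; omega)⟩
  | cons a b iha ihb => exact (iha.mk ihb).of_enc_eq (fun a => a) (fun _ => rfl) (fun _ => rfl)

@[fun_prop]
theorem const (b : β) : Poly fun _ : α => b :=
  (constD (enc b)).of_enc_eq (fun a => a) (fun _ => rfl) (fun _ => rfl)

@[fun_prop]
theorem cond {c : α → Bool} {f g : α → β} (hc : Poly c) (hf : Poly f) (hg : Poly g) :
    Poly fun x => cond (c x) (f x) (g x) := by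
  obtain ⟨R, hR, hcR, hr⟩ := hc
  obtain ⟨T, hT, hfT, hp⟩ := hf
  obtain ⟨S, hS, hgS, hq⟩ := hg
  refine ⟨fun n => (15 * n + 5) + R n + (7 * R n + 3) + 1 + T n + S n, by fun_prop, fun x => ?_,
    fun A C N => ?_⟩
  · have := hfT x
    have := hgS x
    dsimp only
    cases c x <;> simp only [cond_true, cond_false] <;> omega
  obtain ⟨r, hr⟩ := hr A C N
  obtain ⟨p, hp⟩ := hp A C N
  obtain ⟨q, hq⟩ := hq A C N
  refine ⟨.seq dup (.seq r (.ite .m topTrue (.seq drop p) (.seq drop q))), fun x s i o m => ?_⟩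
  obtain ⟨s₁, h₁⟩ := run_dup (enc x) s i o m
  obtain ⟨s₂, h₂⟩ := hr x s₁ i o ((enc x).toks ++ m)
  obtain ⟨s₃, h₃⟩ := run_drop (enc (c x)) s₂ i o ((enc x).toks ++ m) []
  have hc := hcR x
  beta_reduce
  cases h : c x with
  | false =>
    obtain ⟨s₄, h₄⟩ := hq x s₃ i o m
    obtain ⟨n, hn, hrun⟩ := h₃.seq h₄
    refine ⟨s₄, ?_⟩
    refine (h₁.seq (h₂.seq ((Run.ite_false ?_ hrun).le le_rfl))).mono
      (by simp only [esize] at *; omega)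
    rw [h]
    rfl
  | true =>
    obtain ⟨s₄, h₄⟩ := hp x s₃ i o m
    obtain ⟨n, hn, hrun⟩ := h₃.seq h₄
    refine ⟨s₄, ?_⟩
    refine (h₁.seq (h₂.seq ((Run.ite_true ?_ hrun).le le_rfl))).mono
      (by simp only [esize] at *; omega)
    rw [h]
    rfl

end Poly

end CCBackdoor

namespace CCBackdoor

open Enc (enc)

variable {A C : Type} {N : ℕ}

/-! ### Equality test and iteration on trees -/

namespace Prog

/-- Compares the contents of `t` and `u` and empties both. -/
def compare : Prog A C N := .seq (.pop .c fun s _ => { s with e := true })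
  (.seq (.loop .t nonempty (.seq (.pop .t toR)
    (.pop .u fun s o => { s with e := s.e && (o == s.r) })))
  (.seq (.pop .u fun s o => { s with e := s.e && o.isNone }) clearU))

/-- The loop leaves `true` in the flag exactly if the content of `t` is an initial segment of that
of `u`. -/
theorem run_compare_loop (i : List A) (o : List C) (m c l : List Bool) :
    ∀ (s : St N) (l' : List Bool), ∃ s', (s'.e = true ↔ s.e = true ∧ l'.take l.length = l) ∧
      RunLe (.loop .t nonempty (.seq (.pop .t toR)
        (.pop .u fun s o => { s with e := s.e && (o == s.r) }))) ⟨s, i, o, m, l, l', c⟩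
        (3 * l.length + 1) ⟨s', i, o, m, [], l'.drop l.length, c⟩ := by
  induction l with
  | nil => exact fun s l' => ⟨s, by simp, (Run.loop_false rfl).le (by omega)⟩
  | cons a l ih =>
    intro s l'
    obtain ⟨s', he, n, hn, h⟩ := ih { s with r := some a, e := s.e && (l'.head? == some a) } l'.tail
    have : l'.drop (a :: l).length = l'.tail.drop l.length := by cases l' <;> simp
    rw [this]
    refine ⟨s', ?_, _, ?_, Run.loop_true rfl ((Run.pop .t toR _).seq (Run.pop .u _ _)) h⟩
    · rw [he]
      cases l' <;> simp [and_assoc]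
    · simp only [List.length_cons]; omega

theorem run_compare (i : List A) (o : List C) (m l l' : List Bool) (s : St N) :
    ∃ s', (s'.e = true ↔ l = l') ∧ RunLe compare ⟨s, i, o, m, l, l', []⟩
        (3 * l.length + 2 * l'.length + 4) ⟨s', i, o, m, [], [], []⟩ := by
  obtain ⟨s₁, he, h₁⟩ := run_compare_loop i o m [] l { s with e := true } l'
  have h : (s₁.e && (l'.drop l.length).head?.isNone) = true ↔ l = l' := by
    rw [Bool.and_eq_true, he]
    simp only [true_and, Option.isNone_iff_eq_none, List.head?_eq_none_iff, List.drop_eq_nil_iff]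
    constructor
    · rintro ⟨h, h'⟩
      rw [← h, List.take_of_length_le h']
    · rintro rfl
      simp
  -- `run_clearU` does not say that the flag survives.
  have hc : ∀ (l : List Bool) (s : St N), ∃ s', s'.e = s.e ∧
      RunLe clearU ⟨s, i, o, m, [], l, []⟩ (2 * l.length + 1) ⟨s', i, o, m, [], [], []⟩ := by
    intro l
    induction l with
    | nil => exact fun s => ⟨s, rfl, (Run.loop_false rfl).le (by omega)⟩
    | cons a l ih =>
      intro s
      obtain ⟨s', he, n, hn, h⟩ := ih { s with r := some a }
      refine ⟨s', he, _, ?_, Run.loop_true rfl (Run.pop .u toR _) h⟩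
      simp only [List.length_cons]; omega
  obtain ⟨s₂, he₂, h₂⟩ := hc (l'.drop l.length).tail
    { s₁ with e := s₁.e && (l'.drop l.length).head?.isNone }
  refine ⟨s₂, by rw [he₂]; exact h, ?_⟩
  refine (((Run.pop .c _ _).le le_rfl).seq (h₁.seq (((Run.pop .u _ _).le le_rfl).seq h₂))).mono ?_
  simp only [List.length_tail, List.length_drop]
  omega

end Prog

/-- Equality of represented objects, as a Boolean. -/
noncomputable def eqb {α : Type} [Enc α] (a b : α) : Bool := open Classical in decide (a = b)

@[simp] theorem eqb_iff {α : Type} [Enc α] {a b : α} : eqb a b = true ↔ a = b := by simp [eqb]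

open Prog in
/-- Equality of the two components of a tree is decided in polynomial time. -/
theorem Poly.eqD : Poly fun x : BTree => eqb x.fst x.snd := by
  refine ⟨fun n => 20 * n + 20, by fun_prop, fun x => ?_, fun A C N =>
    ⟨.seq (.ite .m topTrue (.seq (.pop .m toR) (.seq moveT (.seq moveU compare)))
        (.pop .m fun s _ => { s with e := true }))
      (.ite .m (fun s _ => s.e) (.seq (.push .m fun _ => false) (.seq (.push .m fun _ => false)
        (.push .m fun _ => true))) (.push .m fun _ => false)), fun x s i o m => ?_⟩⟩
  · show esize (eqb x.fst x.snd) ≤ _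
    generalize eqb x.fst x.snd = b
    cases b <;> simp [esize, enc]
  obtain ⟨s', he, h⟩ : ∃ s', (s'.e = true ↔ x.fst = x.snd) ∧
      RunLe (.ite .m topTrue (.seq (.pop .m toR) (.seq moveT (.seq moveU compare)))
        (.pop .m fun s _ => { s with e := true })) ⟨s, i, o, x.toks ++ m, [], [], []⟩
        (10 * x.size + 12) ⟨s', i, o, m, [], [], []⟩ := by
    cases x with
    | nil => exact ⟨{ s with e := true }, by simp [BTree.fst, BTree.snd],
        (Run.ite_false rfl (Run.pop .m _ _)).le (by omega)⟩
    | cons a b =>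
      obtain ⟨s₁, h₁⟩ := run_moveT a { s with r := some true } i o (b.toks ++ m) [] []
      obtain ⟨s₂, h₂⟩ := run_moveU b s₁ i o m (a.toks.reverse ++ []) []
      obtain ⟨s₃, he, h₃⟩ := run_compare i o m (a.toks.reverse ++ []) (b.toks.reverse ++ []) s₂
      obtain ⟨n, hn, h⟩ := h₁.seq (h₂.seq h₃)
      rw [← List.append_assoc] at h
      refine ⟨s₃, ?_, _, ?_, Run.ite_true rfl ((Run.pop .m toR _).seq h)⟩
      · rw [he]
        simp only [List.append_nil, List.reverse_inj, BTree.fst, BTree.snd]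
        exact ⟨BTree.toks_injective, fun h => by rw [h]⟩
      · simp only [List.append_nil, List.length_reverse, BTree.length_toks] at hn
        simp only [BTree.size_cons]
        omega
  refine ⟨s', ?_⟩
  beta_reduce
  cases hx : eqb x.fst x.snd with
  | true =>
    exact (h.seq ((Run.ite_true (he.2 (eqb_iff.1 hx)) ((Run.push .m (fun _ => false) _).seq
      ((Run.push .m (fun _ => false) _).seq (Run.push .m (fun _ => true) _)))).le le_rfl)).mono
      (by simp only [esize, enc]; omega)
  | false =>
    have : ¬ s'.e = true := fun h => by simp [eqb_iff.2 (he.1 h)] at hx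
    exact (h.seq ((Run.ite_false (by simpa using this)
      (Run.push .m (fun _ => false) _)).le le_rfl)).mono (by simp only [esize, enc]; omega)

section

variable {α β σ : Type} [Enc α] [Enc β] [Enc σ]

@[fun_prop]
theorem Poly.eqb {f g : α → β} (hf : Poly f) (hg : Poly g) : Poly fun a => eqb (f a) (g a) := by
  refine comp (f := fun p : β × β => CCBackdoor.eqb p.1 p.2) (eqD.of_enc_eq enc (fun _ => rfl) ?_)
    (hf.mk hg)
  rintro ⟨a, b⟩
  congr 1
  rw [Bool.eq_iff_iff, eqb_iff, eqb_iff]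
  exact ⟨fun h => Enc.inj h, fun h => congrArg enc h⟩

/-- The tree with a given list of trees hanging off its right spine. -/
def encList : List α → BTree
  | [] => .nil
  | a :: l => .cons (enc a) (encList l)

instance : Enc (List α) where
  enc := encList
  inj l := by
    induction l with
    | nil => intro l' h; cases l' <;> simp_all [encList]
    | cons a l ih =>
      intro l' h
      cases l' with
      | nil => simp [encList] at h
      | cons b l' =>
        simp only [encList, BTree.cons.injEq] at h
        rw [Enc.inj h.1, ih h.2]

@[simp] theorem esize_nil : esize ([] : List α) = 1 := rfl

@[simp] theorem esize_cons (a : α) (l : List α) : esize (a :: l) = esize a + esize l + 1 :=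
  BTree.size_cons _ _

theorem esize_pos (a : α) : 0 < esize a := BTree.size_pos _

open Prog in
/-- A program for left folds; its running time is polynomial in the sizes of the list and of the
largest accumulator. -/
theorem Poly.exists_foldl {f : σ → β → σ} (hf : Poly fun p : σ × β => f p.1 p.2) :
    ∃ T : ℕ → ℕ, Bd T ∧ ∀ A C N, ∃ p : Prog A C N, ∀ (l : List β) (z : σ) (b : ℕ),
      (∀ l', l' <+: l → esize (l'.foldl f z) ≤ b) →
      ∀ (s : St N) (i : List A) (o : List C) (m : List Bool),
        ∃ s', RunLe p ⟨s, i, o, (enc (l, z)).toks ++ m, [], [], []⟩ (T (esize l + b))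
          ⟨s', i, o, (enc (l.foldl f z)).toks ++ m, [], [], []⟩ := by
  have hd : Poly fun x : BTree × σ => (x.1.snd, x.2) :=
    ((sndD).comp (fst id)).mk (snd id)
  -- The body turns `((b :: l), z)` into `(l, f z b)`.
  have hf : Poly fun x : (β × BTree) × σ => (x.1.2, f x.2 x.1.1) :=
    (snd (fst id)).mk (hf.comp ((snd id).mk (fst (fst id))))
  obtain ⟨T, hT, -, hp⟩ := hf
  refine ⟨fun n => n * (T (2 * n + 2) + 3) + 4, by fun_prop, fun A C N => ?_⟩
  obtain ⟨p, hp⟩ := hp A C N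
  have key : ∀ (l : List β) (z : σ) (b M : ℕ), (∀ l', l' <+: l → esize (l'.foldl f z) ≤ b) →
      esize l + b + 1 ≤ M → ∀ (s : St N) (i : List A) (o : List C) (m : List Bool),
        ∃ s', RunLe (.loop .m topTrue (.seq (.push .m fun _ => true) (.seq p (.pop .m toR))))
          ⟨s, i, o, (enc l).toks ++ ((enc z).toks ++ m), [], [], []⟩ (esize l * (T M + 3) + 1)
          ⟨s', i, o, false :: ((enc (l.foldl f z)).toks ++ m), [], [], []⟩ := by
    intro l
    induction l with
    | nil =>
      intro z b M _ _ s i o m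
      exact ⟨s, (Run.loop_false rfl).le (by omega)⟩
    | cons a l ih =>
      intro z b M hb hM s i o m
      have hz : esize z ≤ b := hb [] List.nil_prefix
      rw [esize_cons] at hM
      obtain ⟨s₁, n₁, hn₁, h₁⟩ := hp ((a, enc l), z) s i o m
      obtain ⟨s₂, n₂, hn₂, h₂⟩ := ih (f z a) b M
        (fun l' hl' => hb (a :: l') (by simpa using hl')) (by omega)
        { s₁ with r := some true } i o m
      have hTM : T (esize ((a, enc l), z)) ≤ T M := hT.1 (by
        simp only [esize_prod]
        simp only [esize, enc] at *
        omega)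
      simp only [enc, BTree.toks, List.cons_append, List.append_assoc] at h₁ h₂
      simp only [enc, encList, BTree.toks, List.cons_append, List.append_assoc, List.foldl_cons]
      refine ⟨s₂, _, ?_, Run.loop_true rfl ((Run.push .m (fun _ => true) _).seq
        (h₁.seq (Run.pop .m toR _))) h₂⟩
      rw [esize_cons]
      have : (esize a + esize l + 1) * (T M + 3) ≥ esize l * (T M + 3) + (T M + 3) := by
        nlinarith [esize_pos a]
      omega
  refine ⟨.seq (.pop .m toR) (.seq (.loop .m topTrue
    (.seq (.push .m fun _ => true) (.seq p (.pop .m toR)))) (.pop .m toR)),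
    fun l z b hb s i o m => ?_⟩
  have hz : esize z ≤ b := hb [] List.nil_prefix
  have := esize_pos z
  obtain ⟨s', h⟩ := key l z b (2 * (esize l + b) + 2) hb (by omega) { s with r := some true } i o m
  simp only [enc, BTree.toks, List.cons_append, List.append_assoc] at h ⊢
  refine ⟨_, (((Run.pop .m toR _).le le_rfl).seq (h.seq ((Run.pop .m toR _).le le_rfl))).mono ?_⟩
  have : (esize l + b) * (T (2 * (esize l + b) + 2) + 3) ≥
    esize l * (T (2 * (esize l + b) + 2) + 3) := Nat.mul_le_mul_right _ (by omega)
  omega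

/-- Left folds whose accumulators are polynomially bounded. -/
theorem Poly.foldl_of_bd {f : α → σ → β → σ} {l : α → List β} {z : α → σ}
    (hf : Poly fun p : (α × σ) × β => f p.1.1 p.1.2 p.2) (hl : Poly l) (hz : Poly z)
    {S : ℕ → ℕ} (hS : Bd S)
    (hb : ∀ a l', l' <+: l a → esize (l'.foldl (f a) (z a)) ≤ S (esize a)) :
    Poly fun a => (l a).foldl (f a) (z a) := by
  -- The parameter is carried along as a part of the accumulator.
  have hstep : Poly fun p : (α × σ) × β => (p.1.1, f p.1.1 p.1.2 p.2) := (fst (fst id)).mk hf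
  obtain ⟨T, hT, hp⟩ := exists_foldl (f := fun (s : α × σ) b => (s.1, f s.1 s.2 b)) hstep
  obtain ⟨F, hF, hFs, hq⟩ := hl.mk (id.mk hz)
  have e : ∀ a z (l : List β), l.foldl (fun (s : α × σ) b => (s.1, f s.1 s.2 b)) (a, z) =
      (a, l.foldl (f a) z) := by
    intro a z l
    induction l generalizing z with
    | nil => rfl
    | cons b l ih => exact ih _
  have h : Poly fun a => (a, (l a).foldl (f a) (z a)) := by
    refine ⟨fun n => (n + S n + 1) + F n + T (F n + (n + S n + 1)), by fun_prop, fun a => ?_,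
      fun A C N => ?_⟩
    · have := hb a _ (List.prefix_refl _)
      rw [esize_prod]
      dsimp only
      omega
    obtain ⟨p, hp⟩ := hp A C N
    obtain ⟨q, hq⟩ := hq A C N
    refine ⟨.seq q p, fun a s i o m => ?_⟩
    obtain ⟨s₁, h₁⟩ := hq a s i o m
    obtain ⟨s₂, h₂⟩ := hp (l a) (a, z a) (esize a + S (esize a) + 1) (fun l' hl' => by
      have := hb a l' hl'
      rw [e, esize_prod]
      dsimp only
      omega) s₁ i o m
    rw [e] at h₂
    refine ⟨s₂, (h₁.seq h₂).mono ?_⟩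
    have := hFs a
    rw [esize_prod] at this
    dsimp only at this
    have : T (esize (l a) + (esize a + S (esize a) + 1)) ≤
      T (F (esize a) + (esize a + S (esize a) + 1)) := hT.1 (by omega)
    dsimp only
    omega
  exact snd h

end

end CCBackdoor

namespace CCBackdoor

open Enc (enc)

/-! ### A library of polynomial-time functions -/

section

variable {α β γ σ : Type} [Enc α] [Enc β] [Enc γ] [Enc σ]

namespace Poly

/-- Left folds whose accumulators are bounded in terms of the parameter alone. -/
theorem foldl_bdd {f : α → σ → β → σ} {l : α → List β} {z : α → σ}
    (hf : Poly fun p : (α × σ) × β => f p.1.1 p.1.2 p.2) (hl : Poly l) (hz : Poly z)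
    {S : ℕ → ℕ} (hS : Bd S) (hb : ∀ a s b, esize (f a s b) ≤ S (esize a)) :
    Poly fun a => (l a).foldl (f a) (z a) := by
  have ⟨Z, hZ, hzs, _⟩ := hz
  refine foldl_of_bd hf hl hz (S := fun n => S n + Z n) (by fun_prop) fun a l' _ => ?_
  rcases l'.eq_nil_or_concat with rfl | ⟨l'', b, rfl⟩
  · exact (hzs a).trans (Nat.le_add_left _ _)
  · rw [List.concat_eq_append, List.foldl_append]
    exact (hb a _ b).trans (Nat.le_add_right _ _)

theorem esize_le_of_mem {b : β} {l : List β} (h : b ∈ l) : esize b ≤ esize l := by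
  induction l with
  | nil => simp at h
  | cons c l ih =>
    rw [esize_cons]
    rcases List.mem_cons.1 h with rfl | h
    · omega
    · have := ih h; omega

theorem length_le_esize (l : List β) : l.length ≤ esize l := by
  induction l with
  | nil => simp
  | cons c l ih => rw [esize_cons, List.length_cons]; omega

theorem esize_le_of_sublist {l l' : List β} (h : l'.Sublist l) : esize l' ≤ esize l := by
  induction h with
  | slnil => rfl
  | cons a _ ih => rw [esize_cons]; omega
  | cons_cons a _ ih => rw [esize_cons, esize_cons]; omega

theorem esize_append (l l' : List β) : esize (l ++ l') + 1 = esize l + esize l' := by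
  induction l with
  | nil => simp [add_comm]
  | cons c l ih => rw [List.cons_append, esize_cons, esize_cons]; omega

/-- Left folds in which every step adds at most an amount bounded in terms of the parameter and
the list element. -/
theorem foldl_add {f : α → σ → β → σ} {l : α → List β} {z : α → σ}
    (hf : Poly fun p : (α × σ) × β => f p.1.1 p.1.2 p.2) (hl : Poly l) (hz : Poly z)
    {S : ℕ → ℕ} (hS : Bd S) (hb : ∀ a s b, esize (f a s b) ≤ esize s + S (esize a + esize b)) :
    Poly fun a => (l a).foldl (f a) (z a) := by
  have ⟨Z, hZ, hzs, _⟩ := hz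
  have ⟨L, hL, hls, _⟩ := hl
  refine foldl_of_bd hf hl hz (S := fun n => Z n + L n * S (n + L n)) (by fun_prop)
    fun a l' hl' => ?_
  have key : ∀ (l' : List β) (s : σ), (∀ b ∈ l', b ∈ l a) →
      esize (l'.foldl (f a) s) ≤ esize s + l'.length * S (esize a + L (esize a)) := by
    intro l'
    induction l' with
    | nil => intro s _; simp
    | cons b l' ih =>
      intro s h
      have h1 := hb a s b
      have h2 := ih (f a s b) fun b hb => h b (List.mem_cons_of_mem _ hb)
      have h3 : S (esize a + esize b) ≤ S (esize a + L (esize a)) :=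
        hS.1 (Nat.add_le_add_left ((esize_le_of_mem (h b List.mem_cons_self)).trans (hls a)) _)
      rw [List.foldl_cons, List.length_cons, Nat.add_mul]
      omega
  refine (key l' (z a) fun b hb => hl'.subset hb).trans (add_le_add (hzs a) ?_)
  exact Nat.mul_le_mul_right _ ((hl'.length_le.trans (length_le_esize _)).trans (hls a))

@[fun_prop]
theorem cons {f : α → β} {l : α → List β} (hf : Poly f) (hl : Poly l) :
    Poly fun a => f a :: l a :=
  (mk hf hl).of_enc_eq (fun a => a) (fun _ => rfl) (fun _ => rfl)

@[fun_prop]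
theorem reverse {l : α → List β} (hl : Poly l) : Poly fun a => (l a).reverse := by
  have h : Poly fun a => (l a).foldl (fun s b => b :: s) [] :=
    foldl_add (f := fun _ s b => b :: s) (by fun_prop) hl (by fun_prop) (S := fun n => n + 1)
      (by fun_prop) (fun a s b => by rw [esize_cons]; omega)
  simpa using h

/-- Right folds in which every step adds at most an amount bounded in terms of the parameter and
the list element. -/
theorem foldr_add {f : α → β → σ → σ} {l : α → List β} {z : α → σ}
    (hf : Poly fun p : (α × σ) × β => f p.1.1 p.2 p.1.2) (hl : Poly l) (hz : Poly z)
    {S : ℕ → ℕ} (hS : Bd S) (hb : ∀ a s b, esize (f a b s) ≤ esize s + S (esize a + esize b)) :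
    Poly fun a => (l a).foldr (f a) (z a) := by
  simp only [List.foldr_eq_foldl_reverse]
  exact foldl_add (f := fun a s b => f a b s) hf (reverse hl) hz hS hb

@[fun_prop]
theorem append {f g : α → List β} (hf : Poly f) (hg : Poly g) : Poly fun a => f a ++ g a := by
  have h : Poly fun a => (f a).foldr (fun b s => b :: s) (g a) :=
    foldr_add (f := fun _ b s => b :: s) (by fun_prop) hf hg (S := fun n => n + 1)
      (by fun_prop) (fun a s b => by rw [esize_cons]; omega)
  simpa using h

@[fun_prop]
theorem flatMap {f : α → β → List γ} {l : α → List β} (hf : Poly fun p : α × β => f p.1 p.2)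
    (hl : Poly l) : Poly fun a => (l a).flatMap (f a) := by
  have ⟨T, hT, hs, _⟩ := hf
  have h : Poly fun a => (l a).foldr (fun b s => f a b ++ s) [] := by
    refine foldr_add (f := fun a b s => f a b ++ s) ?_ hl (by fun_prop) (S := fun n => T (n + 1))
      (by fun_prop) (fun a s b => ?_)
    · exact append (comp (f := fun p : α × β => f p.1 p.2) hf
        (g := fun p : (α × List γ) × β => (p.1.1, p.2)) (by fun_prop)) (by fun_prop)
    · have := hs (a, b)
      rw [esize_prod] at this
      have := esize_append (f a b) s
      dsimp only at *
      omega
  refine h.of_enc_eq (fun a => a) (fun _ => rfl) (fun a => congrArg enc ?_)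
  induction l a with
  | nil => rfl
  | cons b l ih => rw [List.foldr_cons, ih, List.flatMap_cons]

@[fun_prop]
theorem map {f : α → β → γ} {l : α → List β} (hf : Poly fun p : α × β => f p.1 p.2)
    (hl : Poly l) : Poly fun a => (l a).map (f a) := by
  have h : Poly fun a => (l a).flatMap fun b => [f a b] := by fun_prop
  refine h.of_enc_eq (fun a => a) (fun _ => rfl) (fun a => congrArg enc ?_)
  induction l a with
  | nil => rfl
  | cons b l ih => rw [List.flatMap_cons, ih]; rfl

@[fun_prop]
theorem filter {p : α → β → Bool} {l : α → List β} (hp : Poly fun q : α × β => p q.1 q.2)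
    (hl : Poly l) : Poly fun a => (l a).filter (p a) := by
  have h : Poly fun a => (l a).flatMap fun b => bif p a b then [b] else [] := by fun_prop
  refine h.of_enc_eq (fun a => a) (fun _ => rfl) (fun a => congrArg enc ?_)
  induction l a with
  | nil => rfl
  | cons b l ih => rw [List.flatMap_cons, List.filter_cons, ih]; cases p a b <;> simp

@[fun_prop]
theorem not {p : α → Bool} (hp : Poly p) : Poly fun a => !p a := by
  have h : Poly fun a => bif p a then false else true := by fun_prop
  refine h.of_enc_eq (fun a => a) (fun _ => rfl) (fun a => congrArg enc ?_)
  cases p a <;> rfl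

@[fun_prop]
theorem and {p q : α → Bool} (hp : Poly p) (hq : Poly q) : Poly fun a => p a && q a := by
  have h : Poly fun a => bif p a then q a else false := by fun_prop
  refine h.of_enc_eq (fun a => a) (fun _ => rfl) (fun a => congrArg enc ?_)
  cases p a <;> rfl

@[fun_prop]
theorem or {p q : α → Bool} (hp : Poly p) (hq : Poly q) : Poly fun a => p a || q a := by
  have h : Poly fun a => bif p a then true else q a := by fun_prop
  refine h.of_enc_eq (fun a => a) (fun _ => rfl) (fun a => congrArg enc ?_)
  cases p a <;> rfl

@[fun_prop]
theorem isEmpty {l : α → List β} (hl : Poly l) : Poly fun a => (l a).isEmpty := by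
  have h : Poly fun a => CCBackdoor.eqb (l a) [] := by fun_prop
  refine h.of_enc_eq (fun a => a) (fun _ => rfl) (fun a => congrArg enc ?_)
  rw [Bool.eq_iff_iff, eqb_iff, List.isEmpty_iff]

@[fun_prop]
theorem any {p : α → β → Bool} {l : α → List β} (hp : Poly fun q : α × β => p q.1 q.2)
    (hl : Poly l) : Poly fun a => (l a).any (p a) := by
  have h : Poly fun a => !((l a).filter (p a)).isEmpty := by fun_prop
  refine h.of_enc_eq (fun a => a) (fun _ => rfl) (fun a => congrArg enc ?_)
  rw [Bool.eq_iff_iff]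
  simp

@[fun_prop]
theorem all {p : α → β → Bool} {l : α → List β} (hp : Poly fun q : α × β => p q.1 q.2)
    (hl : Poly l) : Poly fun a => (l a).all (p a) := by
  have h : Poly fun a => ((l a).filter fun b => !p a b).isEmpty := by fun_prop
  refine h.of_enc_eq (fun a => a) (fun _ => rfl) (fun a => congrArg enc ?_)
  rw [Bool.eq_iff_iff]
  simp

@[fun_prop]
theorem tail {l : α → List β} (hl : Poly l) : Poly fun a => (l a).tail :=
  comp (f := List.tail) (sndD.of_enc_eq enc (fun _ => rfl) fun l => by cases l <;> rfl) hl

@[fun_prop]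
theorem headD {l : α → List β} {d : α → β} (hl : Poly l) (hd : Poly d) :
    Poly fun a => (l a).headD (d a) := by
  have h : Poly fun a => bif (l a).isEmpty then enc (d a) else (enc (l a)).fst :=
    cond (by fun_prop) (hd.of_enc_eq (fun a => a) (fun _ => rfl) fun _ => rfl)
      (comp fstD (hl.of_enc_eq (fun a => a) (fun _ => rfl) fun _ => rfl))
  refine h.of_enc_eq (fun a => a) (fun _ => rfl) (fun a => ?_)
  cases l a <;> rfl

/-- Membership as a Boolean. -/
noncomputable def _root_.CCBackdoor.memb (b : β) (l : List β) : Bool :=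
  l.any fun c => CCBackdoor.eqb b c

@[simp] theorem _root_.CCBackdoor.memb_iff {b : β} {l : List β} : memb b l = true ↔ b ∈ l := by
  simp [memb]

@[fun_prop]
theorem memb {f : α → β} {l : α → List β} (hf : Poly f) (hl : Poly l) :
    Poly fun a => memb (f a) (l a) := by
  unfold CCBackdoor.memb
  fun_prop

end Poly

instance : Enc Unit := ⟨fun _ => .nil, fun _ _ _ => rfl⟩

/-- Natural numbers are written in unary. -/
instance : Enc ℕ where
  enc n := enc (List.replicate n ())
  inj a b h := by simpa using congrArg List.length (Enc.inj h)

/-- Optional values are written as lists of length at most one. -/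
instance : Enc (Option α) where
  enc o := enc o.toList
  inj a b h := by
    have := Enc.inj h
    cases a <;> cases b <;> simp_all

theorem esize_nat (n : ℕ) : esize n = 2 * n + 1 := by
  induction n with
  | zero => rfl
  | succ n ih =>
    have : esize (n + 1) = 1 + esize n + 1 := BTree.size_cons _ _
    omega

namespace Poly

@[fun_prop]
theorem length {l : α → List β} (hl : Poly l) : Poly fun a => (l a).length := by
  have h : Poly fun a => (l a).map fun _ => () := by fun_prop
  refine h.of_enc_eq (fun a => a) (fun _ => rfl) (fun a => ?_)
  rw [List.map_const']
  rfl

@[fun_prop]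
theorem replicate {n : α → ℕ} {b : α → β} (hn : Poly n) (hb : Poly b) :
    Poly fun a => List.replicate (n a) (b a) := by
  have h : Poly fun a => (List.replicate (n a) ()).map fun _ => b a :=
    map (by fun_prop) (hn.of_enc_eq (fun a => a) (fun _ => rfl) fun _ => rfl)
  simpa using h

@[fun_prop]
theorem natAdd {n m : α → ℕ} (hn : Poly n) (hm : Poly m) : Poly fun a => n a + m a := by
  have h : Poly fun a => (List.replicate (n a) () ++ List.replicate (m a) ()).length := by fun_prop
  simpa using h

@[fun_prop]
theorem natMul {n m : α → ℕ} (hn : Poly n) (hm : Poly m) : Poly fun a => n a * m a := by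
  have h : Poly fun a => ((List.replicate (n a) ()).flatMap fun _ =>
    List.replicate (m a) ()).length := by fun_prop
  simpa [List.length_flatMap] using h

@[fun_prop]
theorem range {n : α → ℕ} (hn : Poly n) : Poly fun a => List.range (n a) := by
  have h : Poly fun a => ((List.replicate (n a) ()).foldl
      (fun (s : List ℕ) _ => s.length :: s) []).reverse := by
    refine reverse (foldl_of_bd (f := fun _ (s : List ℕ) _ => s.length :: s) (by fun_prop)
      (by fun_prop) (by fun_prop) (S := fun n => 2 * (n * n) + 2 * n + 2) (by fun_prop) ?_) |>.comp
      hn (f := fun n => ((List.replicate n ()).foldl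
        (fun (s : List ℕ) _ => s.length :: s) []).reverse)
    intro n l' hl'
    have key : ∀ (l : List Unit) (s : List ℕ),
        esize (l.foldl (fun (s : List ℕ) _ => s.length :: s) s) ≤
          esize s + l.length * (2 * (s.length + l.length) + 2) := by
      intro l
      induction l with
      | nil => intro s; simp
      | cons u l ih =>
        intro s
        refine (ih _).trans ?_
        rw [esize_cons, esize_nat]
        simp only [List.length_cons]
        nlinarith
    have h := key l' []
    have := hl'.length_le
    rw [List.length_replicate] at this
    rw [esize_nat]
    rw [esize_nil, List.length_nil] at h
    nlinarith
  refine h.of_enc_eq (fun a => a) (fun _ => rfl) (fun a => congrArg enc ?_)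
  have key : ∀ n, (List.replicate n ()).foldl (fun (s : List ℕ) _ => s.length :: s) [] =
      (List.range n).reverse := by
    intro n
    induction n with
    | zero => rfl
    | succ n ih =>
      rw [List.replicate_succ', List.foldl_append, ih, List.range_succ]
      simp
  rw [key, List.reverse_reverse]

@[fun_prop]
theorem blt {n m : α → ℕ} (hn : Poly n) (hm : Poly m) : Poly fun a => Nat.blt (n a) (m a) := by
  have h : Poly fun a => CCBackdoor.memb (n a) (List.range (m a)) := by fun_prop
  refine h.of_enc_eq (fun a => a) (fun _ => rfl) (fun a => congrArg enc ?_)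
  rw [Bool.eq_iff_iff, memb_iff, List.mem_range, Nat.blt_eq]

@[fun_prop]
theorem drop {n : α → ℕ} {l : α → List β} (hn : Poly n) (hl : Poly l) :
    Poly fun a => (l a).drop (n a) := by
  have h : Poly fun a => (List.replicate (n a) ()).foldl (fun s _ => s.tail) (l a) :=
    foldl_add (f := fun _ (s : List β) (_ : Unit) => s.tail) (by fun_prop) (by fun_prop) hl
      (S := fun _ => 0) (by fun_prop) (fun a s b => esize_le_of_sublist (List.tail_sublist s))
  refine h.of_enc_eq (fun a => a) (fun _ => rfl) (fun a => congrArg enc ?_)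
  generalize l a = l
  induction n a generalizing l with
  | zero => rfl
  | succ n ih => rw [List.replicate_succ, List.foldl_cons, ih, List.drop_tail]

@[fun_prop]
theorem getD {l : α → List β} {n : α → ℕ} {d : α → β} (hl : Poly l) (hn : Poly n) (hd : Poly d) :
    Poly fun a => (l a).getD (n a) (d a) := by
  have h : Poly fun a => ((l a).drop (n a)).headD (d a) := by fun_prop
  refine h.of_enc_eq (fun a => a) (fun _ => rfl) (fun a => congrArg enc ?_)
  rw [List.headD_eq_head?_getD, List.head?_drop, List.getD_eq_getElem?_getD]

@[fun_prop]
theorem some {f : α → β} (hf : Poly f) : Poly fun a => some (f a) := by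
  have h : Poly fun a => [f a] := by fun_prop
  exact h.of_enc_eq (fun a => a) (fun _ => rfl) (fun _ => rfl)

@[fun_prop]
theorem toList {o : α → Option β} (ho : Poly o) : Poly fun a => (o a).toList :=
  ho.of_enc_eq (fun a => a) (fun _ => rfl) (fun _ => rfl)

@[fun_prop]
theorem head? {l : α → List β} (hl : Poly l) : Poly fun a => (l a).head? := by
  have h : Poly fun a => bif (l a).isEmpty then ([] : List BTree) else [(enc (l a)).fst] :=
    cond (by fun_prop) (by fun_prop) (cons (comp fstD (hl.of_enc_eq (fun a => a)
      (fun _ => rfl) fun _ => rfl)) (by fun_prop))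
  refine h.of_enc_eq (fun a => a) (fun _ => rfl) (fun a => ?_)
  cases l a <;> rfl

open Classical in
/-- A function that is given on finitely many arguments and constant elsewhere is computable in
polynomial time, by comparison with these arguments. -/
theorem of_list_match (L : List β) (f : β → γ) (d : γ) :
    ∃ g : β → γ, Poly g ∧ (∀ b ∈ L, g b = f b) ∧ ∀ b ∉ L, g b = d := by
  induction L with
  | nil => exact ⟨fun _ => d, by fun_prop, by simp, by simp⟩
  | cons b L ih =>
    obtain ⟨g, hg, h, h'⟩ := ih
    have key : ∀ c, (bif CCBackdoor.eqb c b then f b else g c) = if c = b then f c else g c := by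
      intro c
      by_cases hcb : c = b
      · simp [hcb, eqb_iff.2]
      · have : CCBackdoor.eqb c b = false := by simpa [← Bool.not_eq_true] using hcb
        simp [this, hcb]
    refine ⟨fun c => bif CCBackdoor.eqb c b then f b else g c, by fun_prop, fun c hc => ?_,
      fun c hc => ?_⟩
    · beta_reduce
      rw [key]
      split
      · rfl
      · exact h c ((List.mem_cons.1 hc).resolve_left ‹_›)
    · rw [List.mem_cons, not_or] at hc
      beta_reduce
      rw [key, if_neg hc.1, h' c hc.2]

/-- Functions that are constant outside a finite set are computable in polynomial time. -/
theorem of_finite_support {f : β → γ} {d : γ} {s : Set β} (hs : s.Finite) (h : ∀ b ∉ s, f b = d) :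
    Poly f := by
  obtain ⟨g, hg, h1, h2⟩ := of_list_match hs.toFinset.toList f d
  have : g = f := by
    funext b
    by_cases hb : b ∈ s
    · exact h1 b (by simpa using hb)
    · rw [h2 b (by simpa using hb), h b hb]
  exact this ▸ hg

/-- Every function on a finite type is computable in polynomial time, by inspection of all
arguments. -/
theorem of_finite [Finite β] (f : β → γ) : Poly f := by
  cases nonempty_fintype β
  rcases isEmpty_or_nonempty β with h | ⟨⟨b⟩⟩
  · refine ⟨fun n => n, by fun_prop, fun b => isEmptyElim b, fun A C N =>
      ⟨.pop .u fun s _ => s, fun b => isEmptyElim b⟩⟩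
  · obtain ⟨g, hg, h, -⟩ := of_list_match Finset.univ.toList f (f b)
    exact (funext fun b => h b (by simp) : g = f) ▸ hg

end Poly

end

/-- The index of an element of a finite type. -/
noncomputable def finIdx {α : Type} [Finite α] (a : α) : ℕ := (Finite.equivFin α a).val

theorem finIdx_injective {α : Type} [Finite α] : Function.Injective (finIdx : α → ℕ) :=
  fun _ _ h => (Finite.equivFin α).injective (Fin.ext h)

theorem finIdx_lt {α : Type} [Finite α] (a : α) : finIdx a < Nat.card α := (Finite.equivFin α a).2

/-- Elements of a finite type are represented by their index. -/
noncomputable abbrev Enc.ofFinite (α : Type) [Finite α] : Enc α where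
  enc a := enc (finIdx a)
  inj _ _ h := finIdx_injective (Enc.inj h)

end CCBackdoor

namespace CCBackdoor

open Enc (enc)

/-! ### Reading the input and writing the output -/

section

variable {A C : Type} {N : ℕ}

namespace Prog

/-- The number modulo `N + 1`, as a value of the counter. -/
def low (n : ℕ) : Fin (N + 1) := Fin.ofNat (N + 1) n

/-- Puts the number in the counter of the control memory on top of `m`. -/
def putNat : Prog A C N := .seq (.push .m fun _ => false)
  (.loop .c (fun s _ => decide (0 < s.n.val))
  (.seq (.push .m fun _ => false) (.seq (.push .m fun _ => true)
    (.pop .u fun s _ => { s with n := low (s.n.val - 1) }))))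

theorem run_putNat (i : List A) (o : List C) (m : List Bool) (s : St N) :
    ∃ s', RunLe putNat ⟨s, i, o, m, [], [], []⟩ (4 * s.n.val + 2)
      ⟨s', i, o, (enc s.n.val).toks ++ m, [], [], []⟩ := by
  have key : ∀ (n k : ℕ) (s : St N), s.n.val = n → ∃ s',
      RunLe (.loop .c (fun s _ => decide (0 < s.n.val))
        (.seq (.push .m fun _ => false) (.seq (.push .m fun _ => true)
        (.pop .u fun s _ => { s with n := low (s.n.val - 1) }))))
        ⟨s, i, o, (enc k).toks ++ m, [], [], []⟩ (4 * n + 1)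
        ⟨s', i, o, (enc (k + n)).toks ++ m, [], [], []⟩ := by
    intro n
    induction n with
    | zero => exact fun k s hs => ⟨s, (Run.loop_false (by simp [hs])).le (by omega)⟩
    | succ n ih =>
      intro k s hs
      have hn : n < N + 1 := by have := s.n.2; omega
      obtain ⟨s', k', hk', h⟩ := ih (k + 1) { s with n := low (s.n.val - 1) }
        (by simp [low, hs, Nat.mod_eq_of_lt hn])
      rw [show k + 1 + n = k + (n + 1) by omega] at h
      refine ⟨s', _, ?_, Run.loop_true (by simp [hs]) ((Run.push .m (fun _ => false) _).seq
        ((Run.push .m (fun _ => true) _).seq (Run.pop .u _ _))) h⟩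
      omega
  obtain ⟨s', h⟩ := key s.n.val 0 s rfl
  rw [Nat.zero_add] at h
  exact ⟨s', (((Run.push .m _ _).le le_rfl).seq h).mono (by omega)⟩

/-- Reads the input; the representation of the reversed input list ends up on `m`. -/
noncomputable def readInput [Finite A] : Prog A C N := .seq (.push .m fun _ => false)
  (.loop .inp nonempty
  (.seq (.pop .inp fun s o => { s with n := low (o.elim 0 finIdx) })
    (.seq putNat (.push .m fun _ => true))))

theorem run_readInput [Finite A] (hN : Nat.card A ≤ N) (w : List A) (s : St N) :
    ∃ s', RunLe (C := C) readInput ⟨s, w, [], [], [], [], []⟩ ((4 * N + 5) * w.length + 2)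
      ⟨s', [], [], (enc (w.reverse.map finIdx)).toks, [], [], []⟩ := by
  have key : ∀ (w : List A) (l : List ℕ) (s : St N), ∃ s', RunLe (C := C) (.loop .inp nonempty
      (.seq (.pop .inp fun s o => { s with n := low (o.elim 0 finIdx) })
      (.seq putNat (.push .m fun _ => true)))) ⟨s, w, [], (enc l).toks, [], [], []⟩
      ((4 * N + 5) * w.length + 1)
      ⟨s', [], [], (enc (w.reverse.map finIdx ++ l)).toks, [], [], []⟩ := by
    intro w
    induction w with
    | nil => exact fun l s => ⟨s, (Run.loop_false rfl).le (by simp)⟩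
    | cons a w ih =>
      intro l s
      have hv : (low (finIdx a) : Fin (N + 1)).val = finIdx a := by
        have := finIdx_lt a
        exact Nat.mod_eq_of_lt (by omega)
      obtain ⟨s₁, n₁, hn₁, h₁⟩ := run_putNat (C := C) w [] (enc l).toks
        ({ s with n := low (finIdx a) } : St N)
      obtain ⟨s₂, n₂, hn₂, h₂⟩ := ih (finIdx a :: l) s₁
      simp only [hv] at h₁ hn₁
      have e : (enc (finIdx a :: l)).toks = true :: ((enc (finIdx a)).toks ++ (enc l).toks) := rfl
      rw [e] at h₂
      rw [List.reverse_cons, List.map_append, List.append_assoc, List.map_singleton,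
        List.singleton_append]
      refine ⟨s₂, _, ?_, Run.loop_true rfl ((Run.pop .inp _ _).seq (h₁.seq
        (Run.push .m (fun _ => true) _))) h₂⟩
      have := finIdx_lt a
      rw [List.length_cons, Nat.mul_add]
      omega
  obtain ⟨s', h⟩ := key w [] s
  rw [List.append_nil] at h
  exact ⟨s', (((Run.push .m _ _).le le_rfl).seq h).mono (by omega)⟩

/-- Writes the list on `m` to the output stack, last element first in the output. -/
noncomputable def writeOutput {C : Type} (g : ℕ → C) : Prog A C N := .seq (.loop .m topTrue
  (.seq (.pop .m fun s _ => { s with n := 0 })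
    (.seq (.loop .m topTrue (.seq (.pop .m fun s _ => { s with n := low (s.n.val + 1) })
      (.pop .m toR))) (.seq (.pop .m toR) (.push .out fun s => g s.n.val))))) (.pop .m toR)

theorem run_writeOutput {C : Type} [Finite C] (hN : Nat.card C ≤ N) {g : ℕ → C}
    (hg : ∀ c, g (finIdx c) = c) (l : List C) (s : St N) :
    ∃ s', RunLe (A := A) (writeOutput g) ⟨s, [], [], (enc (l.map finIdx)).toks, [], [], []⟩
      ((3 * N + 5) * l.length + 2) ⟨s', [], l.reverse, [], [], [], []⟩ := by
  have inner : ∀ (n k : ℕ) (o : List C) (m : List Bool) (s : St N), s.n.val + n = k → k ≤ N →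
      ∃ s', s'.n.val = k ∧ RunLe (A := A) (.loop .m topTrue (.seq
        (.pop .m fun s _ => { s with n := low (s.n.val + 1) }) (.pop .m toR)))
        ⟨s, [], o, (enc n).toks ++ m, [], [], []⟩ (3 * n + 1)
        ⟨s', [], o, false :: m, [], [], []⟩ := by
    intro n
    induction n with
    | zero => exact fun k o m s hs _ => ⟨s, hs, (Run.loop_false rfl).le (by omega)⟩
    | succ n ih =>
      intro k o m s hs hk
      obtain ⟨s', hs', n', hn', h⟩ := ih k o m
        { s with r := some false, n := low (s.n.val + 1) } (by
          have hlt : s.n.val + 1 < N + 1 := by omega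
          simp only [low, Fin.val_ofNat, Nat.mod_eq_of_lt hlt]
          omega) hk
      refine ⟨s', hs', _, ?_, Run.loop_true rfl ((Run.pop .m _ _).seq (Run.pop .m toR _)) h⟩
      omega
  have key : ∀ (l o : List C) (s : St N), ∃ s', RunLe (A := A) (.loop .m topTrue
      (.seq (.pop .m fun s _ => { s with n := 0 })
      (.seq (.loop .m topTrue (.seq (.pop .m fun s _ => { s with n := low (s.n.val + 1) })
      (.pop .m toR))) (.seq (.pop .m toR) (.push .out fun s => g s.n.val)))))
      ⟨s, [], o, (enc (l.map finIdx)).toks, [], [], []⟩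
      ((3 * N + 5) * l.length + 1) ⟨s', [], l.reverse ++ o, [false], [], [], []⟩ := by
    intro l
    induction l with
    | nil => exact fun o s => ⟨s, (Run.loop_false rfl).le (by simp)⟩
    | cons c l ih =>
      intro o s
      have hc := finIdx_lt c
      obtain ⟨s₁, hs₁, n₁, hn₁, h₁⟩ := inner (finIdx c) (finIdx c) o (enc (l.map finIdx)).toks
        { s with n := 0 } (by simp) (by omega)
      obtain ⟨s₂, n₂, hn₂, h₂⟩ := ih (c :: o) { s₁ with r := some false }
      have h₃ : Run (A := A) (.push .out fun s : St N => g s.n.val)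
          ⟨{ s₁ with r := some false }, [], o, (enc (l.map finIdx)).toks, [], [], []⟩ 1
          ⟨{ s₁ with r := some false }, [], g s₁.n.val :: o,
            (enc (l.map finIdx)).toks, [], [], []⟩ :=
        Run.push .out _ _
      rw [hs₁, hg] at h₃
      rw [List.reverse_cons, List.append_assoc, List.singleton_append]
      refine ⟨s₂, _, ?_, Run.loop_true rfl ((Run.pop .m _ _).seq (h₁.seq ((Run.pop .m toR _).seq
        h₃))) h₂⟩
      rw [List.length_cons, Nat.mul_add]
      omega
  obtain ⟨s', h⟩ := key l [] s
  rw [List.append_nil] at h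
  exact ⟨_, (h.seq ((Run.pop .m toR _).le le_rfl)).mono (by omega)⟩

end Prog

end

/-- The parameter-dependent factor in the time bounds is computable. -/
theorem computable_pow_bound (c : ℕ) : Computable fun k : ℕ => (2 * 4 ^ k + 2) ^ c := by
  have hpow : Primrec₂ fun a b : ℕ => a ^ b := Primrec₂.unpaired'.1 Nat.Primrec.pow
  refine Primrec.to_comp (hpow.comp (Primrec.nat_add.comp (Primrec.nat_mul.comp (Primrec.const 2)
    (hpow.comp (Primrec.const 4) Primrec.id)) (Primrec.const 2)) (Primrec.const c))

open Prog in
/-- A function of `(w, k)` is computable in FPT time if its output is a polynomial-time function of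
the input together with `4 ^ k` in unary. Both the input and the output are listed backwards, as
they come from and go to stacks. -/
theorem computableInFPTTime_of_poly {α β γ : Type} [Enc α] [Enc γ] [Finite α] [Finite γ]
    [Inhabited γ] {out : β → List γ} {g : List α × ℕ → β}
    {F : List (Option α) × ℕ → List γ} (hF : Poly F)
    (h : ∀ p, F ((pairCode p).reverse, 4 ^ p.2) = (out (g p)).reverse) :
    ComputableInFPTTime out g := by
  classical
  cases nonempty_fintype α
  -- Input symbols arrive as their indices, from which `dec` recovers them; `sym` does the same for
  -- output symbols.
  obtain ⟨dec, hdec, hdec'⟩ : ∃ dec : ℕ → Option α, Poly dec ∧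
      ∀ a : Option α, dec (finIdx a) = a := by
    obtain ⟨dec, hdec, h, -⟩ := Poly.of_list_match
      ((Finset.univ : Finset (Option α)).toList.map finIdx)
      (fun n => if h : ∃ a : Option α, finIdx a = n then h.choose else none) none
    refine ⟨dec, hdec, fun a => ?_⟩
    rw [h _ (by simp)]
    have h : ∃ b : Option α, finIdx b = finIdx a := ⟨a, rfl⟩
    rw [dif_pos h]
    exact finIdx_injective h.choose_spec
  obtain ⟨sym, hsym⟩ : ∃ sym : ℕ → γ, ∀ c, sym (finIdx c) = c := by
    refine ⟨Function.invFun finIdx, Function.leftInverse_invFun finIdx_injective⟩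
  set N := max (Nat.card (Option α)) (Nat.card γ) with hNdef
  have hidx : Poly (finIdx : γ → ℕ) := Poly.of_finite _
  have hw : Poly fun L : List ℕ => L.map dec := by fun_prop
  -- The three phases after reading: count the symbols `none`, which gives `k` in unary; multiply
  -- `1` by `4` exactly `k` times; apply `F`.
  have hQ1 : Poly fun L : List ℕ =>
      (List.replicate ((L.map dec).filter fun a => eqb a none).length (), (L.map dec, 1)) := by
    fun_prop
  have hQ3 : Poly fun x : List (Option α) × ℕ => (F x).map finIdx := by fun_prop
  obtain ⟨T2, hT2, hq2⟩ := Poly.exists_foldl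
    (f := fun (s : List (Option α) × ℕ) (_ : Unit) => (s.1, s.2 + s.2 + s.2 + s.2)) (by fun_prop)
  obtain ⟨W, hW, hWs, -⟩ := hw
  obtain ⟨T1, hT1, -, hq1⟩ := hQ1
  obtain ⟨T3, hT3, hT3s, hq3⟩ := hQ3
  obtain ⟨q1, hq1⟩ := hq1 (Option α) γ N
  obtain ⟨q2, hq2⟩ := hq2 (Option α) γ N
  obtain ⟨q3, hq3⟩ := hq3 (Option α) γ N
  -- The sum of the time bounds of all phases, with `X = |w| + k + 4 ^ k` as argument.
  have hP : Bd fun X => (4 * N + 5) * X + 2 + (T1 ((2 * N + 2) * X + 1) +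
      (T2 (2 * X + 1 + (W ((2 * N + 2) * X + 1) + 2 * X + 2)) +
      (T3 (W ((2 * N + 2) * X + 1) + 2 * X + 2) +
      ((3 * N + 5) * T3 (W ((2 * N + 2) * X + 1) + 2 * X + 2) + 2)))) + 1 := by fun_prop
  obtain ⟨-, c, hc⟩ := hP
  let P : Prog (Option α) γ N := .seq readInput (.seq q1 (.seq q2 (.seq q3 (writeOutput sym))))
  refine ⟨_, c, ⟨P.machine, Equiv.refl _, Equiv.refl _⟩, computable_pow_bound c, fun p => ?_⟩
  have e1 : List.map (Equiv.refl (Option α)).invFun (pairCode p) = pairCode p := List.map_id _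
  have e2 : List.map (Equiv.refl γ).invFun (out (g p)) = out (g p) := List.map_id _
  suffices H : Nonempty (Turing.TM2OutputsInTime P.machine (pairCode p) (some (out (g p)))
      ((2 * 4 ^ p.2 + 2) ^ c * (p.1.length + 1) ^ c)) from
    (congrArg₂ (fun a b => Nonempty (Turing.TM2OutputsInTime P.machine a (some b)
      ((2 * 4 ^ p.2 + 2) ^ c * (p.1.length + 1) ^ c))) e1 e2).mpr H
  clear e1 e2
  obtain ⟨w, k⟩ := p
  set n := w.length with hn
  set X := n + k + 4 ^ k with hX
  have hlen : (pairCode (w, k)).length = n + k := by simp [pairCode, hn]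
  set L := (pairCode (w, k)).reverse.map finIdx with hL
  have hLw : L.map dec = (pairCode (w, k)).reverse := by
    rw [hL, List.map_map]
    conv_rhs => rw [← List.map_id (pairCode (w, k)).reverse]
    exact List.map_congr_left fun a _ => hdec' a
  have hk : ((L.map dec).filter fun a => eqb a none).length = k := by
    rw [hLw, List.filter_reverse, List.length_reverse, pairCode, List.filter_append]
    have h1 : (w.map some).filter (fun a => eqb a none) = [] := by simp [eqb]
    have h2 : (List.replicate k (none : Option α)).filter (fun a => eqb a none) =
      List.replicate k none := by simp [eqb]
    rw [h1, h2]
    simp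
  have hLs : esize L ≤ (2 * N + 2) * X + 1 := by
    have key : ∀ l : List ℕ, (∀ a ∈ l, a ≤ N) → esize l ≤ (2 * N + 2) * l.length + 1 := by
      intro l
      induction l with
      | nil => simp
      | cons a l ih =>
        intro h
        have h1 := h a (by simp)
        have h2 := ih fun b hb => h b (by simp [hb])
        rw [esize_cons, esize_nat, List.length_cons, Nat.mul_add]
        omega
    refine (key L fun a ha => ?_).trans ?_
    · obtain ⟨b, -, rfl⟩ := List.mem_map.1 ha
      exact (finIdx_lt b).le.trans (le_max_left _ _)
    · have : L.length ≤ X := by simp [hL, hlen, hX]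
      gcongr
  have hws : esize (L.map dec) ≤ W ((2 * N + 2) * X + 1) := (hWs L).trans (hW.1 hLs)
  have hfold : ∀ (l : List Unit) (a : ℕ), l.foldl
      (fun (s : List (Option α) × ℕ) (_ : Unit) => (s.1, s.2 + s.2 + s.2 + s.2)) (L.map dec, a) =
      (L.map dec, a * 4 ^ l.length) := by
    intro l
    induction l with
    | nil => simp
    | cons b l ih =>
      intro a
      rw [List.foldl_cons, ih, List.length_cons, pow_succ]
      congr 1
      ring
  have h4k : k < 4 ^ k := Nat.lt_pow_self (by norm_num)
  have hVs : esize (L.map dec, 4 ^ k) ≤ W ((2 * N + 2) * X + 1) + 2 * X + 2 := by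
    rw [esize_prod, esize_nat]
    dsimp only
    omega
  obtain ⟨s₁, h₁⟩ := run_readInput (C := γ) (N := N) (le_max_left _ _) (pairCode (w, k)) (St.init N)
  obtain ⟨s₂, h₂⟩ := hq1 L s₁ [] [] []
  obtain ⟨s₃, h₃⟩ := hq2 (List.replicate k ()) (L.map dec, 1)
    (W ((2 * N + 2) * X + 1) + 2 * X + 2) (fun l' hl' => by
      rw [hfold, one_mul]
      have hlk : l'.length ≤ k := by simpa using hl'.length_le
      have : 4 ^ l'.length ≤ 4 ^ k := Nat.pow_le_pow_right (by norm_num) hlk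
      rw [esize_prod, esize_nat] at hVs ⊢
      dsimp only at *
      omega) s₂ [] [] []
  obtain ⟨s₄, h₄⟩ := hq3 (L.map dec, 4 ^ k) s₃ [] [] []
  obtain ⟨s₅, h₅⟩ := run_writeOutput (A := Option α) (N := N) (le_max_right _ _) hsym
    (F (L.map dec, 4 ^ k)) s₄
  beta_reduce at h₂ h₄
  rw [hk] at h₂
  rw [hfold, List.length_replicate, one_mul] at h₃
  simp only [List.append_nil] at h₂ h₃ h₄
  rw [hLw, h, List.reverse_reverse] at h₅
  rw [hLw, h] at h₄
  rw [hLw] at h₂ h₃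
  obtain ⟨m, hm, hrun⟩ := h₁.seq (h₂.seq (h₃.seq (h₄.seq h₅)))
  refine hrun.outputs ?_
  have b1 : (4 * N + 5) * (pairCode (w, k)).length ≤ (4 * N + 5) * X := by
    rw [hlen]; gcongr; omega
  have b2 : T1 (esize L) ≤ T1 ((2 * N + 2) * X + 1) := hT1.1 hLs
  have b3 : T2 (esize (List.replicate k ()) + (W ((2 * N + 2) * X + 1) + 2 * X + 2)) ≤
      T2 (2 * X + 1 + (W ((2 * N + 2) * X + 1) + 2 * X + 2)) := hT2.1 (by
    have : esize (List.replicate k ()) = esize k := rfl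
    rw [this, esize_nat]
    omega)
  rw [hLw] at hVs
  have b4 : T3 (esize ((pairCode (w, k)).reverse, 4 ^ k)) ≤
    T3 (W ((2 * N + 2) * X + 1) + 2 * X + 2) := hT3.1 hVs
  have b5 : (out (g (w, k))).length ≤ T3 (W ((2 * N + 2) * X + 1) + 2 * X + 2) := by
    have := (Poly.length_le_esize _).trans ((hT3s ((pairCode (w, k)).reverse, 4 ^ k)).trans b4)
    rwa [List.length_map, h, List.length_reverse] at this
  have b6 := Nat.mul_le_mul_left (3 * N + 5) b5
  have b7 := hc X
  beta_reduce at b7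
  -- `X + 2 ≤ (2 * 4 ^ k + 2) * (n + 1)` separates the parameter from the input length.
  have b8 : (X + 2) ^ c ≤ (2 * 4 ^ k + 2) ^ c * (n + 1) ^ c := by
    rw [← mul_pow]
    refine Nat.pow_le_pow_left ?_ _
    nlinarith [Nat.zero_le (n * 4 ^ k)]
  rw [List.length_reverse] at hm
  dsimp only at hm ⊢
  omega

end CCBackdoor

namespace CCBackdoor

open Enc (enc)

/-- A function of `(w, k)` is computable in FPT time if its output is a polynomial-time function of
`(w, k)` and `4 ^ k` in unary. -/
theorem computableInFPTTime_of_poly_pow {α β γ : Type} [Enc α] [Enc γ] [Finite α] [Finite γ]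
    [Inhabited γ] {out : β → List γ} {g : List α × ℕ → β}
    {F : (List α × ℕ) × ℕ → List γ} (hF : Poly F)
    (h : ∀ p, F (p, 4 ^ p.2) = out (g p)) : ComputableInFPTTime out g := by
  refine computableInFPTTime_of_poly (F := fun x => (F ((x.1.reverse.flatMap Option.toList,
    (x.1.filter fun a => eqb a none).length), x.2)).reverse) (by fun_prop) fun p => ?_
  obtain ⟨w, k⟩ := p
  have h1 : (pairCode (w, k)).reverse.reverse.flatMap Option.toList = w := by
    rw [List.reverse_reverse, pairCode, List.flatMap_append]
    have h1 : (w.map some).flatMap Option.toList = w := by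
      rw [List.flatMap_map]
      exact List.flatMap_singleton' w
    have h2 : (List.replicate k (none : Option α)).flatMap Option.toList = [] := by
      simp [List.flatMap_eq_nil_iff]
    rw [h1, h2, List.append_nil]
  have h2 : ((pairCode (w, k)).reverse.filter fun a => eqb a none).length = k := by
    rw [List.filter_reverse, List.length_reverse, pairCode, List.filter_append]
    have h1 : (w.map some).filter (fun a => eqb a none) = [] := by simp [eqb]
    have h2 : (List.replicate k (none : Option α)).filter (fun a => eqb a none) =
      List.replicate k none := by simp [eqb]
    rw [h1, h2]
    simp
  dsimp only
  rw [h1, h2, h]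

/-! ### Raw instances and parsing -/

instance : Finite Quant :=
  Finite.of_surjective (fun b : Bool => cond b Quant.all Quant.ex) fun q => by
    cases q
    · exact ⟨true, rfl⟩
    · exact ⟨false, rfl⟩

noncomputable instance : Enc Quant := Enc.ofFinite _

/-- A literal over the variables `x₀, x₁, …`; `(true, v)` is the literal `xᵥ`. -/
abbrev Lit := Bool × ℕ

/-- A constraint without its guarantees: `none` for a clause, `some R` for an application of `R`,
with the list of literals. The signs are meaningless in an application. -/
abbrev RawC (Γ : Set BoolRel) := Option Γ × List Lit

/-- An instance without its guarantees: quantifiers, constraints, backdoor. -/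
abbrev Raw (Γ : Set BoolRel) := List Quant × List (RawC Γ) × List ℕ

section

variable {Γ : Set BoolRel}

instance [Finite Γ] : Finite (Sym Γ) :=
  Finite.of_surjective (fun x : (Quant ⊕ Bool) ⊕ (Γ ⊕ Fin 4) => match x with
    | .inl (.inl q) => Sym.quant q
    | .inl (.inr b) => Sym.lit b
    | .inr (.inl R) => Sym.rel R
    | .inr (.inr 0) => Sym.clause
    | .inr (.inr 1) => Sym.var
    | .inr (.inr 2) => Sym.tick
    | .inr (.inr 3) => Sym.backdoor) fun s => by
    cases s with
    | quant q => exact ⟨.inl (.inl q), rfl⟩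
    | clause => exact ⟨.inr (.inr 0), rfl⟩
    | lit b => exact ⟨.inl (.inr b), rfl⟩
    | rel R => exact ⟨.inr (.inl R), rfl⟩
    | var => exact ⟨.inr (.inr 1), rfl⟩
    | tick => exact ⟨.inr (.inr 2), rfl⟩
    | backdoor => exact ⟨.inr (.inr 3), rfl⟩

noncomputable instance [Finite Γ] : Enc (Sym Γ) := Enc.ofFinite _

noncomputable instance [Finite Γ] : Enc Γ := Enc.ofFinite _

/-- The symbol that opens a constraint. -/
def headSym : Option Γ → Sym Γ
  | none => .clause
  | some R => .rel R

/-- The symbol that opens a literal of a clause or an argument of an application. -/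
def entrySym : Option Γ × Bool → Sym Γ
  | (none, b) => .lit b
  | (some _, _) => .var

/-- The string for a raw constraint, as in `Constraint.encode`. -/
def RawC.encode (c : RawC Γ) : List (Sym Γ) :=
  headSym c.1 :: c.2.flatMap fun p => entrySym (c.1, p.1) :: List.replicate p.2 .tick

/-- The string for a raw instance, as in `Instance.encode`. -/
def Raw.encode (r : Raw Γ) : List (Sym Γ) :=
  r.1.map .quant ++ r.2.1.flatMap RawC.encode ++
    .backdoor :: r.2.2.flatMap fun v => .var :: List.replicate v .tick

@[fun_prop]
theorem Raw.encode_poly [Finite Γ] : Poly (Raw.encode : Raw Γ → _) := by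
  have h1 : Poly (headSym : Option Γ → Sym Γ) := Poly.of_finite _
  have h2 : Poly (entrySym : Option Γ × Bool → Sym Γ) := Poly.of_finite _
  have h3 : Poly (Sym.quant : Quant → Sym Γ) := Poly.of_finite _
  unfold Raw.encode RawC.encode
  fun_prop

/-- The raw form of a constraint. -/
def Constraint.raw {n : ℕ} : Constraint Γ n → RawC Γ
  | .clause l => (none, l.map fun p => (p.1, p.2.val))
  | .app R x => (some R, (List.ofFn x).map fun v => (true, v.val))

/-- The raw form of an instance. -/
def Instance.raw (I : Instance Γ) : Raw Γ :=
  (List.ofFn I.quant, I.constraints.map Constraint.raw, I.backdoor.map fun v => v.val)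

theorem Constraint.encode_raw {n : ℕ} (c : Constraint Γ n) : c.raw.encode = c.encode := by
  cases c <;>
    simp [raw, RawC.encode, encode, headSym, entrySym, encodeVar, List.flatMap_map, -List.map_ofFn]

theorem Instance.encode_raw (I : Instance Γ) : I.raw.encode = I.encode := by
  simp only [raw, Raw.encode, encode, List.flatMap_map, encodeVar, Constraint.encode_raw]

/-! A string is cut into groups: a head symbol with a list of entries, each of which is an entry
symbol followed by ticks. -/

/-- The symbols that open an entry. -/
def isEntry : Sym Γ → Bool
  | .lit _ => true
  | .var => true
  | _ => false

/-- The symbol `tick`. -/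
def isTick : Sym Γ → Bool
  | .tick => true
  | _ => false

/-- One step of the tokenizer, which reads from the right: the state holds the ticks and the
entries waiting for their head, and the finished groups. -/
def tokStep (s : Sym Γ) (st : ℕ × List (Sym Γ × ℕ) × List (Sym Γ × List (Sym Γ × ℕ))) :
    ℕ × List (Sym Γ × ℕ) × List (Sym Γ × List (Sym Γ × ℕ)) :=
  bif isTick s then (st.1 + 1, st.2.1, st.2.2)
  else bif isEntry s then (0, (s, st.1) :: st.2.1, st.2.2)
  else (0, [], (s, st.2.1) :: st.2.2)

/-- The groups of a string. -/
def groups (w : List (Sym Γ)) : List (Sym Γ × List (Sym Γ × ℕ)) :=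
  (w.foldr tokStep (0, [], [])).2.2

/-- The quantifier that a head symbol stands for, if any. -/
def quantOf : Sym Γ → List Quant
  | .quant q => [q]
  | _ => []

/-- The kind of constraint that a head symbol opens, if any. -/
def headOf : Sym Γ → Option (Option Γ)
  | .clause => some none
  | .rel R => some (some R)
  | _ => none

/-- The sign of an entry, `true` for arguments of applications. -/
def signOf : Sym Γ → Bool
  | .lit b => b
  | _ => true

/-- The symbol that opens the backdoor. -/
def isBackdoor : Sym Γ → Bool
  | .backdoor => true
  | _ => false

/-- The raw instance that a string represents, if it represents one at all. -/
@[irreducible] def parse (w : List (Sym Γ)) : Raw Γ :=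
  ((groups w).flatMap fun g => quantOf g.1,
    (groups w).flatMap fun g => (headOf g.1).toList.map fun h =>
      (h, g.2.map fun e => (signOf e.1, e.2)),
    (groups w).flatMap fun g => bif isBackdoor g.1 then g.2.map Prod.snd else [])

@[fun_prop]
theorem parse_poly [Finite Γ] : Poly (parse : List (Sym Γ) → Raw Γ) := by
  have h1 : Poly (quantOf : Sym Γ → _) := Poly.of_finite _
  have h2 : Poly (headOf : Sym Γ → _) := Poly.of_finite _
  have h3 : Poly (signOf : Sym Γ → _) := Poly.of_finite _
  have h4 : Poly (isBackdoor : Sym Γ → _) := Poly.of_finite _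
  have h5 : Poly (isTick : Sym Γ → _) := Poly.of_finite _
  have h6 : Poly (isEntry : Sym Γ → _) := Poly.of_finite _
  have hg : Poly (groups : List (Sym Γ) → _) := by
    refine Poly.snd (Poly.snd (Poly.foldr_add (f := fun _ s st => tokStep s st) ?_ (by fun_prop)
      (by fun_prop) (S := fun n => n + 10) (by fun_prop) fun a s b => ?_))
    · unfold tokStep
      fun_prop
    · obtain ⟨t, p, g⟩ := s
      unfold tokStep
      cases isTick b <;> cases isEntry b <;>
        simp only [cond_true, cond_false, esize_prod, esize_cons, esize_nil, esize_nat] <;> omega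
  unfold parse
  fun_prop

/-- The string with the given groups. -/
def ungroup (gs : List (Sym Γ × List (Sym Γ × ℕ))) : List (Sym Γ) :=
  gs.flatMap fun g => g.1 :: g.2.flatMap fun e => e.1 :: List.replicate e.2 .tick

theorem groups_ungroup (gs : List (Sym Γ × List (Sym Γ × ℕ)))
    (h : ∀ g ∈ gs, isTick g.1 = false ∧ isEntry g.1 = false ∧ ∀ e ∈ g.2, isEntry e.1 = true) :
    groups (ungroup gs) = gs := by
  have ht : ∀ (n : ℕ) st, (List.replicate n (Sym.tick : Sym Γ)).foldr tokStep st =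
      (st.1 + n, st.2.1, st.2.2) := by
    intro n st
    induction n with
    | zero => rfl
    | succ n ih => rw [List.replicate_succ, List.foldr_cons, ih]; rfl
  have he : ∀ (es : List (Sym Γ × ℕ)) (G : List (Sym Γ × List (Sym Γ × ℕ))),
      (∀ e ∈ es, isEntry e.1 = true) →
      (es.flatMap fun e => e.1 :: List.replicate e.2 Sym.tick).foldr tokStep (0, [], G) =
        (0, es, G) := by
    intro es G h
    induction es with
    | nil => rfl
    | cons e es ih =>
      have h1 := h e (by simp)
      rw [List.flatMap_cons, List.foldr_append, ih fun e he => h e (by simp [he]),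
        List.foldr_cons, ht]
      have h2 : isTick e.1 = false := by
        cases hs : e.1 <;> simp_all [isEntry, isTick]
      simp [tokStep, h1, h2]
  have hg : (ungroup gs).foldr tokStep (0, [], []) = (0, [], gs) := by
    induction gs with
    | nil => rfl
    | cons g gs ih =>
      have h1 := h g (by simp)
      have ih := ih fun g hg => h g (by simp [hg])
      rw [ungroup, List.flatMap_cons, List.foldr_append, ← ungroup, ih, List.foldr_cons,
        he _ _ h1.2.2]
      simp [tokStep, h1]
  rw [groups, hg]

/-- The signs in applications are `true`. -/
def Raw.Normal (r : Raw Γ) : Prop := ∀ c ∈ r.2.1, c.1.isSome → ∀ p ∈ c.2, p.1 = true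

/-- Parsing recovers a raw instance from its string, so that a string is valid exactly if encoding
its parse gives it back and the parse is well formed. -/
theorem parse_encode (r : Raw Γ) (hr : r.Normal) : parse r.encode = r := by
  obtain ⟨qs, cs, bs⟩ := r
  have h : groups (Raw.encode (qs, cs, bs)) = qs.map (fun q => (.quant q, [])) ++
      cs.map (fun c => (headSym c.1, c.2.map fun p => (entrySym (c.1, p.1), p.2))) ++
      [(.backdoor, bs.map fun v => (.var, v))] := by
    rw [← groups_ungroup (_ ++ _)]
    · congr 1
      simp only [Raw.encode, ungroup, List.flatMap_append, List.flatMap_map]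
      rw [show qs.map Sym.quant = qs.flatMap fun q => [(Sym.quant q : Sym Γ)] from
        List.map_eq_flatMap, List.flatMap_singleton, List.flatMap_map]
      rfl
    · intro g hg
      simp only [List.mem_append, List.mem_map, List.mem_singleton] at hg
      rcases hg with (⟨q, -, rfl⟩ | ⟨⟨h, l⟩, -, rfl⟩) | rfl
      · simp [isTick, isEntry]
      · refine ⟨by cases h <;> rfl, by cases h <;> rfl, fun e he => ?_⟩
        obtain ⟨p, -, rfl⟩ := List.mem_map.1 he
        cases h <;> rfl
      · refine ⟨rfl, rfl, fun e he => ?_⟩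
        obtain ⟨p, -, rfl⟩ := List.mem_map.1 he
        rfl
  unfold parse
  rw [h]
  refine Prod.ext ?_ (Prod.ext ?_ ?_)
  · have : ∀ h : Option Γ, quantOf (headSym h) = [] := by intro h; cases h <;> rfl
    have h1 : ∀ q : Quant, quantOf (Sym.quant q : Sym Γ) = [q] := fun _ => rfl
    have h2 : quantOf (Sym.backdoor : Sym Γ) = [] := rfl
    simp [List.flatMap_append, List.flatMap_map, h1, h2, this]
  · simp only [List.flatMap_append, List.flatMap_map, List.flatMap_singleton]
    have h1 : ∀ q : Quant, headOf (Sym.quant q : Sym Γ) = none := fun _ => rfl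
    have h2 : headOf (Sym.backdoor : Sym Γ) = none := rfl
    have h3 : ∀ h : Option Γ, headOf (headSym h) = some h := by intro h; cases h <;> rfl
    simp only [h1, h2, h3, Option.toList_none, Option.toList_some, List.map_nil, List.map_cons,
      List.append_nil, List.map_map]
    have h4 : qs.flatMap (fun _ => ([] : List (RawC Γ))) = [] := by simp
    rw [h4, List.nil_append]
    conv_rhs => rw [← List.flatMap_singleton' cs]
    rw [List.flatMap_congr]
    intro c hc
    obtain ⟨h, l⟩ := c
    congr 2
    conv_rhs => rw [← List.map_id l]
    refine List.map_congr_left fun p hp => ?_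
    cases h with
    | none => rfl
    | some R => exact Prod.ext (hr _ hc rfl p hp).symm rfl
  · have : ∀ h : Option Γ, isBackdoor (headSym h) = false := by intro h; cases h <;> rfl
    have h1 : ∀ q : Quant, isBackdoor (Sym.quant q : Sym Γ) = false := fun _ => rfl
    have h2 : isBackdoor (Sym.backdoor : Sym Γ) = true := rfl
    have h3 : qs.flatMap (fun _ => ([] : List ℕ)) = [] := by simp
    have h4 : cs.flatMap (fun _ => ([] : List ℕ)) = [] := by simp
    simp [List.flatMap_append, List.flatMap_map, h1, h2, h3, h4, this, Function.comp_def]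

theorem Instance.normal_raw (I : Instance Γ) : I.raw.Normal := by
  intro c hc h p hp
  obtain ⟨K, -, rfl⟩ := List.mem_map.1 hc
  cases K with
  | clause l => simp [Constraint.raw] at h
  | app R x =>
    obtain ⟨v, -, rfl⟩ := List.mem_map.1 hp
    rfl

/-- All variables are bound by the prefix, and applications have the right number of arguments. -/
def Raw.Wf (r : Raw Γ) : Prop :=
  (∀ c ∈ r.2.1, (∀ p ∈ c.2, p.2 < r.1.length) ∧ ∀ R, c.1 = some R → R.1.arity = c.2.length) ∧
    ∀ v ∈ r.2.2, v < r.1.length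

theorem Instance.wf_raw (I : Instance Γ) : I.raw.Wf := by
  refine ⟨fun c hc => ?_, fun v hv => ?_⟩
  · obtain ⟨K, -, rfl⟩ := List.mem_map.1 hc
    cases K with
    | clause l =>
      refine ⟨fun p hp => ?_, fun R h => by simp [Constraint.raw] at h⟩
      obtain ⟨q, -, rfl⟩ := List.mem_map.1 hp
      simp [raw]
    | app R x =>
      refine ⟨fun p hp => ?_, fun R' h => ?_⟩
      · obtain ⟨q, -, rfl⟩ := List.mem_map.1 hp
        simp [raw]
      · obtain rfl : R = R' := Option.some.inj h
        simp [Constraint.raw]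
  · obtain ⟨b, -, rfl⟩ := List.mem_map.1 hv
    simp [raw]

/-- Well-formed raw instances come from instances. -/
theorem Raw.Wf.exists_instance {r : Raw Γ} (hr : r.Wf) : ∃ I : Instance Γ, I.encode = r.encode := by
  obtain ⟨qs, cs, bs⟩ := r
  obtain ⟨hc, hb⟩ := hr
  have h1 : ∃ Ks : List (Constraint Γ qs.length), Ks.flatMap Constraint.encode =
      cs.flatMap RawC.encode := by
    dsimp only at hc
    clear hb
    induction cs with
    | nil => exact ⟨[], rfl⟩
    | cons c cs ih =>
      obtain ⟨Ks, h⟩ := ih fun c h => hc c (by simp [h])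
      obtain ⟨hv, ha⟩ := hc c (by simp)
      obtain ⟨h', l⟩ := c
      have : ∃ K : Constraint Γ qs.length, K.encode = RawC.encode (h', l) := by
        cases h' with
        | none =>
          refine ⟨.clause (l.attach.map fun p => (p.1.1, ⟨p.1.2, hv p.1 p.2⟩)), ?_⟩
          simp only [Constraint.encode, RawC.encode, headSym, entrySym, encodeVar, List.flatMap_map]
          rw [← List.flatMap_map (f := Subtype.val)
            (g := fun p : Lit => Sym.lit p.1 :: List.replicate p.2 Sym.tick),
            List.attach_map_subtype_val]
        | some R =>
          refine ⟨.app R fun i => ⟨(l.get (i.cast (ha R rfl))).2, hv _ (List.get_mem _ _)⟩, ?_⟩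
          simp only [Constraint.encode, RawC.encode, headSym, entrySym, encodeVar]
          congr 1
          rw [List.ofFn_congr (ha R rfl)]
          conv_rhs => rw [← List.ofFn_get l]
          rw [List.flatMap_def, List.flatMap_def, List.map_ofFn, List.map_ofFn]
          rfl
      obtain ⟨K, hK⟩ := this
      exact ⟨K :: Ks, by rw [List.flatMap_cons, List.flatMap_cons, h, hK]⟩
  obtain ⟨Ks, hKs⟩ := h1
  refine ⟨⟨qs.length, qs.get, Ks, bs.attach.map fun v => ⟨v.1, hb v.1 v.2⟩⟩, ?_⟩
  simp only [Instance.encode, Raw.encode, hKs, List.ofFn_get, List.flatMap_map, encodeVar]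
  rw [← List.flatMap_map (f := Subtype.val)
    (g := fun v : ℕ => Sym.var :: List.replicate v Sym.tick), List.attach_map_subtype_val]

/-- The arity, as a function on the finite type `Γ`. -/
def relArity (R : Γ) : ℕ := R.1.arity

/-- Whether a string encodes an instance. -/
noncomputable def valid [Finite Γ] (w : List (Sym Γ)) : Bool :=
  eqb (parse w).encode w &&
    ((parse w).2.1.all (fun c => c.2.all (fun p => Nat.blt p.2 (parse w).1.length) &&
      c.1.toList.all fun R => eqb (relArity R) c.2.length) &&
    (parse w).2.2.all fun v => Nat.blt v (parse w).1.length)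

@[fun_prop]
theorem valid_poly [Finite Γ] : Poly (valid : List (Sym Γ) → Bool) := by
  have h1 : Poly (relArity : Γ → ℕ) := Poly.of_finite _
  unfold valid
  fun_prop

theorem parse_encode_instance (I : Instance Γ) : parse I.encode = I.raw := by
  rw [← I.encode_raw, parse_encode _ I.normal_raw]

theorem valid_iff [Finite Γ] (w : List (Sym Γ)) :
    valid w = true ↔ ∃ I : Instance Γ, I.encode = w := by
  have h : valid w = true ↔ (parse w).encode = w ∧ (parse w).Wf := by
    simp only [valid, Bool.and_eq_true, eqb_iff, List.all_eq_true, Nat.blt_eq, Raw.Wf,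
      Option.mem_toList, relArity]
  rw [h]
  constructor
  · rintro ⟨h1, h2⟩
    obtain ⟨I, hI⟩ := h2.exists_instance
    exact ⟨I, hI.trans h1⟩
  · rintro ⟨I, rfl⟩
    rw [parse_encode_instance]
    exact ⟨I.encode_raw, I.wf_raw⟩

end

/-! ### Truth of raw instances -/

/-- Truth of `Qᵢ xᵢ Qᵢ₊₁ xᵢ₊₁ ⋯ . P`, where `σ` holds the values of the other variables. -/
def qbf : List Quant → ℕ → (ℕ → Bool) → ((ℕ → Bool) → Prop) → Prop
  | [], _, σ, P => P σ
  | .all :: qs, i, σ, P => ∀ b, qbf qs (i + 1) (Function.update σ i b) P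
  | .ex :: qs, i, σ, P => ∃ b, qbf qs (i + 1) (Function.update σ i b) P

theorem qbf_mono {P P' : (ℕ → Bool) → Prop} (h : ∀ σ, P σ → P' σ) :
    ∀ (qs : List Quant) (i : ℕ) (σ : ℕ → Bool), qbf qs i σ P → qbf qs i σ P'
  | [], _, _, hP => h _ hP
  | .all :: qs, _, _, hP => fun b => qbf_mono h qs _ _ (hP b)
  | .ex :: qs, _, _, hP => let ⟨b, hb⟩ := hP; ⟨b, qbf_mono h qs _ _ hb⟩

theorem qbf_congr {P P' : (ℕ → Bool) → Prop} (h : ∀ σ, P σ ↔ P' σ) (qs : List Quant) (i : ℕ)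
    (σ : ℕ → Bool) : qbf qs i σ P ↔ qbf qs i σ P' :=
  ⟨qbf_mono (fun σ => (h σ).1) qs i σ, qbf_mono (fun σ => (h σ).2) qs i σ⟩

/-- The assignment that is `τ` from index `m` on. -/
def shiftIn (σ : ℕ → Bool) (m : ℕ) {n : ℕ} (τ : Fin n → Bool) : ℕ → Bool :=
  fun j => if h : m ≤ j ∧ j < m + n then τ ⟨j - m, by omega⟩ else σ j

theorem shiftIn_cons (σ : ℕ → Bool) (m : ℕ) {n : ℕ} (b : Bool) (τ : Fin n → Bool) :
    shiftIn σ m (Fin.cons b τ : Fin (n + 1) → Bool) =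
      shiftIn (Function.update σ m b) (m + 1) τ := by
  funext j
  unfold shiftIn
  by_cases hj : j = m
  · subst hj
    simp
  by_cases h : m + 1 ≤ j ∧ j < m + 1 + n
  · have h' : m ≤ j ∧ j < m + (n + 1) := by omega
    rw [dif_pos h, dif_pos h']
    have : (⟨j - m, by omega⟩ : Fin (n + 1)) = Fin.succ ⟨j - (m + 1), by omega⟩ :=
      Fin.ext (by simp; omega)
    rw [this, Fin.cons_succ]
  · have h' : ¬ (m ≤ j ∧ j < m + (n + 1)) := by omega
    rw [dif_neg h, dif_neg h', Function.update_of_ne hj]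

/-- Both evaluations of quantified formulas agree: the variables `m, …, m + n - 1` of a total
assignment take the place of a tuple. -/
theorem qbfTrue_shiftIn : ∀ {n : ℕ} (Q : Fin n → Quant) (m : ℕ) (σ : ℕ → Bool)
    (P : (ℕ → Bool) → Prop),
    qbfTrue Q (fun τ => P (shiftIn σ m τ)) ↔ qbf (List.ofFn Q) m σ P
  | 0, Q, m, σ, P => by
    have : shiftIn σ m (Fin.elim0 : Fin 0 → Bool) = σ := by
      funext j
      rw [shiftIn, dif_neg (by omega)]
    simp only [qbfTrue, List.ofFn_zero, qbf]
    exact iff_of_eq (congrArg P this)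
  | n + 1, Q, m, σ, P => by
    rw [List.ofFn_succ]
    have key : ∀ b, qbfTrue (fun i => Q i.succ)
        (fun τ => P (shiftIn σ m (Fin.cons b τ : Fin (n + 1) → Bool))) ↔
        qbf (List.ofFn fun i => Q i.succ) (m + 1) (Function.update σ m b) P := by
      intro b
      simp only [shiftIn_cons]
      exact qbfTrue_shiftIn _ _ _ _
    cases hq : Q 0 with
    | all => simp only [qbfTrue, hq, qbf, key]
    | ex => simp only [qbfTrue, hq, qbf, key]

/-- The relation holds for the first entries of a sequence. -/
def BoolRel.Holds (R : BoolRel) (τ : ℕ → Bool) : Prop := (fun i : Fin R.arity => τ i) ∈ R.tuples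

theorem BoolRel.holds_congr {R : BoolRel} {τ τ' : ℕ → Bool} (h : ∀ i < R.arity, τ i = τ' i) :
    R.Holds τ ↔ R.Holds τ' := by
  unfold Holds
  rw [show (fun i : Fin R.arity => τ i) = fun i : Fin R.arity => τ' i from
    funext fun i : Fin R.arity => h i i.2]

theorem clauseRel_cast {r r' : ℕ} (h : r = r') (s : Fin r' → Bool) :
    clauseRel s = clauseRel fun i : Fin r => s (i.cast h) := by
  subst h
  rfl

theorem exists_clauseRel_get {r : ℕ} (s : Fin r → Bool) :
    ∃ l : List Bool, clauseRel s = clauseRel l.get := by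
  refine ⟨List.ofFn s, ?_⟩
  rw [clauseRel_cast (List.length_ofFn (f := s)).symm]
  congr 1
  funext i
  simp

theorem holds_clauseRel {R : BoolRel} {s : List Bool} (h : R = clauseRel s.get) (τ : ℕ → Bool) :
    R.Holds τ ↔ ∃ i < s.length, τ i = s.getD i true := by
  subst h
  constructor
  · rintro ⟨i, hi⟩
    exact ⟨i, i.2, by simpa using hi⟩
  · rintro ⟨i, hi, h⟩
    refine ⟨⟨i, hi⟩, ?_⟩
    simpa [hi] using h

section

variable {Γ : Set BoolRel}

/-- A clause under an assignment. -/
def ClauseSat (σ : ℕ → Bool) (l : List Lit) : Prop := ∃ p ∈ l, σ p.2 = p.1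

/-- The application of a relation to a list of variables, under an assignment. -/
def AppSat (σ : ℕ → Bool) (a : Γ × List ℕ) : Prop := a.1.1.Holds fun i => σ (a.2.getD i 0)

/-- A raw constraint under an assignment. -/
def RawC.Sat (σ : ℕ → Bool) (c : RawC Γ) : Prop := match c.1 with
  | none => ClauseSat σ c.2
  | some R => AppSat σ (R, c.2.map Prod.snd)

/-- Truth of a raw instance. The initial assignment is immaterial for well-formed instances. -/
def Raw.True (r : Raw Γ) : Prop := qbf r.1 0 (fun _ => false) fun σ => ∀ c ∈ r.2.1, c.Sat σ

theorem Constraint.sat_raw {n : ℕ} (K : Constraint Γ n) (σ : ℕ → Bool) :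
    K.raw.Sat σ ↔ K.toAtom.Sat fun i => σ i := by
  cases K with
  | clause l =>
    simp only [raw, RawC.Sat, ClauseSat, Atom.Sat, toAtom, clauseRel]
    constructor
    · rintro ⟨p, hp, h⟩
      obtain ⟨q, hq, rfl⟩ := List.mem_map.1 hp
      obtain ⟨i, rfl⟩ := List.get_of_mem hq
      exact ⟨i, h⟩
    · rintro ⟨i, h⟩
      exact ⟨_, List.mem_map_of_mem (List.get_mem l i), h⟩
  | app R x =>
    simp only [raw, RawC.Sat, AppSat, Atom.Sat, toAtom, List.map_map]
    rw [BoolRel.Holds]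
    apply iff_of_eq
    congr 1
    funext i
    simp

theorem Instance.isTrue_iff (I : Instance Γ) : I.IsTrue ↔ I.raw.True := by
  unfold IsTrue Raw.True
  rw [show I.raw.1 = List.ofFn I.quant from rfl, ← qbfTrue_shiftIn]
  apply iff_of_eq
  congr 1
  funext τ
  have h : (fun i : Fin I.n => shiftIn (fun _ => false) 0 τ i) = τ := by
    funext i
    simp [shiftIn]
  simp only [raw, List.mem_map, forall_exists_index, and_imp, forall_apply_eq_imp_iff₂,
    Constraint.sat_raw, h, matrix, Set.mem_ofPred_eq]
  apply propext
  constructor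
  · exact fun h c hc => h _ c hc rfl
  · rintro h _ c hc rfl
    exact h c hc

/-! ### Clause forms, relation forms and the backdoor condition -/

open Classical in
/-- A list of signs that makes `R` a clause, if there is one. -/
noncomputable def relSigns (R : Γ) : List (List Bool) :=
  if h : ∃ s : List Bool, R.1 = clauseRel s.get then [h.choose] else []

open Classical in
/-- The relation of `Γ` that is the clause with the given signs, if there is one. -/
noncomputable def signsRel (s : List Bool) : List Γ :=
  if h : clauseRel s.get ∈ Γ then [⟨_, h⟩] else []

/-- The literals with the given signs and variables; there are as many as variables. -/
def zipLits (s : List Bool) (vs : List ℕ) : List Lit :=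
  (List.range vs.length).map fun i => (s.getD i true, vs.getD i 0)

/-- The constraint as a clause, if it is one; a list of length at most one. -/
noncomputable def RawC.clauseForm (c : RawC Γ) : List (List Lit) :=
  bif c.1.toList.isEmpty then [c.2]
  else c.1.toList.flatMap fun R => (relSigns R).map fun s => zipLits s (c.2.map Prod.snd)

/-- The constraint as an application of a relation of `Γ`, if it is one; a list of length at most
one. -/
noncomputable def RawC.relForm (c : RawC Γ) : List (Γ × List ℕ) :=
  bif c.1.toList.isEmpty then (signsRel (c.2.map Prod.fst)).map fun R => (R, c.2.map Prod.snd)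
  else c.1.toList.map fun R => (R, c.2.map Prod.snd)

/-- The constraint is a clause over the set `B` of variables. -/
noncomputable def RawC.kept (B : List ℕ) (c : RawC Γ) : Bool :=
  !c.clauseForm.isEmpty && c.2.all fun p => memb p.2 B

theorem signsRel_poly [Finite Γ] : Poly (signsRel : List Bool → List Γ) := by
  have : {s : List Bool | ∃ R : Γ, s.length ≤ R.1.arity}.Finite := by
    rw [Set.ofPred_exists]
    exact Set.finite_iUnion fun R => List.finite_length_le _ _
  refine Poly.of_finite_support this (d := []) fun s hs => ?_
  rw [signsRel, dif_neg]
  exact fun h => hs ⟨⟨_, h⟩, le_rfl⟩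

@[fun_prop]
theorem RawC.clauseForm_poly [Finite Γ] : Poly (RawC.clauseForm : RawC Γ → _) := by
  have h1 : Poly (relSigns : Γ → _) := Poly.of_finite _
  unfold RawC.clauseForm zipLits
  fun_prop

@[fun_prop]
theorem RawC.relForm_poly [Finite Γ] : Poly (RawC.relForm : RawC Γ → _) := by
  have h1 : Poly (signsRel : List Bool → List Γ) := signsRel_poly
  unfold RawC.relForm
  fun_prop

@[fun_prop]
theorem RawC.kept_poly [Finite Γ] {α : Type} [Enc α] {B : α → List ℕ} {c : α → RawC Γ}
    (hB : Poly B) (hc : Poly c) : Poly fun a => RawC.kept (B a) (c a) := by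
  unfold RawC.kept
  fun_prop

/-- Removal of duplicates. -/
noncomputable def dedupB (l : List ℕ) : List ℕ :=
  l.foldr (fun a s => bif memb a s then s else a :: s) []

@[fun_prop]
theorem dedupB_poly : Poly dedupB := by
  refine Poly.foldr_add (f := fun _ a s => bif memb a s then s else a :: s) (by fun_prop)
    (by fun_prop) (by fun_prop) (S := fun n => n + 1) (by fun_prop) fun a s b => ?_
  cases memb b s
  · simp only [cond_false, esize_cons]; omega
  · simp only [cond_true]; omega

theorem dedupB_spec (l : List ℕ) : (dedupB l).Nodup ∧ ∀ a, a ∈ dedupB l ↔ a ∈ l := by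
  induction l with
  | nil => simp [dedupB]
  | cons b l ih =>
    have e : dedupB (b :: l) = bif memb b (dedupB l) then dedupB l else b :: dedupB l := rfl
    rw [e]
    by_cases h : b ∈ dedupB l
    · rw [memb_iff.2 h, cond_true]
      refine ⟨ih.1, fun a => ?_⟩
      rw [ih.2, List.mem_cons]
      constructor
      · exact Or.inr
      · rintro (rfl | h')
        · exact (ih.2 _).1 h
        · exact h'
    · have : memb b (dedupB l) = false := by simpa [← Bool.not_eq_true] using h
      rw [this, cond_false]
      exact ⟨List.nodup_cons.2 ⟨h, ih.1⟩, fun a => by rw [List.mem_cons, List.mem_cons, ih.2]⟩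

theorem length_dedupB {n : ℕ} (l : List (Fin n)) :
    (dedupB (l.map fun v => v.val)).length = l.toFinset.card := by
  obtain ⟨h1, h2⟩ := dedupB_spec (l.map fun v => v.val)
  rw [← List.toFinset_card_of_nodup h1, ← Finset.card_map Fin.valEmbedding]
  congr 1
  ext a
  simp [h2]

/-- The string encodes an instance whose last component is a clause covering backdoor of the given
size. -/
@[irreducible] noncomputable def admissible [Finite Γ] (p : List (Sym Γ) × ℕ) : Bool :=
  (valid p.1 && eqb (dedupB (parse p.1).2.2).length p.2) &&
  ((parse p.1).2.1.all (fun c => c.kept (parse p.1).2.2 || !c.relForm.isEmpty) &&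
  (parse p.1).2.2.all fun b => (parse p.1).2.1.any fun c =>
    c.kept (parse p.1).2.2 && memb b (c.2.map Prod.snd))

@[fun_prop]
theorem admissible_poly [Finite Γ] : Poly (admissible : List (Sym Γ) × ℕ → Bool) := by
  unfold admissible
  fun_prop

theorem Constraint.range_scope {n : ℕ} (K : Constraint Γ n) (v : Fin n) :
    v ∈ Set.range K.toAtom.scope ↔ v.val ∈ K.raw.2.map Prod.snd := by
  cases K with
  | clause l =>
    simp only [toAtom, raw, List.map_map, List.mem_map, Set.mem_range, Function.comp]
    constructor
    · rintro ⟨i, h⟩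
      exact ⟨_, List.get_mem l i, by rw [h]⟩
    · rintro ⟨p, hp, h⟩
      obtain ⟨i, rfl⟩ := List.get_of_mem hp
      exact ⟨i, Fin.ext h⟩
  | app R x =>
    simp only [toAtom, raw, List.map_map, List.mem_map, Set.mem_range, Function.comp,
      List.mem_ofFn]
    constructor
    · rintro ⟨i, h⟩
      exact ⟨_, ⟨i, rfl⟩, by rw [h]⟩
    · rintro ⟨_, ⟨i, rfl⟩, h⟩
      exact ⟨i, Fin.ext h⟩

theorem RawC.clauseForm_none (l : List Lit) : RawC.clauseForm ((none, l) : RawC Γ) = [l] := rfl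

theorem RawC.clauseForm_some (R : Γ) (l : List Lit) : RawC.clauseForm (some R, l) =
    (relSigns R).map fun s => zipLits s (l.map Prod.snd) := by
  simp [clauseForm]

theorem RawC.relForm_none (l : List Lit) : RawC.relForm ((none, l) : RawC Γ) =
    (signsRel (l.map Prod.fst)).map fun R => (R, l.map Prod.snd) := rfl

theorem RawC.relForm_some (R : Γ) (l : List Lit) : RawC.relForm (some R, l) =
    [(R, l.map Prod.snd)] := rfl

theorem mem_relSigns {R : Γ} {s : List Bool} (h : s ∈ relSigns R) : R.1 = clauseRel s.get := by
  unfold relSigns at h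
  split at h
  · rw [List.mem_singleton.1 h]
    exact Exists.choose_spec ‹_›
  · simp at h

theorem relSigns_ne_nil {R : Γ} : relSigns R ≠ [] ↔ ∃ s : List Bool, R.1 = clauseRel s.get := by
  unfold relSigns
  split <;> simp_all

theorem Constraint.isClause_iff {n : ℕ} (K : Constraint Γ n) :
    K.toAtom.IsClause ↔ K.raw.clauseForm.isEmpty = false := by
  cases K with
  | clause l => exact iff_of_true ⟨_, _, rfl⟩ rfl
  | app R x =>
    rw [raw, RawC.clauseForm_some]
    simp only [toAtom, Atom.IsClause, List.isEmpty_eq_false_iff, ne_eq, List.map_eq_nil_iff]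
    rw [← ne_eq, relSigns_ne_nil]
    constructor
    · rintro ⟨r, s, h⟩
      obtain ⟨l, hl⟩ := exists_clauseRel_get s
      exact ⟨l, h.trans hl⟩
    · rintro ⟨s, h⟩
      exact ⟨_, _, h⟩

theorem clauseRel_map_get {α : Type} (l : List α) (f : α → Bool) :
    clauseRel (l.map f).get = clauseRel fun i : Fin l.length => f (l.get i) := by
  rw [clauseRel_cast (r := l.length) (by simp)]
  congr 1
  funext i
  simp

theorem Constraint.rel_mem_iff {n : ℕ} (K : Constraint Γ n) :
    K.toAtom.rel ∈ Γ ↔ K.raw.relForm.isEmpty = false := by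
  cases K with
  | clause l =>
    rw [raw, RawC.relForm_none, signsRel]
    have e : clauseRel ((l.map fun p : Bool × Fin n => (p.1, p.2.val)).map Prod.fst).get =
        clauseRel fun i : Fin l.length => (l.get i).1 := by
      rw [List.map_map]
      exact clauseRel_map_get l _
    show (clauseRel fun i : Fin l.length => (l.get i).1) ∈ Γ ↔ _
    rw [← e]
    split
    · exact iff_of_true ‹_› rfl
    · exact iff_of_false ‹_› (by simp)
  | app R x => exact iff_of_true R.2 rfl

theorem RawC.sat_clauseForm {c : RawC Γ} {l : List Lit} (h : l ∈ c.clauseForm)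
    (hc : ∀ R, c.1 = some R → R.1.arity = c.2.length) (σ : ℕ → Bool) :
    c.Sat σ ↔ ClauseSat σ l := by
  obtain ⟨o, l'⟩ := c
  cases o with
  | none =>
    rw [clauseForm_none, List.mem_singleton] at h
    rw [h]
    rfl
  | some R =>
    rw [clauseForm_some] at h
    obtain ⟨s, hs, rfl⟩ := List.mem_map.1 h
    have hs := mem_relSigns hs
    have hlen : s.length = l'.length := by
      have h1 := hc R rfl
      rw [hs] at h1
      exact h1
    show (R.1.Holds fun i => σ ((l'.map Prod.snd).getD i 0)) ↔ _
    rw [holds_clauseRel hs]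
    simp only [ClauseSat, zipLits, List.mem_map, List.mem_range, List.length_map, hlen]
    constructor
    · rintro ⟨i, hi, h⟩
      exact ⟨_, ⟨i, hi, rfl⟩, h⟩
    · rintro ⟨_, ⟨i, hi, rfl⟩, h⟩
      exact ⟨i, hi, h⟩

theorem RawC.mem_clauseForm_vars {c : RawC Γ} {l : List Lit} (h : l ∈ c.clauseForm) {p : Lit}
    (hp : p ∈ l) : p.2 ∈ c.2.map Prod.snd := by
  obtain ⟨o, l'⟩ := c
  cases o with
  | none =>
    rw [clauseForm_none, List.mem_singleton] at h
    rw [← h]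
    exact List.mem_map_of_mem hp
  | some R =>
    rw [clauseForm_some] at h
    obtain ⟨s, hs, rfl⟩ := List.mem_map.1 h
    obtain ⟨i, hi, rfl⟩ := List.mem_map.1 hp
    have hi := List.mem_range.1 hi
    dsimp only
    rw [List.getD_eq_getElem _ _ hi]
    exact List.getElem_mem hi

theorem RawC.mem_relForm_snd {c : RawC Γ} {a : Γ × List ℕ} (h : a ∈ c.relForm) :
    a.2 = c.2.map Prod.snd := by
  obtain ⟨o, l'⟩ := c
  cases o with
  | none =>
    rw [relForm_none] at h
    obtain ⟨s, hs, rfl⟩ := List.mem_map.1 h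
    rfl
  | some R =>
    rw [relForm_some, List.mem_singleton] at h
    rw [h]

theorem RawC.sat_relForm {c : RawC Γ} {a : Γ × List ℕ} (h : a ∈ c.relForm) (σ : ℕ → Bool) :
    c.Sat σ ↔ AppSat σ a := by
  obtain ⟨o, l⟩ := c
  cases o with
  | none =>
    rw [relForm_none] at h
    obtain ⟨R, hs, rfl⟩ := List.mem_map.1 h
    have hR : R.1 = clauseRel (l.map Prod.fst).get := by
      unfold signsRel at hs
      split at hs
      · rw [List.mem_singleton.1 hs]
      · simp at hs
    show _ ↔ (R.1.Holds fun i => σ ((l.map Prod.snd).getD i 0))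
    rw [holds_clauseRel hR]
    simp only [RawC.Sat, ClauseSat, List.length_map]
    constructor
    · rintro ⟨p, hp, h⟩
      obtain ⟨i, hi, rfl⟩ := List.mem_iff_getElem.1 hp
      exact ⟨i, hi, by simpa [hi] using h⟩
    · rintro ⟨i, hi, h⟩
      exact ⟨l[i], List.getElem_mem hi, by simpa [hi] using h⟩
  | some R =>
    rw [relForm_some, List.mem_singleton] at h
    rw [h]
    rfl

theorem RawC.kept_iff {B : List ℕ} {c : RawC Γ} :
    c.kept B = true ↔ c.clauseForm.isEmpty = false ∧ ∀ v ∈ c.2.map Prod.snd, v ∈ B := by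
  simp only [kept, Bool.and_eq_true, Bool.not_eq_true', List.all_eq_true, memb_iff, List.mem_map,
    forall_exists_index, and_imp, forall_apply_eq_imp_iff₂]

/-- The largest possible set of clauses over `B` is a witness whenever there is one: `B` is a
backdoor if every other constraint is an application of a relation of `Γ`, and every variable of `B`
occurs in a clause over `B`. -/
theorem Instance.isCCBackdoor_iff (I : Instance Γ) :
    IsCCBackdoor (formulaClass Γ I.n) I.matrix (I.backdoorSet : Set (Fin I.n)) ↔
      (∀ c ∈ I.raw.2.1, c.kept I.raw.2.2 = true ∨ c.relForm.isEmpty = false) ∧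
      ∀ b ∈ I.raw.2.2, ∃ c ∈ I.raw.2.1, c.kept I.raw.2.2 = true ∧ b ∈ c.2.map Prod.snd := by
  have hB : ∀ v : Fin I.n, v ∈ (I.backdoorSet : Set (Fin I.n)) ↔ v.val ∈ I.raw.2.2 := by
    intro v
    simp [backdoorSet, raw, Fin.val_inj]
  have hlt : ∀ K : Constraint Γ I.n, ∀ v ∈ K.raw.2.map Prod.snd, v < I.n := by
    intro K v hv
    cases K with
    | clause l =>
      simp only [Constraint.raw, List.map_map, List.mem_map] at hv
      obtain ⟨p, -, rfl⟩ := hv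
      exact p.2.2
    | app R x =>
      simp only [Constraint.raw, List.map_map, List.mem_map] at hv
      obtain ⟨p, -, rfl⟩ := hv
      exact p.2
  have hkept : ∀ K : Constraint Γ I.n, K.raw.kept I.raw.2.2 = true ↔ K.toAtom.IsClause ∧
      Set.range K.toAtom.scope ⊆ (I.backdoorSet : Set (Fin I.n)) := by
    intro K
    rw [RawC.kept_iff, Constraint.isClause_iff]
    refine and_congr_right fun _ => ⟨fun h v hv => (hB v).2 (h _ ((K.range_scope v).1 hv)),
      fun h v hv => ?_⟩
    exact (hB ⟨v, hlt K v hv⟩).1 (h ((K.range_scope ⟨v, hlt K v hv⟩).2 hv))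
  constructor
  · rintro ⟨C, hC, hcl, hΓ, hV⟩
    refine ⟨fun c hc => ?_, fun b hb => ?_⟩
    · obtain ⟨K, hK, rfl⟩ := List.mem_map.1 hc
      by_cases h : K.toAtom ∈ C
      · refine Or.inl ((hkept K).2 ⟨hcl _ h, fun v hv => ?_⟩)
        rw [← hV]
        exact ⟨_, h, hv⟩
      · exact Or.inr (K.rel_mem_iff.1 (hΓ _ ⟨⟨K, hK, rfl⟩, h⟩))
    · obtain ⟨v, hv, rfl⟩ := List.mem_map.1 hb
      have hv' := (hB v).2 hb
      rw [← hV] at hv'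
      obtain ⟨a, ha, hva⟩ := hv'
      obtain ⟨K, hK, rfl⟩ := hC ha
      refine ⟨K.raw, List.mem_map_of_mem hK, (hkept K).2 ⟨hcl _ ha, fun u hu => ?_⟩,
        (K.range_scope v).1 hva⟩
      rw [← hV]
      exact ⟨_, ha, hu⟩
  · rintro ⟨h1, h2⟩
    refine ⟨{a | a ∈ I.matrix ∧ a.IsClause ∧ Set.range a.scope ⊆ (I.backdoorSet : Set (Fin I.n))},
      fun a ha => ha.1, fun a ha => ha.2.1, ?_, ?_⟩
    · rintro a ⟨⟨K, hK, rfl⟩, h⟩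
      rcases h1 _ (List.mem_map_of_mem hK) with h' | h'
      · exact absurd ⟨⟨K, hK, rfl⟩, (hkept K).1 h'⟩ h
      · exact K.rel_mem_iff.2 h'
    · ext v
      constructor
      · rintro ⟨a, ha, hv⟩
        exact ha.2.2 hv
      · intro hv
        obtain ⟨c, hc, hk, hvc⟩ := h2 _ ((hB v).1 hv)
        obtain ⟨K, hK, rfl⟩ := List.mem_map.1 hc
        exact ⟨_, ⟨⟨K, hK, rfl⟩, (hkept K).1 hk⟩, (K.range_scope v).2 hvc⟩

theorem admissible_iff [Finite Γ] (p : List (Sym Γ) × ℕ) : admissible p = true ↔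
    valid p.1 = true ∧ (dedupB (parse p.1).2.2).length = p.2 ∧
      (∀ c ∈ (parse p.1).2.1, c.kept (parse p.1).2.2 = true ∨ c.relForm.isEmpty = false) ∧
      ∀ b ∈ (parse p.1).2.2, ∃ c ∈ (parse p.1).2.1, c.kept (parse p.1).2.2 = true ∧
        b ∈ c.2.map Prod.snd := by
  unfold admissible
  simp only [Bool.and_eq_true, eqb_iff, List.all_eq_true, List.any_eq_true, Bool.or_eq_true,
    Bool.not_eq_true', memb_iff, and_assoc]

/-- Membership in the evaluation problem in terms of the parse. -/
theorem mem_EV [Finite Γ] (p : List (Sym Γ) × ℕ) :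
    p ∈ EV Γ ↔ admissible p = true ∧ (parse p.1).True := by
  obtain ⟨w, k⟩ := p
  rw [admissible_iff, valid_iff]
  constructor
  · rintro ⟨I, rfl, hB, hk, hT⟩
    dsimp only at hk ⊢
    rw [parse_encode_instance]
    exact ⟨⟨⟨I, rfl⟩, (length_dedupB _).trans hk, I.isCCBackdoor_iff.1 hB⟩, I.isTrue_iff.1 hT⟩
  · rintro ⟨⟨⟨I, hI⟩, hk, hB⟩, hT⟩
    dsimp only at *
    subst hI
    rw [parse_encode_instance] at *
    exact ⟨I, rfl, I.isCCBackdoor_iff.2 hB, (length_dedupB _).symm.trans hk, I.isTrue_iff.2 hT⟩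

/-- The clauses over the backdoor. -/
@[irreducible] noncomputable def Raw.clauses (r : Raw Γ) : List (List Lit) :=
  r.2.1.flatMap fun c => bif c.kept r.2.2 then c.clauseForm else []

/-- The other constraints, as applications of relations of `Γ`. -/
@[irreducible] noncomputable def Raw.apps (r : Raw Γ) : List (Γ × List ℕ) :=
  r.2.1.flatMap fun c => bif c.kept r.2.2 then [] else c.relForm

@[fun_prop]
theorem Raw.clauses_poly [Finite Γ] : Poly (Raw.clauses : Raw Γ → _) := by
  unfold Raw.clauses
  fun_prop

@[fun_prop]
theorem Raw.apps_poly [Finite Γ] : Poly (Raw.apps : Raw Γ → _) := by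
  unfold Raw.apps
  fun_prop

/-- The matrix is the conjunction of the clauses over the backdoor and of applications of relations
of `Γ`. -/
theorem Raw.sat_iff {r : Raw Γ} (hwf : r.Wf)
    (h : ∀ c ∈ r.2.1, c.kept r.2.2 = true ∨ c.relForm.isEmpty = false) (σ : ℕ → Bool) :
    (∀ c ∈ r.2.1, c.Sat σ) ↔ (∀ l ∈ r.clauses, ClauseSat σ l) ∧ ∀ a ∈ r.apps, AppSat σ a := by
  unfold clauses apps
  simp only [List.mem_flatMap]
  constructor
  · refine fun H => ⟨?_, ?_⟩
    · rintro l ⟨c, hc, hl⟩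
      cases hk : c.kept r.2.2 <;> rw [hk] at hl
      · simp at hl
      · exact (RawC.sat_clauseForm hl (hwf.1 c hc).2 σ).1 (H c hc)
    · rintro l ⟨c, hc, hl⟩
      cases hk : c.kept r.2.2 <;> rw [hk] at hl
      · exact (RawC.sat_relForm hl σ).1 (H c hc)
      · simp at hl
  · rintro ⟨H1, H2⟩ c hc
    cases hk : c.kept r.2.2 with
    | true =>
      obtain ⟨l, hl⟩ := List.exists_mem_of_ne_nil _
        (List.isEmpty_eq_false_iff.1 (RawC.kept_iff.1 hk).1)
      exact (RawC.sat_clauseForm hl (hwf.1 c hc).2 σ).2 (H1 l ⟨c, hc, by rw [hk]; exact hl⟩)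
    | false =>
      obtain ⟨a, ha⟩ := List.exists_mem_of_ne_nil _
        (List.isEmpty_eq_false_iff.1 ((h c hc).resolve_left (by simp [hk])))
      exact (RawC.sat_relForm ha σ).2 (H2 a ⟨c, hc, by rw [hk]; exact ha⟩)

theorem Raw.mem_clauses {r : Raw Γ} {l : List Lit} (hl : l ∈ r.clauses) {p : Lit} (hp : p ∈ l) :
    p.2 ∈ r.2.2 := by
  unfold clauses at hl
  obtain ⟨c, hc, hl⟩ := List.mem_flatMap.1 hl
  cases hk : c.kept r.2.2 <;> rw [hk] at hl
  · simp at hl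
  · exact (RawC.kept_iff.1 hk).2 _ (RawC.mem_clauseForm_vars hl hp)

theorem Raw.mem_apps {r : Raw Γ} (hr : r.Wf) {a : Γ × List ℕ} (ha : a ∈ r.apps) {v : ℕ}
    (hv : v ∈ a.2) : v < r.1.length := by
  unfold apps at ha
  obtain ⟨c, hc, hl⟩ := List.mem_flatMap.1 ha
  cases hk : c.kept r.2.2 <;> rw [hk] at hl
  · rw [cond_false] at hl
    rw [RawC.mem_relForm_snd hl] at hv
    obtain ⟨p, hp, rfl⟩ := List.mem_map.1 hv
    exact (hr.1 c hc).1 p hp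
  · simp at hl

theorem RawC.length_relForm {c : RawC Γ} (hc : ∀ R, c.1 = some R → R.1.arity = c.2.length)
    {a : Γ × List ℕ} (h : a ∈ c.relForm) : a.2.length = a.1.1.arity := by
  obtain ⟨o, l⟩ := c
  cases o with
  | none =>
    rw [relForm_none] at h
    obtain ⟨R, hs, rfl⟩ := List.mem_map.1 h
    unfold signsRel at hs
    split at hs
    · rw [List.mem_singleton.1 hs]
      simp [clauseRel]
    · simp at hs
  | some R =>
    rw [relForm_some, List.mem_singleton] at h
    subst h
    simp [hc R rfl]

theorem Raw.length_apps {r : Raw Γ} (hr : r.Wf) {a : Γ × List ℕ} (ha : a ∈ r.apps) :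
    a.2.length = a.1.1.arity := by
  unfold apps at ha
  obtain ⟨c, hc, hl⟩ := List.mem_flatMap.1 ha
  cases hk : c.kept r.2.2 <;> rw [hk] at hl
  · exact RawC.length_relForm (hr.1 c hc).2 hl
  · simp at hl

end

/-! ### Relations preserved by all polymorphisms of the language -/

/-- The operation `x ∨ (y ∧ z)`. -/
def orAnd (x : Fin 3 → Bool) : Bool := x 0 || (x 1 && x 2)

/-- The operation `x ∨ (y ∧ z)` is a polymorphism of `IHSB₊`. -/
theorem isPol_orAnd_ihsbPlus : IsPol orAnd ihsbPlus := by
  have two : ∀ s : Fin 2 → Bool, s 0 ≠ s 1 → Preserves orAnd (clauseRel s) := by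
    intro s hs (A : Fin 3 → Fin 2 → Bool) hA
    have hA : ∀ i, A i 0 = s 0 ∨ A i 1 = s 1 := fun i => Fin.exists_fin_two.1 (hA i)
    refine (Fin.exists_fin_two (p := fun j => orAnd (fun i => A i j) = s j)).2 ?_
    have h0 := hA 0
    have h1 := hA 1
    have h2 := hA 2
    simp only [orAnd]
    revert h0 h1 h2 hs
    generalize s 0 = s0
    generalize s 1 = s1
    generalize A 0 0 = x0
    generalize A 0 1 = x1
    generalize A 1 0 = y0
    generalize A 1 1 = y1
    generalize A 2 0 = z0
    generalize A 2 1 = z1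
    clear hA
    revert s0 s1 x0 x1 y0 y1 z0 z1
    decide
  rintro R (⟨r, -, rfl⟩ | rfl | rfl | rfl)
  · intro A hA
    obtain ⟨j, hj⟩ := hA 0
    exact ⟨j, by simp [orAnd, hj]⟩
  · intro (A : Fin 3 → Fin 1 → Bool) hA
    have h : ∀ i, A i 0 = false := fun i => by
      obtain ⟨j, hj⟩ := hA i
      rwa [Subsingleton.elim j (0 : Fin 1)] at hj
    exact ⟨(0 : Fin 1), by simp [orAnd, h]⟩
  · exact two _ (by simp)
  · exact two _ (by simp)

namespace BoolRel

variable {R : BoolRel}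

/-- The relation is closed under `x ∨ (y ∧ z)`. -/
def OrAndClosed (R : BoolRel) : Prop := ∀ x ∈ R.tuples, ∀ y ∈ R.tuples, ∀ z ∈ R.tuples,
  (fun j => x j || (y j && z j)) ∈ R.tuples

theorem orAndClosed_of_preserves (h : Preserves orAnd R) : R.OrAndClosed := by
  intro x hx y hy z hz
  refine h ![x, y, z] fun i => ?_
  fin_cases i <;> assumption

theorem OrAndClosed.or (h : R.OrAndClosed) {x y : Fin R.arity → Bool} (hx : x ∈ R.tuples)
    (hy : y ∈ R.tuples) : (fun j => x j || y j) ∈ R.tuples := by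
  simpa using h x hx y hy y hy

/-- A nonempty relation closed under `x ∨ (y ∧ z)` is defined by positive clauses, which provide a
tuple below `b`, and by implications and negative units. -/
theorem OrAndClosed.mem (h : R.OrAndClosed) {b : Fin R.arity → Bool}
    (h1 : ∃ a ∈ R.tuples, ∀ z, b z = false → a z = false)
    (h2 : ∀ o z, b o = true → b z = false → ∃ c ∈ R.tuples, c o = true ∧ c z = false)
    (h3 : ∀ o, b o = true → ∃ c ∈ R.tuples, c o = true) : b ∈ R.tuples := by
  obtain ⟨a, ha, hab⟩ := h1
  -- Conjunctions, with `a` as the first argument, collect zeros.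
  have key : ∀ o, b o = true → ∀ Z : Finset (Fin R.arity), (∀ z ∈ Z, b z = false) →
      ∃ e ∈ R.tuples, e o = true ∧ ∀ z ∈ Z, e z = false := by
    intro o ho Z
    induction Z using Finset.induction_on with
    | empty =>
      intro _
      obtain ⟨c, hc, hco⟩ := h3 o ho
      exact ⟨c, hc, hco, by simp⟩
    | insert z Z hz ih =>
      intro hZ
      obtain ⟨e, he, heo, heZ⟩ := ih fun z hz => hZ z (Finset.mem_insert_of_mem hz)
      have hbz := hZ z (Finset.mem_insert_self _ _)
      obtain ⟨c, hc, hco, hcz⟩ := h2 o z ho hbz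
      refine ⟨_, h a ha e he c hc, by simp [heo, hco], fun y hy => ?_⟩
      have hay := hab y (hZ y hy)
      rcases Finset.mem_insert.1 hy with rfl | hy
      · simp [hay, hcz]
      · simp [hay, heZ y hy]
  -- Disjunctions collect ones.
  have key2 : ∀ O : Finset (Fin R.arity), (∀ o ∈ O, b o = true) →
      ∃ e ∈ R.tuples, (∀ z, b z = false → e z = false) ∧ ∀ o ∈ O, e o = true := by
    intro O
    induction O using Finset.induction_on with
    | empty => exact fun _ => ⟨a, ha, hab, by simp⟩
    | insert o O hO ih =>
      intro hO
      obtain ⟨e, he, he0, he1⟩ := ih fun z hz => hO z (Finset.mem_insert_of_mem hz)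
      obtain ⟨c, hc, hco, hcz⟩ := key o (hO o (Finset.mem_insert_self _ _))
        (Finset.univ.filter fun z => b z = false) (by simp)
      refine ⟨_, h.or he hc, fun z hz => ?_, fun y hy => ?_⟩
      · simp [he0 z hz, hcz z (by simp [hz])]
      · rcases Finset.mem_insert.1 hy with rfl | hy
        · simp [hco]
        · simp [he1 y hy]
  obtain ⟨e, he, he0, he1⟩ := key2 (Finset.univ.filter fun z => b z = true) (by simp)
  rwa [show b = e from funext fun j => ?_]
  cases hb : b j
  · exact (he0 j hb).symm
  · exact (he1 j (by simp [hb])).symm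

/-- The positive clause on the variables in `I` holds in all tuples. -/
def PosImplicate (R : BoolRel) (I : Finset (Fin R.arity)) : Prop :=
  ∀ t ∈ R.tuples, ∃ i ∈ I, t i = true

/-- An inclusion-minimal positive implicate. -/
def MinImplicate (R : BoolRel) (I : Finset (Fin R.arity)) : Prop :=
  R.PosImplicate I ∧ ∀ i ∈ I, ∃ t ∈ R.tuples, ∀ j ∈ I, j ≠ i → t j = false

theorem PosImplicate.exists_min {Z : Finset (Fin R.arity)} (h : R.PosImplicate Z) :
    ∃ I ⊆ Z, R.MinImplicate I := by
  induction Z using Finset.strongInduction with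
  | H Z ih =>
    by_cases hZ : R.MinImplicate Z
    · exact ⟨Z, subset_rfl, hZ⟩
    · simp only [MinImplicate, h, true_and, not_forall, not_exists, not_and] at hZ
      obtain ⟨i, hi, hZ⟩ := hZ
      obtain ⟨I, hI, hmin⟩ := ih (Z.erase i) (Finset.erase_ssubset hi) fun t ht => by
        obtain ⟨j, hj, hji, hjt⟩ := hZ t ht
        exact ⟨j, Finset.mem_erase.2 ⟨hji, hj⟩, by simpa using hjt⟩
      exact ⟨I, hI.trans (Finset.erase_subset _ _), hmin⟩

/-- The zeros of a tuple above no tuple of the relation contain a minimal positive implicate. -/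
theorem exists_minImplicate {b : Fin R.arity → Bool}
    (h : ¬ ∃ a ∈ R.tuples, ∀ z, b z = false → a z = false) :
    ∃ I, R.MinImplicate I ∧ ∀ i ∈ I, b i = false := by
  have : R.PosImplicate (Finset.univ.filter fun z => b z = false) := by
    intro t ht
    by_contra hn
    refine h ⟨t, ht, fun z hz => ?_⟩
    by_contra hz'
    exact hn ⟨z, by simp [hz], by simpa using hz'⟩
  obtain ⟨I, hI, hm⟩ := this.exists_min
  exact ⟨I, hm, fun i hi => (Finset.mem_filter.1 (hI hi)).2⟩

/-- The projection of `R` to the variables of a minimal positive implicate is the positive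
clause. -/
theorem MinImplicate.exists_extension (h : R.OrAndClosed) {I : Finset (Fin R.arity)}
    (hI : R.MinImplicate I) (s : Fin R.arity → Bool) (hs : ∃ i ∈ I, s i = true) :
    ∃ t ∈ R.tuples, ∀ i ∈ I, t i = s i := by
  have unit : ∀ i ∈ I, ∃ t ∈ R.tuples, t i = true ∧ ∀ j ∈ I, j ≠ i → t j = false := by
    intro i hi
    obtain ⟨t, ht, h0⟩ := hI.2 i hi
    refine ⟨t, ht, ?_, h0⟩
    obtain ⟨j, hj, hjt⟩ := hI.1 t ht
    by_cases hji : j = i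
    · rwa [← hji]
    · rw [h0 j hj hji] at hjt
      exact absurd hjt (by simp)
  obtain ⟨o, ho, hso⟩ := hs
  have key : ∀ O : Finset (Fin R.arity), (∀ i ∈ O, i ∈ I ∧ s i = true) →
      ∃ t ∈ R.tuples, (∀ i ∈ O, t i = true) ∧ ∀ i ∈ I, s i = false → t i = false := by
    intro O
    induction O using Finset.induction_on with
    | empty =>
      intro _
      obtain ⟨t, ht, -, h0⟩ := unit o ho
      refine ⟨t, ht, by simp, fun i hi hsi => h0 i hi ?_⟩
      rintro rfl
      simp [hso] at hsi
    | insert i O hO ih =>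
      intro hO
      obtain ⟨t, ht, h1, h0⟩ := ih fun j hj => hO j (Finset.mem_insert_of_mem hj)
      have hi := hO i (Finset.mem_insert_self _ _)
      obtain ⟨t', ht', h1', h0'⟩ := unit i hi.1
      refine ⟨_, h.or ht ht', fun j hj => ?_, fun j hj hsj => ?_⟩
      · rcases Finset.mem_insert.1 hj with rfl | hj
        · simp [h1']
        · simp [h1 j hj]
      · have : j ≠ i := by
          rintro rfl
          simp [hi.2] at hsj
        simp [h0 j hj hsj, h0' j hj this]
  obtain ⟨t, ht, h1, h0⟩ := key (I.filter fun i => s i = true) (by simp)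
  refine ⟨t, ht, fun i hi => ?_⟩
  cases hsi : s i
  · exact h0 i hi hsi
  · exact h1 i (by simp [hi, hsi])

/-- The implication `x → y` holds in `R`, and the projection of `R` to `x` and `y` has the three
tuples that it allows. -/
def StrictImplication (R : BoolRel) (x y : Fin R.arity) : Prop :=
  (∀ t ∈ R.tuples, t x = true → t y = true) ∧ (∃ t ∈ R.tuples, t x = true) ∧
    (∃ t ∈ R.tuples, t x = false ∧ t y = true) ∧ ∃ t ∈ R.tuples, t y = false

theorem StrictImplication.exists_extension {x y : Fin R.arity} (h : R.StrictImplication x y)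
    {a b : Bool} (hab : a = true → b = true) : ∃ t ∈ R.tuples, t x = a ∧ t y = b := by
  obtain ⟨h0, ⟨t1, ht1, h1⟩, ⟨t2, ht2, h2⟩, ⟨t3, ht3, h3⟩⟩ := h
  cases a with
  | true => exact ⟨t1, ht1, h1, by rw [hab rfl, h0 t1 ht1 h1]⟩
  | false =>
    cases b with
    | true => exact ⟨t2, ht2, h2⟩
    | false =>
      refine ⟨t3, ht3, ?_, h3⟩
      by_contra hx
      rw [h0 t3 ht3 (by simpa using hx)] at h3
      exact absurd h3 (by simp)

/-- Relations without strict implications are preserved by `x ∨ (y ∧ ¬ z)`. -/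
theorem preserves_orAndNot (h : R.OrAndClosed) (hR : ∀ x y, ¬ R.StrictImplication x y) :
    Preserves orAndNot R := by
  intro A hA
  have hx := hA 0
  have hy := hA 1
  have hz := hA 2
  simp only [orAndNot]
  generalize A 0 = x at *
  generalize A 1 = y at *
  generalize A 2 = z at *
  refine h.mem ⟨x, hx, fun j hj => ?_⟩ (fun o q ho hq => ?_) fun o ho => ?_
  · exact (Bool.or_eq_false_iff.1 hj).1
  · by_contra hn
    simp only [not_exists, not_and, Bool.not_eq_false] at hn
    refine hR o q ⟨hn, ?_⟩
    have hx' := hn x hx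
    have hy' := hn y hy
    refine ⟨⟨y, hy, ?_⟩, ⟨z, hz, ?_⟩, ⟨x, hx, ?_⟩⟩ <;> revert ho hq hx' hy' <;>
      cases x o <;> cases x q <;> cases y o <;> cases y q <;> cases z o <;> cases z q <;> simp
  · cases hxo : x o
    · exact ⟨y, hy, by simp_all⟩
    · exact ⟨x, hx, hxo⟩

theorem threshold_three (x : Fin 3 → Bool) :
    threshold 3 x = ((x 0 && x 1) || (x 0 && x 2) || (x 1 && x 2)) := by
  revert x
  unfold threshold
  decide

/-- Relations whose minimal positive implicates have at most two variables are preserved by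
majority. -/
theorem preserves_threshold (h : R.OrAndClosed) (hR : ∀ I, R.MinImplicate I → I.card ≤ 2) :
    Preserves (threshold 3) R := by
  intro A hA
  have hx := hA 0
  have hy := hA 1
  have hz := hA 2
  simp only [threshold_three]
  generalize A 0 = x at *
  generalize A 1 = y at *
  generalize A 2 = z at *
  refine h.mem ?_ (fun o q ho hq => ?_) fun o ho => ?_
  · by_contra hn
    obtain ⟨I, hI, h0⟩ := exists_minImplicate hn
    obtain ⟨i, hi, hxi⟩ := hI.1 x hx
    obtain ⟨j, hj, hyj⟩ := hI.1 y hy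
    obtain ⟨k, hk, hzk⟩ := hI.1 z hz
    have h0i := h0 i hi
    have h0j := h0 j hj
    have hij : i ≠ j := by
      rintro rfl
      simp [hxi, hyj] at h0i
    have hik : i ≠ k := by
      rintro rfl
      simp [hxi, hzk] at h0i
    have hjk : j ≠ k := by
      rintro rfl
      simp [hyj, hzk] at h0j
    have := hR I hI
    have h3 : 2 < I.card := Finset.two_lt_card.2 ⟨i, hi, j, hj, k, hk, hij, hik, hjk⟩
    omega
  · by_contra hn
    simp only [not_exists, not_and, Bool.not_eq_false] at hn
    have hx' := hn x hx
    have hy' := hn y hy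
    have hz' := hn z hz
    revert ho hq hx' hy' hz'
    cases x o <;> cases x q <;> cases y o <;> cases y q <;> cases z o <;> cases z q <;> simp
  · cases hxo : x o
    · exact ⟨y, hy, by simp_all⟩
    · exact ⟨x, hx, hxo⟩

/-- In a relation preserved by majority, the minimal positive implicates have at most two
variables. -/
theorem MinImplicate.card_le_two (h : Preserves (threshold 3) R) {I : Finset (Fin R.arity)}
    (hI : R.MinImplicate I) : I.card ≤ 2 := by
  by_contra hc
  obtain ⟨i, hi, j, hj, k, hk, hij, hik, hjk⟩ := Finset.two_lt_card.1 (not_le.1 hc)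
  obtain ⟨x, hx, hx0⟩ := hI.2 i hi
  obtain ⟨y, hy, hy0⟩ := hI.2 j hj
  obtain ⟨z, hz, hz0⟩ := hI.2 k hk
  have := h ![x, y, z] fun i => by fin_cases i <;> assumption
  simp only [threshold_three] at this
  obtain ⟨l, hl, hlt⟩ := hI.1 _ this
  have h1 := hx0 l hl
  have h2 := hy0 l hl
  have h3 := hz0 l hl
  by_cases e1 : l = i
  · subst e1
    simp_all
  by_cases e2 : l = j
  · subst e2
    simp_all
  · simp_all

/-! ### Definitions of relations by clauses -/

theorem exists_holds {t : Fin R.arity → Bool} (ht : t ∈ R.tuples) :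
    ∃ α : ℕ → Bool, R.Holds α ∧ ∀ i : Fin R.arity, α i = t i := by
  refine ⟨fun j => if h : j < R.arity then t ⟨j, h⟩ else false, ?_, fun i => by simp⟩
  rw [Holds]
  convert ht using 1
  funext i
  simp

/-- `OrAndClosed.mem` with minimal positive implicates in place of all positive clauses. -/
theorem OrAndClosed.holds (h : R.OrAndClosed) {τ : ℕ → Bool}
    (h1 : ∀ I, R.MinImplicate I → ∃ i ∈ I, τ i = true)
    (h2 : ∀ o < R.arity, ∀ z < R.arity, τ o = true → τ z = false →
      ∃ α, R.Holds α ∧ α o = true ∧ α z = false)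
    (h3 : ∀ o < R.arity, τ o = true → ∃ α, R.Holds α ∧ α o = true) : R.Holds τ := by
  refine h.mem ?_ (fun o z ho hz => ?_) fun o ho => ?_
  · by_contra hn
    obtain ⟨I, hI, h0⟩ := exists_minImplicate hn
    obtain ⟨i, hi, hτ⟩ := h1 I hI
    rw [h0 i hi] at hτ
    exact absurd hτ (by simp)
  · obtain ⟨α, hα, h⟩ := h2 o o.2 z z.2 ho hz
    exact ⟨_, hα, h⟩
  · obtain ⟨α, hα, h⟩ := h3 o o.2 ho
    exact ⟨_, hα, h⟩

/-- The literals over the first `n` variables. -/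
def _root_.CCBackdoor.lits (n : ℕ) : List Lit :=
  (List.range n).flatMap fun i => [(true, i), (false, i)]

theorem _root_.CCBackdoor.mem_lits {n : ℕ} {p : Lit} : p ∈ lits n ↔ p.2 < n := by
  obtain ⟨b, i⟩ := p
  cases b <;> simp [lits]

/-- The assignment satisfies a clause of two literals. -/
def _root_.CCBackdoor.PairSat (σ : ℕ → Bool) (e : Lit × Lit) : Prop :=
  σ e.1.2 = e.1.1 ∨ σ e.2.2 = e.2.1

/-- The relation is the set of solutions of the clauses of two literals in `E` and of the clauses in
`K`. -/
def DefinedBy (R : BoolRel) (E : List (Lit × Lit)) (K : List (List Lit)) : Prop :=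
  (∀ τ, R.Holds τ ↔ (∀ e ∈ E, PairSat τ e) ∧ ∀ l ∈ K, ClauseSat τ l) ∧
    (∀ e ∈ E, e.1.2 < R.arity ∧ e.2.2 < R.arity) ∧ ∀ l ∈ K, ∀ p ∈ l, p.2 < R.arity

/-- The clauses of two literals are units, written with the same literal twice, and equivalences,
written as pairs of implications. -/
def _root_.CCBackdoor.UnitsAndEquivalences (E : List (Lit × Lit)) : Prop :=
  ∀ e ∈ E, e.1 = e.2 ∨ ∃ x y, e = ((false, x), (true, y)) ∧ ((false, y), (true, x)) ∈ E

open Classical in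
/-- The pairs of literals on the variables of `R` with the property `q`. -/
noncomputable def pairs (R : BoolRel) (q : Lit × Lit → Prop) : List (Lit × Lit) :=
  ((lits R.arity).product (lits R.arity)).filter fun e => decide (q e)

theorem mem_pairs {q : Lit × Lit → Prop} {e : Lit × Lit} :
    e ∈ R.pairs q ↔ (e.1.2 < R.arity ∧ e.2.2 < R.arity) ∧ q e := by
  obtain ⟨a, b⟩ := e
  simp [pairs, List.mem_filter, List.pair_mem_product, mem_lits]

/-- The clause of two literals holds in `R`. -/
def Implies (R : BoolRel) (e : Lit × Lit) : Prop := ∀ α, R.Holds α → PairSat α e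

theorem MinImplicate.exists_holds {I : Finset (Fin R.arity)} (hI : R.MinImplicate I) {α : ℕ → Bool}
    (hα : R.Holds α) : ∃ i ∈ I, α i = true := hI.1 _ hα

/-- A relation preserved by majority is defined by clauses of two literals, except that the empty
relation may need the empty clause. -/
theorem exists_definedBy_of_threshold (h : R.OrAndClosed) (hm : Preserves (threshold 3) R) :
    ∃ E K, R.DefinedBy E K ∧ ∀ l ∈ K, l = [] := by
  classical
  refine ⟨R.pairs R.Implies, if ∃ α, R.Holds α then [] else [[]], ⟨fun τ => ⟨fun hτ => ?_,
    fun hτ => ?_⟩, fun e he => (mem_pairs.1 he).1, fun l hl p hp => ?_⟩, fun l hl => ?_⟩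
  · rw [if_pos ⟨τ, hτ⟩]
    exact ⟨fun e he => (mem_pairs.1 he).2 τ hτ, by simp⟩
  · obtain ⟨hE, hK⟩ := hτ
    have hne : ∃ α, R.Holds α := by
      by_contra hn
      rw [if_neg hn] at hK
      simp [ClauseSat] at hK
    refine h.holds (fun I hI => ?_) (fun o ho z hz hto htz => ?_) fun o ho hto => ?_
    · by_contra hn
      simp only [not_exists, not_and, Bool.not_eq_true] at hn
      obtain ⟨α, hα⟩ := hne
      obtain ⟨i, hi, -⟩ := hI.exists_holds hα
      have hI2 := hI.card_le_two hm
      have : ∃ j ∈ I, ∀ l ∈ I, l = i ∨ l = j := by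
        by_contra hj
        simp only [not_exists, not_and, not_forall, not_or] at hj
        obtain ⟨j, hjI, hji, -⟩ := hj i hi
        obtain ⟨k, hkI, hki, hkj⟩ := hj j hjI
        have := Finset.two_lt_card.2 ⟨i, hi, j, hjI, k, hkI, Ne.symm hji, Ne.symm hki, Ne.symm hkj⟩
        omega
      obtain ⟨j, hj, hij⟩ := this
      have := hE ((true, i.val), (true, j.val)) (mem_pairs.2 ⟨⟨i.2, j.2⟩, fun β hβ => by
        obtain ⟨l, hl, hlt⟩ := hI.exists_holds hβ
        rcases hij l hl with rfl | rfl
        · exact Or.inl hlt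
        · exact Or.inr hlt⟩)
      simp [PairSat, hn i hi, hn j hj] at this
    · by_contra hn
      simp only [not_exists, not_and, Bool.not_eq_false] at hn
      have := hE ((false, o), (true, z)) (mem_pairs.2 ⟨⟨ho, hz⟩, fun β hβ => by
        by_cases hβo : β o = true
        · exact Or.inr (hn β hβ hβo)
        · exact Or.inl (by simpa using hβo)⟩)
      simp [PairSat, hto, htz] at this
    · by_contra hn
      simp only [not_exists, not_and, Bool.not_eq_true] at hn
      have := hE ((false, o), (false, o)) (mem_pairs.2 ⟨⟨ho, ho⟩, fun β hβ => Or.inl (hn β hβ)⟩)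
      simp [PairSat, hto] at this
  · split at hl <;> simp_all
  · split at hl <;> simp_all

open Classical in
/-- The positive clauses that hold in `R`; if `R` is empty, the empty clause is one of them. -/
noncomputable def posClauses (R : BoolRel) : List (List Lit) :=
  ((List.range R.arity).sublists.map fun I => I.map fun i => (true, i)).filter fun l =>
    decide (∀ α, R.Holds α → ClauseSat α l)

theorem mem_posClauses {l : List Lit} (h : l ∈ R.posClauses) :
    (∀ p ∈ l, p.1 = true ∧ p.2 < R.arity) ∧ ∀ α, R.Holds α → ClauseSat α l := by
  obtain ⟨h1, h2⟩ := List.mem_filter.1 h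
  obtain ⟨I, hI, rfl⟩ := List.mem_map.1 h1
  refine ⟨fun p hp => ?_, by simpa using h2⟩
  obtain ⟨i, hi, rfl⟩ := List.mem_map.1 hp
  exact ⟨rfl, List.mem_range.1 ((List.mem_sublists.1 hI).subset hi)⟩

/-- The variables of `I` in increasing order. -/
def indices (I : Finset (Fin R.arity)) : List ℕ :=
  (List.range R.arity).filter fun i => decide (∃ j ∈ I, j.val = i)

theorem mem_indices {I : Finset (Fin R.arity)} {i : ℕ} : i ∈ indices I ↔ ∃ j ∈ I, j.val = i := by
  simp only [indices, List.mem_filter, List.mem_range, decide_eq_true_eq, and_iff_right_iff_imp]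
  rintro ⟨j, -, rfl⟩
  exact j.2

theorem length_indices (I : Finset (Fin R.arity)) : (indices I).length = I.card := by
  have h : (indices I).Nodup := List.nodup_range.filter _
  rw [← List.toFinset_card_of_nodup h, ← Finset.card_map Fin.valEmbedding (s := I)]
  congr 1
  ext i
  simp only [List.mem_toFinset, Finset.mem_map, Fin.valEmbedding_apply]
  exact mem_indices

theorem clauseSat_indices {I : Finset (Fin R.arity)} {α : ℕ → Bool} :
    ClauseSat α ((indices I).map fun i => (true, i)) ↔ ∃ i ∈ I, α i = true := by
  simp only [ClauseSat, List.mem_map, mem_indices]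
  constructor
  · rintro ⟨_, ⟨_, ⟨j, hj, rfl⟩, rfl⟩, h⟩
    exact ⟨j, hj, h⟩
  · rintro ⟨j, hj, h⟩
    exact ⟨_, ⟨_, ⟨j, hj, rfl⟩, rfl⟩, h⟩

theorem indices_mem_posClauses {I : Finset (Fin R.arity)} (hI : R.MinImplicate I) :
    ((indices I).map fun i => (true, i)) ∈ R.posClauses := by
  refine List.mem_filter.2 ⟨List.mem_map_of_mem (List.mem_sublists.2 List.filter_sublist), ?_⟩
  simp only [decide_eq_true_eq]
  exact fun α hα => clauseSat_indices.2 (hI.exists_holds hα)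

/-- If `x → y` is strict, then `x ∨ (y ∧ ¬ z)` maps tuples with values `00`, `11`, `01` at `x` and
`y` to a tuple with values `10`. -/
theorem not_strictImplication_of_preserves (hm : Preserves orAndNot R) (x y : Fin R.arity) :
    ¬ R.StrictImplication x y := by
  rintro ⟨h0, ⟨b, hb, hb1⟩, ⟨c, hc, hc0, hc1⟩, ⟨a, ha, hay⟩⟩
  have h := hm ![a, b, c] fun i => by fin_cases i <;> assumption
  have hax : a x = false := by
    by_contra hx
    rw [h0 a ha (by simpa using hx)] at hay
    exact absurd hay (by simp)
  have := h0 _ h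
  simp [orAndNot, hax, hb1, hc0, hay, hc1] at this

/-- A relation preserved by `x ∨ (y ∧ ¬ z)` is defined by positive clauses, negative units and
equivalences. -/
theorem exists_definedBy_of_orAndNot (h : R.OrAndClosed) (hm : Preserves orAndNot R) :
    ∃ E K, R.DefinedBy E K ∧ (∀ l ∈ K, ∀ p ∈ l, p.1 = true) ∧ UnitsAndEquivalences E := by
  refine ⟨R.pairs fun e => R.Implies e ∧ (e.1 = e.2 ∨ ∃ x y, e = ((false, x), (true, y)) ∧
    R.Implies ((false, y), (true, x))), R.posClauses, ⟨fun τ => ⟨fun hτ => ?_,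
    fun hτ => ?_⟩, fun e he => (mem_pairs.1 he).1, fun l hl p hp => ((mem_posClauses hl).1 p hp).2⟩,
    fun l hl p hp => ((mem_posClauses hl).1 p hp).1, fun e he => ?_⟩
  · exact ⟨fun e he => (mem_pairs.1 he).2.1 τ hτ, fun l hl => (mem_posClauses hl).2 τ hτ⟩
  · obtain ⟨hE, hK⟩ := hτ
    have h1 : ∀ I, R.MinImplicate I → ∃ i ∈ I, τ i = true := fun I hI =>
      clauseSat_indices.1 (hK _ (indices_mem_posClauses hI))
    have h3 : ∀ o < R.arity, τ o = true → ∃ α, R.Holds α ∧ α o = true := by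
      intro o ho hto
      by_contra hn
      simp only [not_exists, not_and, Bool.not_eq_true] at hn
      have := hE ((false, o), (false, o)) (mem_pairs.2 ⟨⟨ho, ho⟩, fun β hβ => Or.inl (hn β hβ),
        Or.inl rfl⟩)
      simp [PairSat, hto] at this
    refine h.holds h1 (fun o ho z hz hto htz => ?_) h3
    by_contra hn
    simp only [not_exists, not_and, Bool.not_eq_false] at hn
    obtain ⟨β, hβ, hβo⟩ := h3 o ho hto
    refine not_strictImplication_of_preserves hm ⟨o, ho⟩ ⟨z, hz⟩ ⟨fun t ht hto => ?_,
      ⟨_, hβ, hβo⟩, ?_, ?_⟩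
    · obtain ⟨α, hα, hαt⟩ := exists_holds ht
      have := hn α hα ((hαt ⟨o, ho⟩).trans hto)
      exact (hαt ⟨z, hz⟩).symm.trans this
    · by_contra hs
      have := hE ((false, o), (true, z)) (mem_pairs.2 ⟨⟨ho, hz⟩, fun β hβ => ?_,
        Or.inr ⟨o, z, rfl, fun β hβ => ?_⟩⟩)
      · simp [PairSat, hto, htz] at this
      · by_cases hβo : β o = true
        · exact Or.inr (hn β hβ hβo)
        · exact Or.inl (by simpa using hβo)
      · by_contra hβ'
        simp only [PairSat, not_or, Bool.not_eq_true, Bool.not_eq_false] at hβ'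
        exact hs ⟨_, hβ, hβ'.2, hβ'.1⟩
    · by_contra hs
      simp only [not_exists, not_and, Bool.not_eq_false] at hs
      by_cases hne : R.MinImplicate {⟨z, hz⟩}
      · obtain ⟨i, hi, hτ⟩ := h1 _ hne
        rw [Finset.mem_singleton.1 hi] at hτ
        rw [show τ z = true from hτ] at htz
        exact absurd htz (by simp)
      · refine hne ⟨fun t ht => ⟨_, Finset.mem_singleton_self _, hs t ht⟩, fun i hi => ?_⟩
        exact ⟨_, hβ, fun j hj hji => absurd ((Finset.mem_singleton.1 hj).trans
          (Finset.mem_singleton.1 hi).symm) hji⟩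
  · obtain ⟨hlt, himp, h | ⟨x, y, rfl, himp'⟩⟩ := mem_pairs.1 he
    · exact Or.inl h
    · exact Or.inr ⟨x, y, rfl, mem_pairs.2 ⟨hlt.symm, himp', Or.inr ⟨y, x, rfl, himp⟩⟩⟩

/-- A nonempty relation closed under `x ∨ (y ∧ z)` whose minimal positive implicates have at most
`d` variables is defined by positive clauses of at most `d` literals, negative units and
implications. -/
theorem OrAndClosed.exists_clauses (h : R.OrAndClosed) {d : ℕ}
    (hd : ∀ I, R.MinImplicate I → I.card ≤ d) (hne : ∃ α, R.Holds α) :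
    ∃ C : List (List Lit), (∀ l ∈ C, ∀ p ∈ l, p.2 < R.arity) ∧
      (∀ l ∈ C, (l ≠ [] ∧ l.length ≤ d ∧ ∀ p ∈ l, p.1 = true) ∨ (∃ x, l = [(false, x)]) ∨
        ∃ x y, l = [(false, x), (true, y)]) ∧
      ∀ τ, R.Holds τ ↔ ∀ l ∈ C, ClauseSat τ l := by
  classical
  refine ⟨R.posClauses.filter (fun l => decide (l.length ≤ d)) ++
    (R.pairs fun e => R.Implies e ∧ e.1 = e.2 ∧ e.1.1 = false).map (fun e => [e.1]) ++
    (R.pairs fun e => R.Implies e ∧ e.1.1 = false ∧ e.2.1 = true).map (fun e => [e.1, e.2]),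
    fun l hl => ?_, fun l hl => ?_, fun τ => ⟨fun hτ l hl => ?_, fun hτ => ?_⟩⟩
  · simp only [List.mem_append, List.mem_map, List.mem_filter, mem_pairs] at hl
    rcases hl with (hl | ⟨e, he, rfl⟩) | ⟨e, he, rfl⟩
    · exact fun p hp => ((mem_posClauses hl.1).1 p hp).2
    · simpa using he.1.1
    · simpa using he.1
  · simp only [List.mem_append, List.mem_map, List.mem_filter, mem_pairs, decide_eq_true_eq] at hl
    rcases hl with (hl | ⟨⟨⟨a, x⟩, e⟩, ⟨-, -, -, rfl⟩, rfl⟩) |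
      ⟨⟨⟨a, x⟩, ⟨b, y⟩⟩, ⟨-, -, rfl, rfl⟩, rfl⟩
    · refine Or.inl ⟨?_, hl.2, fun p hp => ((mem_posClauses hl.1).1 p hp).1⟩
      rintro rfl
      obtain ⟨α, hα⟩ := hne
      simpa [ClauseSat] using (mem_posClauses hl.1).2 α hα
    · exact Or.inr (Or.inl ⟨x, rfl⟩)
    · exact Or.inr (Or.inr ⟨x, y, rfl⟩)
  · simp only [List.mem_append, List.mem_map, List.mem_filter, mem_pairs] at hl
    rcases hl with (hl | ⟨e, ⟨-, he, h12, -⟩, rfl⟩) | ⟨e, ⟨-, he, -⟩, rfl⟩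
    · exact (mem_posClauses hl.1).2 τ hτ
    · have := he τ hτ
      simp only [PairSat, ← h12, or_self] at this
      exact ⟨_, List.mem_singleton_self _, this⟩
    · rcases he τ hτ with h | h
      · exact ⟨e.1, by simp, h⟩
      · exact ⟨e.2, by simp, h⟩
  · refine h.holds (fun I hI => clauseSat_indices.1 (hτ _ ?_)) (fun o ho z hz hto htz => ?_)
      fun o ho hto => ?_
    · refine List.mem_append_left _ (List.mem_append_left _ (List.mem_filter.2
        ⟨indices_mem_posClauses hI, ?_⟩))
      simpa [length_indices] using hd I hI
    · by_contra hn
      simp only [not_exists, not_and, Bool.not_eq_false] at hn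
      have := hτ [(false, o), (true, z)] (List.mem_append_right _ (List.mem_map.2
        ⟨((false, o), (true, z)), mem_pairs.2 ⟨⟨ho, hz⟩, fun β hβ => ?_, rfl, rfl⟩, rfl⟩))
      · simp [ClauseSat, hto, htz] at this
      · by_cases hβo : β o = true
        · exact Or.inr (hn β hβ hβo)
        · exact Or.inl (by simpa using hβo)
    · by_contra hn
      simp only [not_exists, not_and, Bool.not_eq_true] at hn
      have := hτ [(false, o)] (List.mem_append_left _ (List.mem_append_right _ (List.mem_map.2
        ⟨((false, o), (false, o)), mem_pairs.2 ⟨⟨ho, ho⟩, fun β hβ => Or.inl (hn β hβ), rfl, rfl⟩,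
        rfl⟩)))
      simp [ClauseSat, hto] at this

end BoolRel

/-! ### The implication graph of the clauses of two literals -/

/-- The complementary literal. -/
def neg (p : Lit) : Lit := (!p.1, p.2)

@[simp] theorem neg_neg (p : Lit) : neg (neg p) = p := by simp [neg]

/-- The literal is true. -/
def LitSat (σ : ℕ → Bool) (p : Lit) : Prop := σ p.2 = p.1

theorem LitSat.neg_iff {σ : ℕ → Bool} {p : Lit} : LitSat σ (neg p) ↔ ¬ LitSat σ p := by
  simp [LitSat, neg, Bool.eq_not]

theorem litSat_mk {σ : ℕ → Bool} (i : ℕ) : LitSat σ (σ i, i) := rfl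

theorem LitSat.eq {σ : ℕ → Bool} {p : Lit} (h : LitSat σ p) : p = (σ p.2, p.2) :=
  Prod.ext h.symm rfl

section

variable {E : List (Lit × Lit)}

/-- The implication `a → b` is one of the clauses of two literals. -/
def Edge (E : List (Lit × Lit)) (a b : Lit) : Prop := (neg a, b) ∈ E ∨ (b, neg a) ∈ E

/-- The implication `a → b` follows from the clauses of two literals by a chain of implications. -/
abbrev Reach (E : List (Lit × Lit)) : Lit → Lit → Prop := Relation.ReflTransGen (Edge E)

theorem Edge.contrapose {a b : Lit} (h : Edge E a b) : Edge E (neg b) (neg a) := by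
  unfold Edge
  rw [neg_neg]
  exact h.symm

theorem Reach.contrapose {a b : Lit} (h : Reach E a b) : Reach E (neg b) (neg a) := by
  induction h with
  | refl => exact .refl
  | tail _ h ih => exact ih.head h.contrapose

theorem Edge.litSat {σ : ℕ → Bool} (hσ : ∀ e ∈ E, PairSat σ e) {a b : Lit} (h : Edge E a b)
    (ha : LitSat σ a) : LitSat σ b := by
  have hn : ¬ LitSat σ (neg a) := fun h => LitSat.neg_iff.1 h ha
  rcases h with h | h
  · exact (hσ _ h).resolve_left hn
  · exact (hσ _ h).resolve_right hn

theorem Reach.litSat {σ : ℕ → Bool} (hσ : ∀ e ∈ E, PairSat σ e) {a b : Lit} (h : Reach E a b)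
    (ha : LitSat σ a) : LitSat σ b := by
  induction h with
  | refl => exact ha
  | tail _ h ih => exact h.litSat hσ ih

theorem pairSat_of_edge {σ : ℕ → Bool} (h : ∀ a b, Edge E a b → LitSat σ a → LitSat σ b)
    {e : Lit × Lit} (he : e ∈ E) : PairSat σ e := by
  by_cases h1 : LitSat σ e.1
  · exact Or.inl h1
  · refine Or.inr (h (neg e.1) e.2 (Or.inl ?_) (LitSat.neg_iff.2 h1))
    rwa [neg_neg]

/-- Under units and equivalences only, implications from true positive variables are
equivalences with true variables. -/
theorem UnitsAndEquivalences.reach (hE : UnitsAndEquivalences E) {σ : ℕ → Bool}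
    (hσ : ∀ e ∈ E, PairSat σ e) {a b : Lit} (h : Reach E a b) (ha : a.1 = true)
    (hs : LitSat σ a) : b.1 = true ∧ Reach E b a := by
  induction h with
  | refl => exact ⟨ha, .refl⟩
  | @tail b c hab hbc ih =>
    have hb : LitSat σ b := Reach.litSat hσ hab hs
    have hc := hbc.litSat hσ hb
    obtain ⟨b1, b2⟩ := b
    obtain ⟨rfl, hba⟩ : b1 = true ∧ _ := ih
    have hne : c ≠ neg (true, b2) := by
      rintro rfl
      exact LitSat.neg_iff.1 hc hb
    rcases hbc with hbc | hbc
    · rcases hE _ hbc with h | ⟨x, y, h, h'⟩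
      · exact absurd h.symm hne
      · simp only [neg, Bool.not_true, Prod.mk.injEq, true_and] at h
        obtain ⟨rfl, rfl⟩ := h
        exact ⟨rfl, hba.head (Or.inl h')⟩
    · rcases hE _ hbc with h | ⟨x, y, h, h'⟩
      · exact absurd h hne
      · simp [neg] at h

end

/-! ### The game on implied backdoor literals -/

section

variable (Q : List Quant) (E : List (Lit × Lit)) (K : List (List Lit)) (B : List ℕ)

/-- The variable is universally quantified. -/
def Univ (j : ℕ) : Prop := Q.getD j .ex = .all

/-- The backdoor literals implied by a literal. -/
def implied (l : Lit) : Set Lit := {m | Reach E l m ∧ m.2 ∈ B}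

/-- The literal implies its complement or a literal on a later universal variable, hence must not
become true. -/
def Bad (l : Lit) : Prop := Reach E l (neg l) ∨ ∃ m, Reach E l m ∧ l.2 < m.2 ∧ Univ Q m.2

/-- All the literals implied by the literal are positive and on existential variables outside the
backdoor; such a literal can always be made true without any harm. -/
def Good (l : Lit) : Prop := ∀ m, Reach E l m → m.1 = true ∧ ¬ Univ Q m.2 ∧ m.2 ∉ B

/-- The backdoor literals in `F` do not force all literals of a clause to be false, except for
clauses with a good literal. -/
def Final (F : Set Lit) : Prop :=
  ∀ c ∈ K, (∀ l ∈ c, ¬ Good Q E B l) → ∃ l ∈ c, ∃ m ∈ implied E B (neg l), m ∉ F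

/-- The evaluation game, in which only the set `F` of the backdoor literals implied by the moves
made so far is remembered. -/
def Win : List Quant → ℕ → Set Lit → Prop
  | [], _, F => Final Q E K B F
  | .all :: qs, i, F => ∀ b, ¬ Bad Q E (b, i) ∧ Win qs (i + 1) (F ∪ implied E B (b, i))
  | .ex :: qs, i, F => ∃ b, ¬ Bad Q E (b, i) ∧ Win qs (i + 1) (F ∪ implied E B (b, i))

/-- The clauses are satisfied. -/
def MatSat (σ : ℕ → Bool) : Prop := (∀ e ∈ E, PairSat σ e) ∧ ∀ c ∈ K, ClauseSat σ c

variable {Q E K B}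

theorem Win.anti {F F' : Set Lit} (hF : F' ⊆ F) {qs : List Quant} {i : ℕ}
    (h : Win Q E K B qs i F) : Win Q E K B qs i F' := by
  induction qs generalizing i F F' with
  | nil =>
    intro c hc hg
    obtain ⟨l, hl, m, hm, hmF⟩ := h c hc hg
    exact ⟨l, hl, m, hm, fun h => hmF (hF h)⟩
  | cons q qs ih =>
    cases q with
    | all => exact fun b => ⟨(h b).1, ih (Set.union_subset_union_left _ hF) (h b).2⟩
    | ex =>
      obtain ⟨b, hb, h⟩ := h
      exact ⟨b, hb, ih (Set.union_subset_union_left _ hF) h⟩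

theorem implied_mono {a b : Lit} (h : Reach E a b) : implied E B b ⊆ implied E B a :=
  fun _ hm => ⟨h.trans hm.1, hm.2⟩

theorem Bad.of_reach {a b : Lit} (h : Reach E a b) (hab : a.2 < b.2) (hb : Bad Q E b) :
    Bad Q E a := by
  rcases hb with hb | ⟨m, hm, hlt, hu⟩
  · exact Or.inl (h.trans (hb.trans h.contrapose))
  · exact Or.inr ⟨m, h.trans hm, hab.trans hlt, hu⟩

theorem Good.of_reach {a b : Lit} (h : Reach E a b) (ha : Good Q E B a) : Good Q E B b :=
  fun m hm => ha m (h.trans hm)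

theorem Good.not_bad {i : ℕ} (h : Good Q E B (true, i)) : ¬ Bad Q E (true, i) := by
  rintro (hn | ⟨m, hm, -, hu⟩)
  · exact absurd (h _ hn).1 (by simp [neg])
  · exact (h m hm).2.1 hu

theorem Good.implied_subset {l : Lit} (h : Good Q E B l) (F : Set Lit) : implied E B l ⊆ F :=
  fun m hm => absurd hm.2 (h m hm.1).2.2

/-- The invariant of play: the values chosen before `i` respect the implications among them, none
of them is bad, good variables are true, and `F` contains the implied backdoor literals. -/
structure Consistent (Q : List Quant) (E : List (Lit × Lit)) (B : List ℕ) (i : ℕ) (σ : ℕ → Bool)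
    (F : Set Lit) : Prop where
  not_bad : ∀ j < i, ¬ Bad Q E (σ j, j)
  subset : ∀ j < i, implied E B (σ j, j) ⊆ F
  closed : ∀ j < i, ∀ m, Reach E (σ j, j) m → m.2 < i → LitSat σ m
  good : ∀ j < i, Good Q E B (true, j) → σ j = true

theorem Consistent.update {i : ℕ} {σ : ℕ → Bool} {F F' : Set Lit} (h : Consistent Q E B i σ F)
    {b : Bool} (hFF : F ⊆ F') (hF : implied E B (b, i) ⊆ F') (hb : ¬ Bad Q E (b, i))
    (hforce : ∀ j < i, ¬ Reach E (σ j, j) (!b, i)) (hgood : Good Q E B (true, i) → b = true) :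
    Consistent Q E B (i + 1) (Function.update σ i b) F' := by
  have old : ∀ j < i, Function.update σ i b j = σ j := fun j hj =>
    Function.update_of_ne hj.ne _ _
  have new : Function.update σ i b i = b := Function.update_self ..
  refine ⟨fun j hj => ?_, fun j hj => ?_, fun j hj m hm hmi => ?_, fun j hj hg => ?_⟩
  · rcases Nat.lt_succ_iff_lt_or_eq.1 hj with hj | rfl
    · rw [old j hj]
      exact h.not_bad j hj
    · rwa [new]
  · rcases Nat.lt_succ_iff_lt_or_eq.1 hj with hj | rfl
    · rw [old j hj]
      exact (h.subset j hj).trans hFF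
    · rwa [new]
  · obtain ⟨m1, m2⟩ := m
    unfold LitSat
    dsimp only at hmi ⊢
    rcases Nat.lt_succ_iff_lt_or_eq.1 hj with hj | rfl
    · rw [old j hj] at hm
      rcases Nat.lt_succ_iff_lt_or_eq.1 hmi with hmi | rfl
      · rw [old m2 hmi]
        exact h.closed j hj _ hm hmi
      · rw [new]
        by_contra hne
        refine hforce j hj ?_
        rwa [show (!b) = m1 by cases b <;> cases m1 <;> simp_all]
    · rw [new] at hm
      rcases Nat.lt_succ_iff_lt_or_eq.1 hmi with hmi | rfl
      · rw [old m2 hmi]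
        by_contra hne
        refine hforce m2 hmi ?_
        have := hm.contrapose
        simp only [neg] at this
        rwa [show σ m2 = !m1 by cases m1 <;> simp_all]
      · rw [new]
        by_contra hne
        refine hb (Or.inl ?_)
        simp only [neg]
        rwa [show (!b) = m1 by cases b <;> cases m1 <;> simp_all]
  · rcases Nat.lt_succ_iff_lt_or_eq.1 hj with hj | rfl
    · rw [old j hj]
      exact h.good j hj hg
    · rw [new]
      exact hgood hg

theorem getD_of_drop_eq_cons {i : ℕ} {q : Quant} {qs : List Quant} (h : Q.drop i = q :: qs) :
    Q.getD i .ex = q ∧ Q.drop (i + 1) = qs := by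
  constructor
  · have : (Q.drop i).getD 0 .ex = q := by rw [h]; rfl
    simpa using this
  · rw [← List.drop_drop, h]
    rfl

/-- A winning strategy of the existential player in the game yields one for the formula: forced
values are chosen first, good variables are made true, and otherwise the game is followed. -/
theorem Win.qbf (hE : ∀ e ∈ E, e.1.2 < Q.length ∧ e.2.2 < Q.length)
    (hK : ∀ c ∈ K, ∀ l ∈ c, l.2 < Q.length) {qs : List Quant} {i : ℕ} {σ : ℕ → Bool} {F : Set Lit}
    (hQ : Q.drop i = qs) (hi : Consistent Q E B i σ F) (hw : Win Q E K B qs i F) :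
    qbf qs i σ (MatSat E K) := by
  induction qs generalizing i σ F with
  | nil =>
    have hlen : Q.length ≤ i := List.drop_eq_nil_iff.1 hQ
    constructor
    · refine fun e he => pairSat_of_edge (fun a b hab ha => ?_) he
      have hlt : a.2 < Q.length ∧ b.2 < Q.length := by
        rcases hab with h | h
        · exact hE _ h
        · exact (hE _ h).symm
      refine hi.closed a.2 (by omega) b (.single ?_) (by omega)
      rwa [← ha.eq]
    · intro c hc
      by_contra hn
      have hn : ∀ l ∈ c, ¬ LitSat σ l := fun l hl h => hn ⟨l, hl, h⟩
      obtain ⟨l, hl, m, hm, hmF⟩ := hw c hc fun l hl hg => by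
        have h1 := (hg l .refl).1
        obtain ⟨l1, l2⟩ := l
        obtain rfl : l1 = true := h1
        have := hK c hc _ hl
        dsimp only at this
        exact hn _ hl (hi.good l2 (by omega) hg)
      have := hK c hc l hl
      refine hmF (hi.subset l.2 (by omega) ?_)
      rwa [← show neg l = (σ l.2, l.2) from (LitSat.neg_iff.2 (hn l hl)).eq]
  | cons q qs ih =>
    obtain ⟨hq, hQ'⟩ := getD_of_drop_eq_cons hQ
    cases q with
    | all =>
      intro b
      refine ih hQ' (hi.update Set.subset_union_left Set.subset_union_right (hw b).1
        (fun j hj hr => ?_) fun hg => ?_) (hw b).2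
      · exact hi.not_bad j hj (Or.inr ⟨_, hr, hj, hq⟩)
      · exact absurd hq (hg _ .refl).2.1
    | ex =>
      obtain ⟨b', hb', hw'⟩ := hw
      have hwF : Win Q E K B qs (i + 1) F := hw'.anti Set.subset_union_left
      by_cases hforce : ∃ b, ∃ j < i, Reach E (σ j, j) (b, i)
      · obtain ⟨b, j, hj, hr⟩ := hforce
        refine ⟨b, ih hQ' (hi.update subset_rfl ((implied_mono hr).trans (hi.subset j hj))
          (fun hb => hi.not_bad j hj (hb.of_reach hr hj)) (fun j' hj' hr' => ?_) fun hg => ?_) hwF⟩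
        · have h1 : Reach E (b, i) (neg (σ j', j')) := by
            have := hr'.contrapose
            simpa [neg] using this
          have := hi.closed j hj _ (hr.trans h1) hj'
          exact LitSat.neg_iff.1 this (litSat_mk j')
        · by_contra hb
          obtain rfl : b = false := by simpa using hb
          have h1 : Reach E (true, i) (neg (σ j, j)) := by
            have := hr.contrapose
            simpa [neg] using this
          have h2 := (hg _ h1).1
          have h3 : neg (σ j, j) = (true, j) := Prod.ext h2 rfl
          have h4 := hi.good j hj (h3 ▸ hg.of_reach h1)
          simp [neg, h4] at h2
      · simp only [not_exists, not_and] at hforce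
        by_cases hg : Good Q E B (true, i)
        · exact ⟨true, ih hQ' (hi.update subset_rfl (hg.implied_subset F) hg.not_bad
            (fun j hj => hforce _ j hj) fun _ => rfl) hwF⟩
        · exact ⟨b', ih hQ' (hi.update Set.subset_union_left Set.subset_union_right hb'
            (fun j hj => hforce _ j hj) fun h => absurd h hg) hw'⟩

/-- A true formula has a satisfying assignment that extends the given values. -/
theorem qbf_exists {P : (ℕ → Bool) → Prop} {qs : List Quant} {i : ℕ} {σ : ℕ → Bool}
    (h : qbf qs i σ P) : ∃ σ', P σ' ∧ ∀ j < i, σ' j = σ j := by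
  induction qs generalizing i σ with
  | nil => exact ⟨σ, h, fun _ _ => rfl⟩
  | cons q qs ih =>
    have : ∃ b, CCBackdoor.qbf qs (i + 1) (Function.update σ i b) P := by
      cases q with
      | all => exact ⟨true, h true⟩
      | ex => exact h
    obtain ⟨b, hb⟩ := this
    obtain ⟨σ', h1, h2⟩ := ih hb
    exact ⟨σ', h1, fun j hj => (h2 j (by omega)).trans (Function.update_of_ne hj.ne _ _)⟩

/-- A later universal variable can take both values in satisfying assignments. -/
theorem qbf_exists_univ {P : (ℕ → Bool) → Prop} {qs : List Quant} {i : ℕ} {σ : ℕ → Bool}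
    (h : qbf qs i σ P) {k : ℕ} (hk : qs.getD k .ex = .all) (b : Bool) :
    ∃ σ', P σ' ∧ (∀ j < i, σ' j = σ j) ∧ σ' (i + k) = b := by
  induction qs generalizing i σ k with
  | nil => simp at hk
  | cons q qs ih =>
    cases k with
    | zero =>
      obtain rfl : q = .all := by simpa using hk
      obtain ⟨σ', h1, h2⟩ := qbf_exists (h b)
      exact ⟨σ', h1, fun j hj => (h2 j (by omega)).trans (Function.update_of_ne hj.ne _ _),
        (h2 i (by omega)).trans (Function.update_self ..)⟩
    | succ k =>
      have : ∃ b, CCBackdoor.qbf qs (i + 1) (Function.update σ i b) P := by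
        cases q with
        | all => exact ⟨true, h true⟩
        | ex => exact h
      obtain ⟨b', hb⟩ := this
      obtain ⟨σ', h1, h2, h3⟩ := ih hb (by simpa using hk)
      exact ⟨σ', h1, fun j hj => (h2 j (by omega)).trans (Function.update_of_ne hj.ne _ _),
        by rw [← h3]; congr 1; omega⟩

/-- Bad literals make the formula false. -/
theorem not_bad_of_qbf {qs : List Quant} {i : ℕ} {σ : ℕ → Bool} {b : Bool}
    (hQ : Q.drop (i + 1) = qs) (h : qbf qs (i + 1) (Function.update σ i b) (MatSat E K)) :
    ¬ Bad Q E (b, i) := by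
  have hsat : ∀ σ' : ℕ → Bool, (∀ j < i + 1, σ' j = Function.update σ i b j) →
      LitSat σ' (b, i) := fun σ' h => (h i (by omega)).trans (Function.update_self ..)
  rintro (hr | ⟨m, hm, hlt, hu⟩)
  · obtain ⟨σ', h1, h2⟩ := qbf_exists h
    exact LitSat.neg_iff.1 (hr.litSat h1.1 (hsat σ' h2)) (hsat σ' h2)
  · dsimp only at hlt
    have hk : qs.getD (m.2 - (i + 1)) .ex = .all := by
      rw [← hQ]
      simp only [List.getD_eq_getElem?_getD, List.getElem?_drop]
      rw [show i + 1 + (m.2 - (i + 1)) = m.2 by omega]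
      rw [← List.getD_eq_getElem?_getD]
      exact hu
    obtain ⟨σ', h1, h2, h3⟩ := qbf_exists_univ h hk (!m.1)
    rw [show i + 1 + (m.2 - (i + 1)) = m.2 by omega] at h3
    have := hm.litSat h1.1 (hsat σ' h2)
    rw [LitSat, h3] at this
    simp at this

/-- If the formula is true then the existential player wins the game, by a strategy for the
formula. A universal variable that is true but implies no backdoor literal is treated as if it
were false; so true clauses with positive literals only have a true literal that is good or
equivalent to a backdoor variable. -/
theorem Win.of_qbf (hK : ∀ c ∈ K, (∀ l ∈ c, l.2 ∈ B) ∨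
      ((∀ l ∈ c, l.1 = true) ∧ UnitsAndEquivalences E))
    {qs : List Quant} {i : ℕ} {σ : ℕ → Bool} {F : Set Lit} (hQ : Q.drop i = qs)
    (h : CCBackdoor.qbf qs i σ (MatSat E K)) (hF : ∀ m ∈ F, ∃ j < i, Reach E (σ j, j) m)
    (hU : ∀ j < i, Univ Q j → (∀ m, Reach E (true, j) m → m.2 ∉ B) → σ j = false) :
    Win Q E K B qs i F := by
  induction qs generalizing i σ F with
  | nil =>
    have hlen : Q.length ≤ i := List.drop_eq_nil_iff.1 hQ
    obtain ⟨hE, hsat⟩ := h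
    have hFsat : ∀ m, LitSat σ m → neg m ∉ F := by
      intro m hm hmF
      obtain ⟨j, -, hr⟩ := hF _ hmF
      exact LitSat.neg_iff.1 (hr.litSat hE (litSat_mk j)) hm
    intro c hc hg
    obtain ⟨l, hl, hls : LitSat σ l⟩ := hsat c hc
    rcases hK c hc with hB | ⟨hpos, hsym⟩
    · exact ⟨l, hl, neg l, ⟨.refl, hB l hl⟩, hFsat l hls⟩
    · suffices ∃ m, Reach E l m ∧ m.2 ∈ B by
        obtain ⟨m, hm, hmB⟩ := this
        exact ⟨l, hl, neg m, ⟨(hsym.reach hE hm (hpos l hl) hls).2.contrapose, hmB⟩,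
          hFsat m (hm.litSat hE hls)⟩
      have := hg l hl
      simp only [Good, not_forall] at this
      obtain ⟨m, hm, hnot⟩ := this
      by_cases hmB : m.2 ∈ B
      · exact ⟨m, hm, hmB⟩
      have hm1 := (hsym.reach hE hm (hpos l hl) hls).1
      have hu : Univ Q m.2 := by
        by_contra hu
        exact hnot ⟨hm1, hu, hmB⟩
      have hmi : m.2 < i := by
        by_contra hmi
        rw [Univ, List.getD_eq_default _ _ (by omega)] at hu
        exact absurd hu (by simp)
      have hmt : LitSat σ m := hm.litSat hE hls
      obtain ⟨m1, m2⟩ := m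
      obtain rfl : m1 = true := hm1
      by_contra hn
      rw [LitSat, hU m2 hmi hu fun m' hm' hmB' => hn ⟨m', hm.trans hm', hmB'⟩] at hmt
      simp at hmt
  | cons q qs ih =>
    obtain ⟨hq, hQ'⟩ := getD_of_drop_eq_cons hQ
    have old : ∀ b, ∀ j < i, Function.update σ i b j = σ j := fun b j hj =>
      Function.update_of_ne hj.ne _ _
    have hF' : ∀ b, ∀ m ∈ F, ∃ j < i + 1, Reach E (Function.update σ i b j, j) m := by
      intro b m hm
      obtain ⟨j, hj, hr⟩ := hF m hm
      exact ⟨j, by omega, by rwa [old b j hj]⟩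
    cases q with
    | all =>
      intro b
      refine ⟨not_bad_of_qbf hQ' (h b), ?_⟩
      by_cases hP : b = true ∧ ∀ m, Reach E (true, i) m → m.2 ∉ B
      · obtain ⟨rfl, hP⟩ := hP
        refine ih hQ' (h false) (fun m hm => ?_) fun j hj hu hjB => ?_
        · rcases hm with hm | hm
          · exact hF' _ m hm
          · exact absurd hm.2 (hP m hm.1)
        · rcases Nat.lt_succ_iff_lt_or_eq.1 hj with hj | rfl
          · rw [old _ j hj]
            exact hU j hj hu hjB
          · exact Function.update_self ..
      · refine ih hQ' (h b) (fun m hm => ?_) fun j hj hu hjB => ?_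
        · rcases hm with hm | hm
          · exact hF' _ m hm
          · exact ⟨i, by omega, by rw [Function.update_self]; exact hm.1⟩
        · rcases Nat.lt_succ_iff_lt_or_eq.1 hj with hj | rfl
          · rw [old _ j hj]
            exact hU j hj hu hjB
          · rw [Function.update_self]
            by_contra hb
            exact hP ⟨by simpa using hb, hjB⟩
    | ex =>
      obtain ⟨b, hb⟩ := h
      refine ⟨b, not_bad_of_qbf hQ' hb, ih hQ' hb (fun m hm => ?_) fun j hj hu hjB => ?_⟩
      · rcases hm with hm | hm
        · exact hF' _ m hm
        · exact ⟨i, by omega, by rw [Function.update_self]; exact hm.1⟩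
      · rcases Nat.lt_succ_iff_lt_or_eq.1 hj with hj | rfl
        · rw [old _ j hj]
          exact hU j hj hu hjB
        · rw [Univ, hq] at hu
          exact absurd hu (by simp)

/-- The formula is true exactly if the existential player wins the game. -/
theorem win_iff (hE : ∀ e ∈ E, e.1.2 < Q.length ∧ e.2.2 < Q.length)
    (hKlt : ∀ c ∈ K, ∀ l ∈ c, l.2 < Q.length) (hK : ∀ c ∈ K, (∀ l ∈ c, l.2 ∈ B) ∨
      ((∀ l ∈ c, l.1 = true) ∧ UnitsAndEquivalences E)) (σ : ℕ → Bool) :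
    Win Q E K B Q 0 ∅ ↔ qbf Q 0 σ (MatSat E K) :=
  ⟨Win.qbf hE hKlt rfl ⟨by simp, by simp, by simp, by simp⟩,
    fun h => Win.of_qbf hK rfl h (by simp) (by simp)⟩

end

/-! ### Computing reachability -/

@[fun_prop]
theorem neg_poly : Poly neg := by
  unfold neg
  fun_prop

@[fun_prop]
theorem lits_poly : Poly lits := by
  unfold lits
  fun_prop

/-- All pairs of literals over the first `n` variables. -/
def litPairs (n : ℕ) : List (Lit × Lit) := (lits n).flatMap fun a => (lits n).map fun b => (a, b)

theorem mem_litPairs {n : ℕ} {e : Lit × Lit} : e ∈ litPairs n ↔ e.1.2 < n ∧ e.2.2 < n := by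
  simp only [litPairs, List.mem_flatMap, List.mem_map, mem_lits]
  constructor
  · rintro ⟨a, ha, b, hb, rfl⟩
    exact ⟨ha, hb⟩
  · rintro ⟨ha, hb⟩
    exact ⟨_, ha, _, hb, rfl⟩

@[fun_prop]
theorem litPairs_poly : Poly litPairs := by
  unfold litPairs
  fun_prop

/-- One step of the transitive closure: paths through `v` are added. -/
noncomputable def closureStep (n : ℕ) (T : List (Lit × Lit)) (v : Lit) : List (Lit × Lit) :=
  (litPairs n).filter fun e => memb e T || (memb (e.1, v) T && memb (v, e.2) T)

/-- The pairs of literals `a`, `b` over the first `n` variables with `Reach E a b`. -/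
@[irreducible] noncomputable def closure (n : ℕ) (E : List (Lit × Lit)) : List (Lit × Lit) :=
  (lits n).foldl (closureStep n) ((litPairs n).filter fun e =>
    eqb e.1 e.2 || (memb (neg e.1, e.2) E || memb (e.2, neg e.1) E))

@[fun_prop]
theorem closure_poly {α : Type} [Enc α] {n : α → ℕ} {E : α → List (Lit × Lit)} (hn : Poly n)
    (hE : Poly E) : Poly fun a => closure (n a) (E a) := by
  have ⟨S, hS, hs, _⟩ := litPairs_poly
  have h : Poly fun p : ℕ × List (Lit × Lit) => closure p.1 p.2 := by
    unfold closure closureStep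
    refine Poly.foldl_bdd (f := fun (p : ℕ × List (Lit × Lit)) T v => (litPairs p.1).filter fun e =>
      memb e T || (memb (e.1, v) T && memb (v, e.2) T)) (l := fun p => lits p.1)
      (z := fun p => (litPairs p.1).filter fun e => eqb e.1 e.2 ||
        (memb (neg e.1, e.2) p.2 || memb (e.2, neg e.1) p.2)) (by fun_prop) (by fun_prop)
      (by fun_prop) hS fun p T v => ?_
    refine (Poly.esize_le_of_sublist List.filter_sublist).trans ((hs p.1).trans (hS.1 ?_))
    rw [esize_prod]
    omega
  exact h.comp (hn.mk hE)

theorem mem_closure {n : ℕ} {E : List (Lit × Lit)} (hE : ∀ e ∈ E, e.1.2 < n ∧ e.2.2 < n)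
    {a b : Lit} : (a, b) ∈ closure n E ↔ (a.2 < n ∧ b.2 < n) ∧ Reach E a b := by
  have step : ∀ (T : List (Lit × Lit)) (v a b : Lit), (a, b) ∈ closureStep n T v ↔
      (a.2 < n ∧ b.2 < n) ∧ ((a, b) ∈ T ∨ (a, v) ∈ T ∧ (v, b) ∈ T) := by
    intro T v a b
    simp [closureStep, List.mem_filter, mem_litPairs]
  -- Invariant: `T` is closed under composition at the vertices in `D`.
  have key : ∀ (L D : List Lit) (T : List (Lit × Lit)),
      (∀ a b, (a, b) ∈ T → (a.2 < n ∧ b.2 < n) ∧ Reach E a b) →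
      (∀ v ∈ D, ∀ a b, (a, v) ∈ T → (v, b) ∈ T → (a, b) ∈ T) →
      (∀ a b, (a, b) ∈ L.foldl (closureStep n) T → (a.2 < n ∧ b.2 < n) ∧ Reach E a b) ∧
      (∀ v, v ∈ D ∨ v ∈ L → ∀ a b, (a, v) ∈ L.foldl (closureStep n) T →
        (v, b) ∈ L.foldl (closureStep n) T → (a, b) ∈ L.foldl (closureStep n) T) ∧
      ∀ a b, (a, b) ∈ T → (a, b) ∈ L.foldl (closureStep n) T := by
    intro L
    induction L with
    | nil =>
      intro D T h1 h2
      exact ⟨h1, fun v hv => h2 v (by simpa using hv), fun _ _ h => h⟩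
    | cons w L ih =>
      intro D T h1 h2
      have s1 : ∀ a b, (a, b) ∈ closureStep n T w → (a.2 < n ∧ b.2 < n) ∧ Reach E a b := by
        intro a b hab
        obtain ⟨hlt, hab | ⟨haw, hwb⟩⟩ := (step ..).1 hab
        · exact h1 a b hab
        · exact ⟨hlt, (h1 a w haw).2.trans (h1 w b hwb).2⟩
      have s2 : ∀ v ∈ w :: D, ∀ a b, (a, v) ∈ closureStep n T w → (v, b) ∈ closureStep n T w →
          (a, b) ∈ closureStep n T w := by
        intro v hv a b hav hvb
        rw [step] at hav hvb ⊢
        refine ⟨⟨hav.1.1, hvb.1.2⟩, ?_⟩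
        rcases List.mem_cons.1 hv with rfl | hv
        · exact Or.inr ⟨by tauto, by tauto⟩
        · have h2 := h2 v hv
          rcases hav.2 with h | ⟨h, h'⟩ <;> rcases hvb.2 with g | ⟨g, g'⟩
          · exact Or.inl (h2 _ _ h g)
          · exact Or.inr ⟨h2 _ _ h g, g'⟩
          · exact Or.inr ⟨h, h2 _ _ h' g⟩
          · exact Or.inr ⟨h, g'⟩
      obtain ⟨g1, g2, g3⟩ := ih (w :: D) (closureStep n T w) s1 s2
      refine ⟨g1, fun v hv => g2 v ?_, fun a b hab => g3 a b ((step ..).2 ⟨(h1 a b hab).1,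
        Or.inl hab⟩)⟩
      simpa only [List.mem_cons, or_assoc, or_left_comm] using hv
  have init : ∀ a b, (a, b) ∈ ((litPairs n).filter fun e => eqb e.1 e.2 ||
      (memb (neg e.1, e.2) E || memb (e.2, neg e.1) E)) ↔ (a.2 < n ∧ b.2 < n) ∧
      (a = b ∨ Edge E a b) := by
    intro a b
    simp [List.mem_filter, mem_litPairs, Edge, eqb_iff]
  unfold closure
  obtain ⟨g1, g2, g3⟩ := key (lits n) [] _ (fun a b hab => by
    rw [init] at hab
    obtain ⟨hlt, rfl | h⟩ := hab
    · exact ⟨hlt, .refl⟩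
    · exact ⟨hlt, .single h⟩) (by simp)
  refine ⟨g1 a b, ?_⟩
  rintro ⟨⟨ha, hb⟩, hr⟩
  induction hr with
  | refl => exact g3 _ _ ((init ..).2 ⟨⟨ha, ha⟩, Or.inl rfl⟩)
  | @tail b c hr hbc ih =>
    have hb' : b.2 < n := by
      rcases hbc with h | h
      · exact (hE _ h).1
      · exact (hE _ h).2
    exact g2 b (Or.inr (mem_lits.2 hb')) _ _ (ih hb') (g3 _ _ ((init ..).2 ⟨⟨hb', hb⟩, Or.inr hbc⟩))

/-! ### Deciding the game -/

/-- The sublists of a list, as long as there are not more than `m` of them. The cutoff makes this a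
polynomial-time function of the list and of `m` in unary. -/
noncomputable def boundedSublists {α : Type} (m : ℕ) (l : List α) : List (List α) :=
  l.foldr (fun a s => bif Nat.blt m (s ++ s.map (a :: ·)).length then s
    else s ++ s.map (a :: ·)) [[]]

theorem boundedSublists_eq {α : Type} {m : ℕ} {l : List α} (h : 2 ^ l.length ≤ m) :
    boundedSublists m l = l.sublists' := by
  induction l with
  | nil => rfl
  | cons a l ih =>
    have h' : 2 ^ l.length ≤ m := by
      rw [List.length_cons, pow_succ] at h
      omega
    have e : boundedSublists m (a :: l) = bif Nat.blt m (boundedSublists m l ++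
        (boundedSublists m l).map (a :: ·)).length then boundedSublists m l
        else boundedSublists m l ++ (boundedSublists m l).map (a :: ·) := rfl
    rw [e, ih h', ← List.sublists'_cons, List.length_sublists']
    have : Nat.blt m (2 ^ (a :: l).length) = false := by
      rw [← Bool.not_eq_true, Nat.blt_eq]
      omega
    rw [this, cond_false]

theorem length_boundedSublists_le {α : Type} (m : ℕ) (l : List α) :
    (boundedSublists m l).length ≤ m + 1 ∧ ∀ s ∈ boundedSublists m l, s.Sublist l := by
  induction l with
  | nil => simp [boundedSublists]
  | cons a l ih =>
    have e : boundedSublists m (a :: l) = bif Nat.blt m (boundedSublists m l ++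
        (boundedSublists m l).map (a :: ·)).length then boundedSublists m l
        else boundedSublists m l ++ (boundedSublists m l).map (a :: ·) := rfl
    rw [e]
    cases hb : Nat.blt m (boundedSublists m l ++ (boundedSublists m l).map (a :: ·)).length
    · rw [← Bool.not_eq_true, Nat.blt_eq] at hb
      rw [cond_false]
      refine ⟨by omega, fun s hs => ?_⟩
      rcases List.mem_append.1 hs with hs | hs
      · exact (ih.2 s hs).cons _
      · obtain ⟨t, ht, rfl⟩ := List.mem_map.1 hs
        exact (ih.2 t ht).cons_cons _
    · exact ⟨ih.1, fun s hs => (ih.2 s hs).cons _⟩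

theorem esize_le_length_mul {α : Type} [Enc α] {l : List α} {c : ℕ} (h : ∀ a ∈ l, esize a ≤ c) :
    esize l ≤ l.length * (c + 1) + 1 := by
  induction l with
  | nil => simp
  | cons a l ih =>
    have h1 := h a (by simp)
    have h2 := ih fun b hb => h b (by simp [hb])
    rw [esize_cons, List.length_cons, Nat.add_mul]
    omega

@[fun_prop]
theorem boundedSublists_poly {α β : Type} [Enc α] [Enc β] {m : β → ℕ} {l : β → List α}
    (hm : Poly m) (hl : Poly l) : Poly fun b => boundedSublists (m b) (l b) := by
  have h : Poly fun p : ℕ × List α => boundedSublists p.1 p.2 := by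
    unfold boundedSublists
    simp only [List.foldr_eq_foldl_reverse]
    refine Poly.foldl_of_bd (f := fun (p : ℕ × List α) s a =>
      bif Nat.blt p.1 (s ++ s.map (a :: ·)).length then s else s ++ s.map (a :: ·))
      (l := fun p => p.2.reverse) (z := fun _ => [[]]) (by fun_prop) (by fun_prop) (by fun_prop)
      (S := fun n => (n + 1) * (n + 1) + 1) (by fun_prop) fun p l' hl' => ?_
    have e : l'.foldl (fun s a => bif Nat.blt p.1 (s ++ s.map (a :: ·)).length then s
        else s ++ s.map (a :: ·)) [[]] = boundedSublists p.1 l'.reverse := by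
      rw [boundedSublists, List.foldr_reverse]
    rw [e]
    obtain ⟨h1, h2⟩ := length_boundedSublists_le p.1 l'.reverse
    have h3 : l'.reverse.Sublist p.2 := by
      simpa using hl'.sublist.reverse
    have h4 := esize_prod p
    have h5 := esize_nat p.1
    refine (esize_le_length_mul fun s hs => Poly.esize_le_of_sublist ((h2 s hs).trans h3)).trans ?_
    gcongr <;> omega
  exact h.comp (hm.mk hl)

/-- The data of the game: the quantifiers, the backdoor, and the implications between literals. -/
abbrev Game := (List Quant × List ℕ) × List (Lit × Lit)

/-- Boolean version of `Univ`. -/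
noncomputable def univB (Q : List Quant) (j : ℕ) : Bool := eqb (Q.getD j .ex) .all

/-- Boolean version of `Bad`. -/
noncomputable def badB (G : Game) (l : Lit) : Bool :=
  memb (l, neg l) G.2 || G.2.any fun e => eqb e.1 l && (Nat.blt l.2 e.2.2 && univB G.1.1 e.2.2)

/-- Boolean version of `Good`. -/
noncomputable def goodB (G : Game) (l : Lit) : Bool :=
  G.2.all fun e => !eqb e.1 l || (e.2.1 && (!univB G.1.1 e.2.2 && !memb e.2.2 G.1.2))

/-- The elements of `implied` as a list. -/
noncomputable def impliedL (G : Game) (l : Lit) : List Lit :=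
  (G.2.filter fun e => eqb e.1 l && memb e.2.2 G.1.2).map Prod.snd

/-- Boolean version of `Final`. -/
noncomputable def finalB (G : Game) (K : List (List Lit)) (F : List Lit) : Bool :=
  K.all fun c => c.any (fun l => goodB G l) ||
    c.any fun l => (impliedL G (neg l)).any fun m => !memb m F

/-- The literals on the backdoor. -/
def backdoorLits (B : List ℕ) : List Lit := B.flatMap fun b => [(true, b), (false, b)]

/-- From the position `F`, the choice of the literal `l` leads to a position in `W`. -/
noncomputable def moveB (G : Game) (W : List (List Lit)) (F : List Lit) (l : Lit) : Bool :=
  !badB G l && memb ((backdoorLits G.1.2).filter fun x => memb x F || memb x (impliedL G l)) W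

/-- The winning positions, given those for the next variable. -/
noncomputable def stageB (G : Game) (Ls : List (List Lit)) (i : ℕ) (W : List (List Lit)) :
    List (List Lit) :=
  Ls.filter fun F => bif univB G.1.1 i then moveB G W F (true, i) && moveB G W F (false, i)
    else moveB G W F (true, i) || moveB G W F (false, i)

@[fun_prop]
theorem univB_poly {α : Type} [Enc α] {Q : α → List Quant} {j : α → ℕ} (hQ : Poly Q) (hj : Poly j) :
    Poly fun a => univB (Q a) (j a) := by
  unfold univB
  fun_prop

@[fun_prop]
theorem badB_poly {α : Type} [Enc α] {G : α → Game} {l : α → Lit} (hG : Poly G) (hl : Poly l) :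
    Poly fun a => badB (G a) (l a) := by
  unfold badB
  fun_prop

@[fun_prop]
theorem goodB_poly {α : Type} [Enc α] {G : α → Game} {l : α → Lit} (hG : Poly G) (hl : Poly l) :
    Poly fun a => goodB (G a) (l a) := by
  unfold goodB
  fun_prop

@[fun_prop]
theorem impliedL_poly {α : Type} [Enc α] {G : α → Game} {l : α → Lit} (hG : Poly G) (hl : Poly l) :
    Poly fun a => impliedL (G a) (l a) := by
  unfold impliedL
  fun_prop

@[fun_prop]
theorem backdoorLits_poly : Poly backdoorLits := by
  unfold backdoorLits
  fun_prop

@[fun_prop]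
theorem finalB_poly {α : Type} [Enc α] {G : α → Game} {K : α → List (List Lit)} {F : α → List Lit}
    (hG : Poly G) (hK : Poly K) (hF : Poly F) : Poly fun a => finalB (G a) (K a) (F a) := by
  unfold finalB
  fun_prop

@[fun_prop]
theorem moveB_poly {α : Type} [Enc α] {G : α → Game} {W : α → List (List Lit)} {F : α → List Lit}
    {l : α → Lit} (hG : Poly G) (hW : Poly W) (hF : Poly F) (hl : Poly l) :
    Poly fun a => moveB (G a) (W a) (F a) (l a) := by
  unfold moveB
  fun_prop

/-- Whether the existential player wins the game. The winning positions are computed from the last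
variable to the first; the positions are the sublists of the list of backdoor literals, and `m` is
an upper bound on their number. -/
@[irreducible] noncomputable def winB (m : ℕ) (G : Game) (K : List (List Lit)) : Bool :=
  memb [] ((List.range G.1.1.length).foldr
    (stageB G (boundedSublists m (backdoorLits G.1.2)))
    ((boundedSublists m (backdoorLits G.1.2)).filter fun F => finalB G K F))

@[fun_prop]
theorem winB_poly {α : Type} [Enc α] {m : α → ℕ} {G : α → Game} {K : α → List (List Lit)}
    (hm : Poly m) (hG : Poly G) (hK : Poly K) : Poly fun a => winB (m a) (G a) (K a) := by
  have h : Poly fun p : (ℕ × Game) × List (List Lit) => winB p.1.1 p.1.2 p.2 := by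
    unfold winB
    refine Poly.memb (by fun_prop) ?_
    simp only [List.foldr_eq_foldl_reverse]
    have hp : Poly fun p : (ℕ × Game) × List (List Lit) =>
        boundedSublists p.1.1 (backdoorLits p.1.2.1.2) := by fun_prop
    have ⟨S, hS, hs, _⟩ := hp
    refine Poly.foldl_bdd (f := fun (p : (ℕ × Game) × List (List Lit)) W i =>
      stageB p.1.2 (boundedSublists p.1.1 (backdoorLits p.1.2.1.2)) i W)
      (l := fun p => (List.range p.1.2.1.1.length).reverse)
      (z := fun p => (boundedSublists p.1.1 (backdoorLits p.1.2.1.2)).filter fun F =>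
        finalB p.1.2 p.2 F) ?_ (by fun_prop) (by fun_prop) hS fun p W i => ?_
    · unfold stageB
      fun_prop
    · exact (Poly.esize_le_of_sublist List.filter_sublist).trans (hs p)
  exact h.comp ((hm.mk hG).mk hK)

section

variable {Q : List Quant} {E : List (Lit × Lit)} {K : List (List Lit)} {B : List ℕ}

theorem univB_iff {j : ℕ} : univB Q j = true ↔ Univ Q j := by
  rw [univB, eqb_iff, Univ]

theorem Univ.lt {j : ℕ} (h : Univ Q j) : j < Q.length := by
  by_contra hj
  rw [Univ, List.getD_eq_default _ _ (by omega)] at h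
  exact absurd h (by simp)

theorem mem_backdoorLits {l : Lit} : l ∈ backdoorLits B ↔ l.2 ∈ B := by
  obtain ⟨b, i⟩ := l
  cases b <;> simp [backdoorLits]

theorem Reach.lt {n : ℕ} (hE : ∀ e ∈ E, e.1.2 < n ∧ e.2.2 < n) {a b : Lit} (h : Reach E a b)
    (ha : a.2 < n) : b.2 < n := by
  induction h with
  | refl => exact ha
  | tail _ h _ =>
    rcases h with h | h
    · exact (hE _ h).2
    · exact (hE _ h).1

theorem badB_iff (hE : ∀ e ∈ E, e.1.2 < Q.length ∧ e.2.2 < Q.length) {l : Lit}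
    (hl : l.2 < Q.length) : badB ((Q, B), closure Q.length E) l = true ↔ Bad Q E l := by
  simp only [badB, Bool.or_eq_true, memb_iff, List.any_eq_true, Bool.and_eq_true, eqb_iff,
    Nat.blt_eq, univB_iff, Bad]
  rw [mem_closure hE]
  refine or_congr ⟨fun h => h.2, fun h => ⟨⟨hl, hl⟩, h⟩⟩ ⟨?_, ?_⟩
  · rintro ⟨⟨a, m⟩, he, rfl, h⟩
    exact ⟨m, ((mem_closure hE).1 he).2, h⟩
  · rintro ⟨m, hm, h, hu⟩
    exact ⟨(l, m), (mem_closure hE).2 ⟨⟨hl, hu.lt⟩, hm⟩, rfl, h, hu⟩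

theorem goodB_iff (hE : ∀ e ∈ E, e.1.2 < Q.length ∧ e.2.2 < Q.length) {l : Lit}
    (hl : l.2 < Q.length) : goodB ((Q, B), closure Q.length E) l = true ↔ Good Q E B l := by
  simp only [goodB, Bool.or_eq_true, memb_iff, List.all_eq_true, Bool.and_eq_true,
    Bool.not_eq_true', ← Bool.not_eq_true, eqb_iff, univB_iff, Good]
  constructor
  · intro h m hm
    exact (h (l, m) ((mem_closure hE).2 ⟨⟨hl, hm.lt hE hl⟩, hm⟩)).resolve_left (by simp)
  · rintro h ⟨a, m⟩ he
    by_cases ha : a = l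
    · subst ha
      exact Or.inr (h m ((mem_closure hE).1 he).2)
    · exact Or.inl ha

theorem mem_impliedL (hE : ∀ e ∈ E, e.1.2 < Q.length ∧ e.2.2 < Q.length) {l m : Lit}
    (hl : l.2 < Q.length) : m ∈ impliedL ((Q, B), closure Q.length E) l ↔ m ∈ implied E B l := by
  simp only [impliedL, List.mem_map, List.mem_filter, Bool.and_eq_true, eqb_iff, memb_iff]
  constructor
  · rintro ⟨⟨a, m⟩, ⟨he, rfl, h⟩, rfl⟩
    exact ⟨((mem_closure hE).1 he).2, h⟩
  · rintro ⟨hm, h⟩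
    exact ⟨(l, m), ⟨(mem_closure hE).2 ⟨⟨hl, hm.lt hE hl⟩, hm⟩, rfl, h⟩, rfl⟩

theorem finalB_iff (hE : ∀ e ∈ E, e.1.2 < Q.length ∧ e.2.2 < Q.length)
    (hK : ∀ c ∈ K, ∀ l ∈ c, l.2 < Q.length) {F : List Lit} :
    finalB ((Q, B), closure Q.length E) K F = true ↔ Final Q E K B {x | x ∈ F} := by
  simp only [finalB, List.all_eq_true, Bool.or_eq_true, List.any_eq_true, Bool.not_eq_true',
    ← Bool.not_eq_true, memb_iff, Final]
  refine forall₂_congr fun c hc => ?_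
  have h1 : (∃ l ∈ c, goodB ((Q, B), closure Q.length E) l = true) ↔
      ¬ ∀ l ∈ c, ¬ Good Q E B l := by
    simp only [not_forall, not_not, exists_prop]
    exact exists_congr fun l => and_congr_right fun hl => goodB_iff hE (hK c hc l hl)
  have h2 : (∃ l ∈ c, ∃ m ∈ impliedL ((Q, B), closure Q.length E) (neg l), ¬ m ∈ F) ↔
      ∃ l ∈ c, ∃ m ∈ implied E B (neg l), m ∉ {x | x ∈ F} :=
    exists_congr fun l => and_congr_right fun hl => exists_congr fun m => and_congr_left fun _ =>
      mem_impliedL hE (hK c hc l hl)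
  rw [h1, h2, imp_iff_not_or]

/-- The positions computed by backward induction are the winning ones. The bound in terms of the
number of backdoor literals makes the list of positions complete. -/
theorem winB_iff (hE : ∀ e ∈ E, e.1.2 < Q.length ∧ e.2.2 < Q.length)
    (hK : ∀ c ∈ K, ∀ l ∈ c, l.2 < Q.length) {m : ℕ} (hm : 2 ^ (backdoorLits B).length ≤ m) :
    winB m ((Q, B), closure Q.length E) K = true ↔ Win Q E K B Q 0 ∅ := by
  set G : Game := ((Q, B), closure Q.length E)
  have key : ∀ (qs : List Quant) (i : ℕ), Q.drop i = qs → ∀ F : List Lit,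
      F ∈ (List.range' i qs.length).foldr (stageB G (backdoorLits B).sublists')
        ((backdoorLits B).sublists'.filter fun F => finalB G K F) ↔
      F.Sublist (backdoorLits B) ∧ Win Q E K B qs i {x | x ∈ F} := by
    intro qs
    induction qs with
    | nil =>
      intro i _ F
      simp only [List.length_nil, List.range'_zero, List.foldr_nil, List.mem_filter,
        List.mem_sublists', Win]
      rw [finalB_iff hE hK]
    | cons q qs ih =>
      intro i hi F
      obtain ⟨hq, hi'⟩ := getD_of_drop_eq_cons hi
      have hlt : i < Q.length := by
        by_contra hn
        rw [List.drop_eq_nil_iff.2 (by omega)] at hi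
        exact absurd hi (by simp)
      rw [List.length_cons, List.range'_succ, List.foldr_cons, stageB, List.mem_filter,
        List.mem_sublists']
      refine and_congr_right fun hF => ?_
      have move : ∀ b, moveB G ((List.range' (i + 1) qs.length).foldr
          (stageB G (backdoorLits B).sublists')
          ((backdoorLits B).sublists'.filter fun F => finalB G K F)) F (b, i) = true ↔
          ¬ Bad Q E (b, i) ∧ Win Q E K B qs (i + 1) ({x | x ∈ F} ∪ implied E B (b, i)) := by
        intro b
        rw [moveB, Bool.and_eq_true, Bool.not_eq_true', ← Bool.not_eq_true, badB_iff hE hlt,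
          memb_iff, ih (i + 1) hi']
        refine and_congr_right fun _ => ?_
        rw [and_iff_right List.filter_sublist]
        apply iff_of_eq
        congr 1
        ext x
        simp only [Set.mem_ofPred_eq, List.mem_filter, Bool.or_eq_true, memb_iff,
          mem_impliedL hE (B := B) (l := (b, i)) hlt, Set.mem_union, G]
        refine ⟨fun h => h.2, fun h => ⟨?_, h⟩⟩
        rcases h with h | h
        · exact hF.subset h
        · exact mem_backdoorLits.2 h.2
      have hu : univB G.1.1 i = true ↔ q = .all := by
        rw [univB_iff, Univ, ← hq]
      cases q with
      | all =>
        rw [hu.2 rfl, cond_true, Bool.and_eq_true, move, move]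
        simp only [Win, Bool.forall_bool]
        exact and_comm
      | ex =>
        have : univB G.1.1 i = false := by
          rw [← Bool.not_eq_true, hu]
          simp
        rw [this, cond_false, Bool.or_eq_true, move, move]
        simp only [Win, Bool.exists_bool]
        exact or_comm
  unfold winB
  rw [memb_iff, boundedSublists_eq hm, List.range_eq_range', key Q 0 rfl]
  simp

end

/-! ### Fixed-parameter tractability -/

section

variable {Γ : Set BoolRel}

/-- The literal of a constraint on the variables that are listed in `vs`. -/
def substLit (vs : List ℕ) (p : Lit) : Lit := (p.1, vs.getD p.2 0)

@[fun_prop]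
theorem substLit_poly {α : Type} [Enc α] {vs : α → List ℕ} {p : α → Lit} (hv : Poly vs)
    (hp : Poly p) : Poly fun a => substLit (vs a) (p a) := by
  unfold substLit
  fun_prop

/-- The clauses of two literals by which the constraints outside the backdoor are defined. -/
@[irreducible] noncomputable def Raw.pairClauses (E : Γ → List (Lit × Lit)) (r : Raw Γ) :
    List (Lit × Lit) :=
  r.apps.flatMap fun a => (E a.1).map fun e => (substLit a.2 e.1, substLit a.2 e.2)

/-- The other clauses. -/
@[irreducible] noncomputable def Raw.longClauses (K : Γ → List (List Lit)) (r : Raw Γ) :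
    List (List Lit) :=
  r.clauses ++ r.apps.flatMap fun a => (K a.1).map fun c => c.map fun l => substLit a.2 l

@[fun_prop]
theorem Raw.pairClauses_poly [Finite Γ] (E : Γ → List (Lit × Lit)) :
    Poly (Raw.pairClauses E) := by
  have h : Poly E := Poly.of_finite _
  unfold Raw.pairClauses
  fun_prop

@[fun_prop]
theorem Raw.longClauses_poly [Finite Γ] (K : Γ → List (List Lit)) :
    Poly (Raw.longClauses K) := by
  have h : Poly K := Poly.of_finite _
  unfold Raw.longClauses
  fun_prop

theorem Raw.matSat_iff {E : Γ → List (Lit × Lit)} {K : Γ → List (List Lit)}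
    (h : ∀ R : Γ, R.1.DefinedBy (E R) (K R)) (r : Raw Γ) (σ : ℕ → Bool) :
    MatSat (r.pairClauses E) (r.longClauses K) σ ↔
      (∀ l ∈ r.clauses, ClauseSat σ l) ∧ ∀ a ∈ r.apps, AppSat σ a := by
  have hp : ∀ (a : Γ × List ℕ) (e : Lit × Lit), PairSat σ (substLit a.2 e.1, substLit a.2 e.2) ↔
      PairSat (fun i => σ (a.2.getD i 0)) e := fun a e => Iff.rfl
  have hc : ∀ (a : Γ × List ℕ) (c : List Lit), ClauseSat σ (c.map fun l => substLit a.2 l) ↔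
      ClauseSat (fun i => σ (a.2.getD i 0)) c := fun a c => by
    simp only [ClauseSat, List.mem_map, substLit]
    constructor
    · rintro ⟨_, ⟨l, hl, rfl⟩, h⟩
      exact ⟨l, hl, h⟩
    · rintro ⟨l, hl, h⟩
      exact ⟨_, ⟨l, hl, rfl⟩, h⟩
  have hA : ∀ a : Γ × List ℕ, AppSat σ a ↔ (∀ e ∈ E a.1, PairSat σ (substLit a.2 e.1,
      substLit a.2 e.2)) ∧ ∀ c ∈ K a.1, ClauseSat σ (c.map fun l => substLit a.2 l) := fun a => by
    rw [AppSat, (h a.1).1]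
    simp only [hp, hc]
  unfold MatSat pairClauses longClauses
  simp only [List.mem_flatMap, List.mem_map, List.mem_append, hA]
  constructor
  · rintro ⟨h1, h2⟩
    exact ⟨fun l hl => h2 l (Or.inl hl), fun a ha => ⟨fun e he => h1 _ ⟨a, ha, e, he, rfl⟩,
      fun c hc => h2 _ (Or.inr ⟨a, ha, c, hc, rfl⟩)⟩⟩
  · rintro ⟨h1, h2⟩
    refine ⟨?_, ?_⟩
    · rintro _ ⟨a, ha, e, he, rfl⟩
      exact (h2 a ha).1 e he
    · rintro _ (hl | ⟨a, ha, c, hc, rfl⟩)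
      · exact h1 _ hl
      · exact (h2 a ha).2 c hc

/-- The evaluation problem is fixed-parameter tractable if the relations are defined by clauses of
two literals together with either empty clauses, or positive clauses where the clauses of two
literals are units and equivalences. -/
theorem isFPT_EV [Finite Γ] {E : Γ → List (Lit × Lit)} {K : Γ → List (List Lit)}
    (h : ∀ R : Γ, R.1.DefinedBy (E R) (K R)) (hK : (∀ R, ∀ c ∈ K R, c = []) ∨
      ∀ R, (∀ c ∈ K R, ∀ l ∈ c, l.1 = true) ∧ UnitsAndEquivalences (E R)) : IsFPT (EV Γ) := by
  classical
  refine ⟨fun p => decide (p ∈ EV Γ), by simp, ?_⟩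
  refine computableInFPTTime_of_poly_pow (F := fun x => [admissible x.1 && winB x.2
    (((parse x.1.1).1, dedupB (parse x.1.1).2.2),
      closure (parse x.1.1).1.length ((parse x.1.1).pairClauses E))
    ((parse x.1.1).longClauses K)]) (by fun_prop) fun p => ?_
  congr 1
  rw [Bool.eq_iff_iff, decide_eq_true_eq, Bool.and_eq_true, mem_EV]
  refine and_congr_right fun hadm => ?_
  rw [admissible_iff, valid_iff] at hadm
  obtain ⟨⟨I, hI⟩, hk, hB, -⟩ := hadm
  have hwf : (parse p.1).Wf := by
    rw [← hI, parse_encode_instance]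
    exact I.wf_raw
  generalize parse p.1 = r at hk hB hwf ⊢
  dsimp only
  have hdef := Raw.matSat_iff h r
  have hvar : ∀ a ∈ r.apps, ∀ i < a.1.1.arity, a.2.getD i 0 < r.1.length := by
    intro a ha i hi
    rw [← Raw.length_apps hwf ha] at hi
    rw [List.getD_eq_getElem _ _ hi]
    exact Raw.mem_apps hwf ha (List.getElem_mem hi)
  have hE : ∀ e ∈ r.pairClauses E, e.1.2 < r.1.length ∧ e.2.2 < r.1.length := by
    intro e he
    unfold Raw.pairClauses at he
    obtain ⟨a, ha, he⟩ := List.mem_flatMap.1 he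
    obtain ⟨e', he', rfl⟩ := List.mem_map.1 he
    have := (h a.1).2.1 e' he'
    exact ⟨hvar a ha _ this.1, hvar a ha _ this.2⟩
  have hKl : ∀ c ∈ r.longClauses K, ((∃ a ∈ r.apps, ∃ c' ∈ K a.1, c = c'.map (substLit a.2)) ∨
      ∀ l ∈ c, l.2 ∈ r.2.2) := by
    intro c hc
    unfold Raw.longClauses at hc
    rcases List.mem_append.1 hc with hc | hc
    · exact Or.inr fun l hl => Raw.mem_clauses hc hl
    · obtain ⟨a, ha, hc⟩ := List.mem_flatMap.1 hc
      obtain ⟨c', hc', rfl⟩ := List.mem_map.1 hc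
      exact Or.inl ⟨a, ha, c', hc', rfl⟩
  have hKlt : ∀ c ∈ r.longClauses K, ∀ l ∈ c, l.2 < r.1.length := by
    intro c hc l hl
    rcases hKl c hc with ⟨a, ha, c', hc', rfl⟩ | h'
    · obtain ⟨l', hl', rfl⟩ := List.mem_map.1 hl
      exact hvar a ha _ ((h a.1).2.2 c' hc' l' hl')
    · exact hwf.2 _ (h' l hl)
  rw [winB_iff hE hKlt, win_iff hE hKlt _ fun _ => false]
  · unfold Raw.True
    exact qbf_congr (fun σ => (hdef σ).trans (Raw.sat_iff hwf hB σ).symm) _ _ _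
  · intro c hc
    have hdd := (dedupB_spec r.2.2).2
    rcases hKl c hc with ⟨a, ha, c', hc', rfl⟩ | h'
    · rcases hK with hK | hK
      · rw [hK _ c' hc']
        exact Or.inl (by simp)
      · refine Or.inr ⟨fun l hl => ?_, fun e he => ?_⟩
        · obtain ⟨l', hl', rfl⟩ := List.mem_map.1 hl
          exact (hK a.1).1 c' hc' l' hl'
        · unfold Raw.pairClauses at he
          obtain ⟨b, hb, he⟩ := List.mem_flatMap.1 he
          obtain ⟨e', he', rfl⟩ := List.mem_map.1 he
          rcases (hK b.1).2 e' he' with heq | ⟨x, y, rfl, he''⟩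
          · exact Or.inl (by rw [heq])
          · refine Or.inr ⟨_, _, rfl, ?_⟩
            unfold Raw.pairClauses
            exact List.mem_flatMap.2 ⟨b, hb, List.mem_map.2 ⟨_, he'', rfl⟩⟩
    · exact Or.inl fun l hl => (hdd _).2 (h' l hl)
  -- There are `2 ^ (2 * k) = 4 ^ k` positions.
  · have : (backdoorLits (dedupB r.2.2)).length = 2 * p.2 := by
      rw [← hk, backdoorLits, List.length_flatMap]
      simp [mul_comm]
    rw [this, pow_mul]
    norm_num

end

/-! ### Replacing constraints by gadgets -/

section

variable {Γ Γ' : Set BoolRel}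

/-- The variable in a slot of a gadget: `(true, i)` is the `i`-th variable of the constraint to be
replaced, `(false, j)` the `j`-th variable of the block at index `b`. -/
def slotVar (vs : List ℕ) (b : ℕ) (s : Lit) : ℕ := bif s.1 then vs.getD s.2 0 else b + s.2

/-- The value in a slot of a gadget. -/
def slotVal (τ w : ℕ → Bool) (s : Lit) : Bool := bif s.1 then τ s.2 else w s.2

/-- The gadget `T` expresses `R`: its constraints on the variables of `R` and on a block of a
universal variable, followed by `m` existential variables, define `R`. In `w`, the universal
variable has index `0` and the existential variables have the indices `1, …, m`. -/
structure IsGadget (m : ℕ) (R : BoolRel) (T : List (Γ' × List Lit)) : Prop where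
  length : ∀ t ∈ T, t.2.length = t.1.1.arity
  lt : ∀ t ∈ T, ∀ s ∈ t.2, bif s.1 then s.2 < R.arity else s.2 ≤ m
  holds : ∀ τ, R.Holds τ ↔ ∀ u, ∃ w : ℕ → Bool, w 0 = u ∧ ∀ t ∈ T,
    t.1.1.Holds fun i => slotVal τ w (t.2.getD i (true, 0))

/-- The constraints of a gadget. -/
def instantiate (T : List (Γ' × List Lit)) (vs : List ℕ) (b : ℕ) : List (RawC Γ') :=
  T.map fun t => (some t.1, t.2.map fun s => (true, slotVar vs b s))

/-- The constraints of the gadgets for several applications, with blocks from index `b` on. -/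
def instantiateAll (m : ℕ) (T : Γ → List (Γ' × List Lit)) :
    ℕ → List (Γ × List ℕ) → List (RawC Γ')
  | _, [] => []
  | b, a :: as => instantiate (T a.1) a.2 b ++ instantiateAll m T (b + (m + 1)) as

theorem instantiateAll_eq (m : ℕ) (T : Γ → List (Γ' × List Lit)) (b : ℕ) (as : List (Γ × List ℕ)) :
    instantiateAll m T b as = (List.range as.length).flatMap fun i =>
      (as.drop i).head?.toList.flatMap fun a => instantiate (T a.1) a.2 (b + (m + 1) * i) := by
  induction as generalizing b with
  | nil => rfl
  | cons a as ih =>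
    rw [instantiateAll, ih, List.length_cons, List.range_succ_eq_map, List.flatMap_cons,
      List.flatMap_map]
    simp [Nat.mul_add, add_assoc, add_comm]

theorem mem_instantiateAll {m : ℕ} {T : Γ → List (Γ' × List Lit)} {b : ℕ}
    {as : List (Γ × List ℕ)} {c : RawC Γ'} (h : c ∈ instantiateAll m T b as) :
    ∃ a ∈ as, ∃ t ∈ T a.1, ∃ b', b' + (m + 1) ≤ b + (m + 1) * as.length ∧
      c = (some t.1, t.2.map fun s => (true, slotVar a.2 b' s)) := by
  induction as generalizing b with
  | nil => simp [instantiateAll] at h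
  | cons a as ih =>
    rw [instantiateAll] at h
    rcases List.mem_append.1 h with h | h
    · obtain ⟨t, ht, rfl⟩ := List.mem_map.1 h
      exact ⟨a, by simp, t, ht, b, by rw [List.length_cons, Nat.mul_add]; omega, rfl⟩
    · obtain ⟨a', ha', t, ht, b', hb', rfl⟩ := ih h
      exact ⟨a', by simp [ha'], t, ht, b', by rw [List.length_cons, Nat.mul_add]; omega, rfl⟩

theorem qbf_append {P : (ℕ → Bool) → Prop} (qs qs' : List Quant) (i : ℕ) (σ : ℕ → Bool) :
    qbf (qs ++ qs') i σ P ↔ qbf qs i σ fun σ' => qbf qs' (i + qs.length) σ' P := by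
  induction qs generalizing i σ with
  | nil => rfl
  | cons q qs ih =>
    have h : i + (q :: qs).length = i + 1 + qs.length := by rw [List.length_cons]; omega
    rw [h]
    cases q with
    | all => exact forall_congr' fun b => ih _ _
    | ex => exact exists_congr fun b => ih _ _

theorem qbf_replicate_ex {P : (ℕ → Bool) → Prop} (m i : ℕ) (σ : ℕ → Bool) :
    qbf (List.replicate m .ex) i σ P ↔
      ∃ σ', (∀ j, j < i ∨ i + m ≤ j → σ' j = σ j) ∧ P σ' := by
  induction m generalizing i σ with
  | zero =>
    constructor
    · exact fun h => ⟨σ, fun _ _ => rfl, h⟩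
    · rintro ⟨σ', h, hP⟩
      rwa [show σ' = σ from funext fun j => h j (by omega)] at hP
  | succ m ih =>
    rw [List.replicate_succ]
    constructor
    · rintro ⟨b, h⟩
      obtain ⟨σ', h, hP⟩ := (ih _ _).1 h
      exact ⟨σ', fun j hj => (h j (by omega)).trans (Function.update_of_ne (by omega) _ _), hP⟩
    · rintro ⟨σ', h, hP⟩
      refine ⟨σ' i, (ih _ _).2 ⟨σ', fun j hj => ?_, hP⟩⟩
      by_cases hji : j = i
      · rw [hji, Function.update_self]
      · rw [Function.update_of_ne hji]
        exact h j (by omega)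

/-- The quantifiers of the blocks of the gadgets. -/
def blocks (m : ℕ) (as : List (Γ × List ℕ)) : List Quant :=
  as.flatMap fun _ => .all :: List.replicate m .ex

theorem length_blocks (m : ℕ) (as : List (Γ × List ℕ)) :
    (blocks m as).length = (m + 1) * as.length := by
  simp [blocks, List.length_flatMap, mul_comm]

theorem AppSat.congr {σ σ' : ℕ → Bool} {a : Γ × List ℕ} (hlen : a.2.length = a.1.1.arity)
    (h : ∀ v ∈ a.2, σ v = σ' v) : AppSat σ a ↔ AppSat σ' a := by
  refine BoolRel.holds_congr fun i hi => h _ ?_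
  rw [← hlen] at hi
  rw [List.getD_eq_getElem _ _ hi]
  exact List.getElem_mem hi

theorem sat_instantiate {T : List (Γ' × List Lit)} (hT : ∀ t ∈ T, t.2.length = t.1.1.arity)
    (vs : List ℕ) (b : ℕ) (σ : ℕ → Bool) : (∀ c ∈ instantiate T vs b, c.Sat σ) ↔ ∀ t ∈ T,
      t.1.1.Holds fun i => slotVal (fun i => σ (vs.getD i 0)) (fun j => σ (b + j))
        (t.2.getD i (true, 0)) := by
  simp only [instantiate, List.mem_map, forall_exists_index, and_imp, forall_apply_eq_imp_iff₂]
  refine forall₂_congr fun t ht => ?_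
  show (t.1.1.Holds fun i =>
    σ (((t.2.map fun s => (true, slotVar vs b s)).map Prod.snd).getD i 0)) ↔ _
  refine BoolRel.holds_congr fun i hi => ?_
  rw [← hT t ht] at hi
  simp only [List.map_map, List.getD_eq_getElem?_getD, List.getElem?_map]
  rw [List.getElem?_eq_getElem hi]
  simp only [Option.map_some, Option.getD_some, Function.comp, slotVar, slotVal]
  cases (t.2[i]).1 <;> simp

/-- A gadget has a solution for both values of its universal variable exactly if the constraint
that it replaces holds. -/
theorem IsGadget.appSat_iff {m : ℕ} {a : Γ × List ℕ} {T : List (Γ' × List Lit)}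
    (hT : IsGadget m a.1.1 T) (hlen : a.2.length = a.1.1.arity) {b : ℕ} (hb : ∀ v ∈ a.2, v < b)
    (σ : ℕ → Bool) : AppSat σ a ↔ ∀ u, ∃ σ' : ℕ → Bool, σ' b = u ∧
      (∀ j, j < b ∨ b + (m + 1) ≤ j → σ' j = σ j) ∧ ∀ c ∈ instantiate T a.2 b, c.Sat σ' := by
  have hv : ∀ i < a.1.1.arity, a.2.getD i 0 < b := by
    intro i hi
    rw [← hlen] at hi
    rw [List.getD_eq_getElem _ _ hi]
    exact hb _ (List.getElem_mem hi)
  have hcongr : ∀ (σ' w : ℕ → Bool), (∀ j < b, σ' j = σ j) → (∀ j ≤ m, σ' (b + j) = w j) →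
      ((∀ c ∈ instantiate T a.2 b, c.Sat σ') ↔ ∀ t ∈ T,
        t.1.1.Holds fun i => slotVal (fun i => σ (a.2.getD i 0)) w (t.2.getD i (true, 0))) := by
    intro σ' w h1 h2
    rw [sat_instantiate hT.length]
    refine forall₂_congr fun t ht => BoolRel.holds_congr fun i hi => ?_
    rw [← hT.length t ht] at hi
    rw [List.getD_eq_getElem _ _ hi]
    have := hT.lt t ht _ (List.getElem_mem hi)
    unfold slotVal
    cases hs : (t.2[i]).1 <;> rw [hs] at this
    · exact h2 _ this
    · exact h1 _ (hv _ this)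
  rw [AppSat, hT.holds]
  refine forall_congr' fun u => ⟨?_, ?_⟩
  · rintro ⟨w, hw, h⟩
    refine ⟨fun j => if b ≤ j ∧ j < b + (m + 1) then w (j - b) else σ j, by simpa using hw,
      fun j hj => if_neg (by omega),
      (hcongr _ w (fun j hj => if_neg (by omega)) fun j hj => ?_).2 h⟩
    simp [Nat.lt_succ_of_le hj]
  · rintro ⟨σ', hu, h1, h2⟩
    exact ⟨fun j => σ' (b + j), hu, (hcongr _ _ (fun j hj => h1 j (Or.inl hj)) fun _ _ => rfl).1 h2⟩

theorem instantiate_sat_congr {m : ℕ} {a : Γ × List ℕ} {T : List (Γ' × List Lit)}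
    (hT : IsGadget m a.1.1 T) (hlen : a.2.length = a.1.1.arity) {b : ℕ} (hb : ∀ v ∈ a.2, v < b)
    {σ σ' : ℕ → Bool} (h : ∀ j < b + (m + 1), σ j = σ' j) :
    (∀ c ∈ instantiate T a.2 b, c.Sat σ) ↔ ∀ c ∈ instantiate T a.2 b, c.Sat σ' := by
  rw [sat_instantiate hT.length, sat_instantiate hT.length]
  refine forall₂_congr fun t ht => BoolRel.holds_congr fun i hi => ?_
  rw [← hT.length t ht] at hi
  rw [List.getD_eq_getElem _ _ hi]
  have := hT.lt t ht _ (List.getElem_mem hi)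
  unfold slotVal
  cases hs : (t.2[i]).1 <;> rw [hs] at this
  · exact h _ (by rw [cond_false] at this; omega)
  · rw [cond_true, ← hlen] at this
    simp only [cond_true]
    rw [List.getD_eq_getElem _ _ this]
    have := hb _ (List.getElem_mem this)
    exact h _ (by omega)

/-- Appending the blocks of the gadgets to the prefix turns the applications that they replace into
the constraints of the gadgets. The condition on `P` says that it depends only on the variables
below `b`. -/
theorem qbf_blocks {m : ℕ} {T : Γ → List (Γ' × List Lit)} (hT : ∀ R : Γ, IsGadget m R.1 (T R))
    (as : List (Γ × List ℕ)) (hlen : ∀ a ∈ as, a.2.length = a.1.1.arity) {b : ℕ}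
    (hb : ∀ a ∈ as, ∀ v ∈ a.2, v < b) {P : (ℕ → Bool) → Prop}
    (hP : ∀ σ σ', (∀ j < b, σ j = σ' j) → (P σ ↔ P σ')) (σ : ℕ → Bool) :
    qbf (blocks m as) b σ (fun σ' => P σ' ∧ ∀ c ∈ instantiateAll m T b as, c.Sat σ') ↔
      P σ ∧ ∀ a ∈ as, AppSat σ a := by
  induction as generalizing b σ P with
  | nil => simp [blocks, instantiateAll, qbf]
  | cons a as ih =>
    have hlen' := fun a ha => hlen a (List.mem_cons_of_mem _ ha)
    have hb' := fun a ha => hb a (List.mem_cons_of_mem _ ha)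
    have hla := hlen a (by simp)
    have hba := hb a (by simp)
    have h1 : ∀ σ', qbf (blocks m as) (b + (m + 1)) σ' (fun σ'' => P σ'' ∧
        ∀ c ∈ instantiateAll m T b (a :: as), c.Sat σ'') ↔
        (P σ' ∧ ∀ c ∈ instantiate (T a.1) a.2 b, c.Sat σ') ∧ ∀ a ∈ as, AppSat σ' a := by
      intro σ'
      rw [← ih hlen' (b := b + (m + 1)) (fun a ha v hv => (hb' a ha v hv).trans (by omega))
        fun σ σ' h => and_congr (hP σ σ' fun j hj => h j (by omega))
          (instantiate_sat_congr (hT a.1) hla hba h)]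
      refine qbf_congr (fun σ'' => ?_) _ _ _
      simp only [instantiateAll, List.mem_append, or_imp, forall_and, and_assoc]
    have h2 : blocks m (a :: as) = (.all :: List.replicate m .ex) ++ blocks m as := rfl
    rw [h2, qbf_append]
    simp only [List.length_cons, List.length_replicate, h1, qbf]
    simp only [qbf_replicate_ex]
    rw [List.forall_mem_cons, (hT a.1).appSat_iff hla hba]
    have h3 : ∀ σ', (∀ j < b, σ' j = σ j) → ((P σ' ↔ P σ) ∧
        ((∀ a ∈ as, AppSat σ' a) ↔ ∀ a ∈ as, AppSat σ a)) := fun σ' h =>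
      ⟨hP _ _ h, forall₂_congr fun a ha =>
        AppSat.congr (hlen' a ha) fun v hv => h v (hb' a ha v hv)⟩
    constructor
    · intro H
      have H' : ∀ u, ∃ σ' : ℕ → Bool, σ' b = u ∧ (∀ j, j < b ∨ b + (m + 1) ≤ j → σ' j = σ j) ∧
          (P σ' ∧ ∀ c ∈ instantiate (T a.1) a.2 b, c.Sat σ') ∧ ∀ a ∈ as, AppSat σ' a := by
        intro u
        obtain ⟨σ', h, h'⟩ := H u
        exact ⟨σ', (h b (by omega)).trans (Function.update_self ..), fun j hj =>
          (h j (by omega)).trans (Function.update_of_ne (by omega) _ _), h'⟩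
      obtain ⟨σ', -, g1, ⟨g2, -⟩, g3⟩ := H' true
      obtain ⟨e1, e2⟩ := h3 σ' fun j hj => g1 j (Or.inl hj)
      refine ⟨e1.1 g2, fun u => ?_, e2.1 g3⟩
      obtain ⟨σ', f0, f1, f2, -⟩ := H' u
      exact ⟨σ', f0, f1, f2.2⟩
    · rintro ⟨g1, g2, g3⟩ u
      obtain ⟨σ', f0, f1, f2⟩ := g2 u
      obtain ⟨e1, e2⟩ := h3 σ' fun j hj => f1 j (Or.inl hj)
      refine ⟨σ', fun j hj => ?_, ⟨e1.2 g1, f2⟩, e2.2 g3⟩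
      by_cases hjb : j = b
      · rw [hjb, f0, Function.update_self]
      · rw [Function.update_of_ne hjb]
        exact f1 j (by omega)

/-- The instance in which the constraints outside the backdoor are replaced by gadgets. -/
@[irreducible] noncomputable def Raw.replace (m : ℕ) (T : Γ → List (Γ' × List Lit)) (r : Raw Γ) :
    Raw Γ' :=
  (r.1 ++ blocks m r.apps,
    r.clauses.map (fun l => (none, l)) ++ instantiateAll m T r.1.length r.apps, r.2.2)

@[fun_prop]
theorem Raw.replace_poly [Finite Γ] [Finite Γ'] (m : ℕ) (T : Γ → List (Γ' × List Lit)) :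
    Poly (Raw.replace m T) := by
  have h : Poly T := Poly.of_finite _
  unfold Raw.replace blocks
  simp only [instantiateAll_eq]
  unfold instantiate slotVar
  fun_prop

theorem RawC.mem_vars_clauseForm {c : RawC Γ} {l : List Lit} (h : l ∈ c.clauseForm) {v : ℕ}
    (hv : v ∈ c.2.map Prod.snd) : v ∈ l.map Prod.snd := by
  obtain ⟨o, l'⟩ := c
  cases o with
  | none =>
    rw [clauseForm_none, List.mem_singleton] at h
    rwa [h]
  | some R =>
    rw [clauseForm_some] at h
    obtain ⟨s, hs, rfl⟩ := List.mem_map.1 h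
    obtain ⟨i, hi, rfl⟩ := List.mem_iff_getElem.1 hv
    refine List.mem_map.2 ⟨_, List.mem_map.2 ⟨i, List.mem_range.2 hi, rfl⟩, ?_⟩
    exact List.getD_eq_getElem _ _ hi

/-- Gadgets that express the relations of `Γ` by relations of `Γ'` provide a reduction, which
leaves the backdoor and the clauses over it unchanged. -/
theorem fptReducible_EV [Finite Γ] [Finite Γ'] {m : ℕ} {T : Γ → List (Γ' × List Lit)}
    (hT : ∀ R : Γ, IsGadget m R.1 (T R)) : FPTReducible (EV Γ) (EV Γ') := by
  -- The empty string encodes no instance, so it serves as value for inadmissible inputs.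
  refine ⟨fun p => bif admissible p then (((parse p.1).replace m T).encode, p.2) else ([], 0),
    fun p => ?_, ⟨id, Computable.id, fun p => ?_⟩, ?_⟩
  · dsimp only
    cases hadm : admissible p
    · rw [mem_EV, hadm, cond_false]
      refine iff_of_false (by simp) ?_
      rintro ⟨I, hI, -⟩
      simp [Instance.encode] at hI
    · rw [mem_EV, hadm, cond_true, mem_EV]
      rw [admissible_iff, valid_iff] at hadm
      obtain ⟨⟨I, hI⟩, hk, hB, hcov⟩ := hadm
      have hwf : (parse p.1).Wf := by
        rw [← hI, parse_encode_instance]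
        exact I.wf_raw
      generalize parse p.1 = r at hk hB hcov hwf ⊢
      have hlen : ∀ a ∈ r.apps, a.2.length = a.1.1.arity := fun a ha => r.length_apps hwf ha
      have hvar : ∀ a ∈ r.apps, ∀ v ∈ a.2, v < r.1.length := fun a ha v hv => r.mem_apps hwf ha hv
      have hgetD : ∀ a ∈ r.apps, ∀ i < a.1.1.arity, a.2.getD i 0 < r.1.length := by
        intro a ha i hi
        rw [← hlen a ha] at hi
        rw [List.getD_eq_getElem _ _ hi]
        exact hvar a ha _ (List.getElem_mem hi)
      have hmem : ∀ c ∈ (r.replace m T).2.1, (∃ l ∈ r.clauses, c = (none, l)) ∨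
          c ∈ instantiateAll m T r.1.length r.apps := by
        intro c hc
        unfold Raw.replace at hc
        rcases List.mem_append.1 hc with hc | hc
        · obtain ⟨l, hl, rfl⟩ := List.mem_map.1 hc
          exact Or.inl ⟨l, hl, rfl⟩
        · exact Or.inr hc
      have hbd : (r.replace m T).2.2 = r.2.2 := by unfold Raw.replace; rfl
      have hl' : (r.replace m T).1.length = r.1.length + (m + 1) * r.apps.length := by
        unfold Raw.replace
        rw [List.length_append, length_blocks]
      have hwf' : (r.replace m T).Wf := by
        refine ⟨fun c hc => ?_, fun v hv => ?_⟩
        · rcases hmem c hc with ⟨l, hl, rfl⟩ | hc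
          · refine ⟨fun p hp => ?_, by simp⟩
            have := hwf.2 _ (Raw.mem_clauses hl hp)
            omega
          · obtain ⟨a, ha, t, ht, b', hb', rfl⟩ := mem_instantiateAll hc
            refine ⟨fun p hp => ?_, fun R hR => ?_⟩
            · obtain ⟨s, hs, rfl⟩ := List.mem_map.1 hp
              have := (hT a.1).lt t ht s hs
              rw [hl']
              unfold slotVar
              cases h1 : s.1 <;> rw [h1] at this
              · simp only [cond_false] at this ⊢
                omega
              · simp only [cond_true] at this ⊢
                have := hgetD a ha _ this
                omega
            · obtain rfl : t.1 = R := by simpa using hR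
              simpa using ((hT a.1).length t ht).symm
        · rw [hbd] at hv
          have := hwf.2 v hv
          omega
      have hnorm : (r.replace m T).Normal := by
        intro c hc hs p hp
        rcases hmem c hc with ⟨l, hl, rfl⟩ | hc
        · simp at hs
        · obtain ⟨a, ha, t, ht, b', hb', rfl⟩ := mem_instantiateAll hc
          obtain ⟨s, -, rfl⟩ := List.mem_map.1 hp
          rfl
      have hkept : ∀ l ∈ r.clauses, RawC.kept r.2.2 ((none, l) : RawC Γ') = true := by
        intro l hl
        refine RawC.kept_iff.2 ⟨rfl, fun v hv => ?_⟩
        obtain ⟨p, hp, rfl⟩ := List.mem_map.1 hv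
        exact Raw.mem_clauses hl hp
      have hadm' : admissible ((r.replace m T).encode, p.2) = true := by
        rw [admissible_iff, valid_iff]
        dsimp only
        rw [parse_encode _ hnorm, hbd]
        refine ⟨hwf'.exists_instance, hk, fun c hc => ?_, fun b hb => ?_⟩
        · rcases hmem c hc with ⟨l, hl, rfl⟩ | hc
          · exact Or.inl (hkept l hl)
          · obtain ⟨a, ha, t, ht, b', hb', rfl⟩ := mem_instantiateAll hc
            exact Or.inr rfl
        · obtain ⟨c, hc, hck, hbc⟩ := hcov b hb
          obtain ⟨l, hl⟩ := List.exists_mem_of_ne_nil _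
            (List.isEmpty_eq_false_iff.1 (RawC.kept_iff.1 hck).1)
          have hlr : l ∈ r.clauses := by
            unfold Raw.clauses
            exact List.mem_flatMap.2 ⟨c, hc, by rw [hck]; exact hl⟩
          refine ⟨(none, l), ?_, hkept l hlr, RawC.mem_vars_clauseForm hl hbc⟩
          unfold Raw.replace
          exact List.mem_append_left _ (List.mem_map_of_mem hlr)
      rw [hadm']
      refine and_congr Iff.rfl ?_
      dsimp only
      rw [parse_encode _ hnorm]
      unfold Raw.True
      have h1 : (r.replace m T).1 = r.1 ++ blocks m r.apps := by unfold Raw.replace; rfl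
      have h2 : ∀ σ, (∀ c ∈ (r.replace m T).2.1, c.Sat σ) ↔ (∀ l ∈ r.clauses, ClauseSat σ l) ∧
          ∀ c ∈ instantiateAll m T r.1.length r.apps, c.Sat σ := by
        intro σ
        unfold Raw.replace
        simp only [List.forall_mem_append, List.forall_mem_map]
        rfl
      rw [h1, qbf_append]
      simp only [h2]
      refine qbf_congr (fun σ => ?_) _ _ _
      rw [Nat.zero_add, qbf_blocks hT r.apps hlen hvar, Raw.sat_iff hwf hB]
      intro σ σ' h
      refine forall₂_congr fun l hl => exists_congr fun p => and_congr_right fun hp => ?_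
      rw [h _ (hwf.2 _ (Raw.mem_clauses hl hp))]
  · dsimp only
    cases admissible p <;> simp
  · refine computableInFPTTime_of_poly_pow (F := fun x => bif admissible x.1 then
      ((parse x.1.1).replace m T).encode.map some ++ List.replicate x.1.2 none else [])
      (by fun_prop) fun p => ?_
    dsimp only
    cases admissible p <;> rfl

end

/-! ### Gadgets between the language and `d-IHSB₊` -/

theorem finite_dIhsbPlus (d : ℕ) : (dIhsbPlus d).Finite := by
  refine Set.Finite.subset (s := (fun r => clauseRel fun _ : Fin r => true) '' Set.Iic d ∪
    {clauseRel ![false], clauseRel ![false, true], clauseRel ![true, false]})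
    (((Set.finite_Iic d).image _).union (by simp)) ?_
  rintro R ⟨⟨r, -, rfl⟩ | h, hR⟩
  · exact Or.inl ⟨r, hR, rfl⟩
  · exact Or.inr h

/-- The clauses of `OrAndClosed.exists_clauses` belong to `d-IHSB₊`. -/
theorem clauseRel_get_mem {d : ℕ} (hd : 2 ≤ d) {l : List Lit}
    (h : (l ≠ [] ∧ l.length ≤ d ∧ ∀ p ∈ l, p.1 = true) ∨ (∃ x, l = [(false, x)]) ∨
      ∃ x y, l = [(false, x), (true, y)]) : clauseRel (l.map Prod.fst).get ∈ dIhsbPlus d := by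
  rcases h with ⟨h1, h2, h3⟩ | ⟨x, rfl⟩ | ⟨x, y, rfl⟩
  · refine ⟨Or.inl ⟨(l.map Prod.fst).length, ?_, ?_⟩, ?_⟩
    · rw [List.length_map]
      exact List.length_pos_of_ne_nil h1
    · congr 1
      funext i
      have := List.get_mem (l.map Prod.fst) i
      obtain ⟨p, hp, hpi⟩ := List.mem_map.1 this
      rw [← hpi, h3 p hp]
    · show (l.map Prod.fst).length ≤ d
      rwa [List.length_map]
  · refine ⟨Or.inr (Or.inl ?_), show 1 ≤ d by omega⟩
    exact congrArg (clauseRel (r := 1)) (funext fun i => by fin_cases i; rfl)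
  · refine ⟨Or.inr (Or.inr (Or.inl ?_)), show 2 ≤ d by omega⟩
    exact congrArg (clauseRel (r := 2)) (funext fun i => by fin_cases i <;> rfl)

/-- Conjunctions of clauses of `d-IHSB₊` are gadgets that use neither the universal nor the
existential variables of their block. -/
theorem exists_gadget_clauses {d : ℕ} (hd : 2 ≤ d) {n : ℕ} (C : List (List Lit))
    (hlt : ∀ l ∈ C, ∀ p ∈ l, p.2 < n)
    (hC : ∀ l ∈ C, (l ≠ [] ∧ l.length ≤ d ∧ ∀ p ∈ l, p.1 = true) ∨ (∃ x, l = [(false, x)]) ∨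
      ∃ x y, l = [(false, x), (true, y)]) :
    ∃ T : List (dIhsbPlus d × List Lit), (∀ t ∈ T, t.2.length = t.1.1.arity) ∧
      (∀ t ∈ T, ∀ s ∈ t.2, s.1 = true ∧ s.2 < n) ∧
      ∀ τ w, (∀ t ∈ T, t.1.1.Holds fun i => slotVal τ w (t.2.getD i (true, 0))) ↔
        ∀ l ∈ C, ClauseSat τ l := by
  induction C with
  | nil => exact ⟨[], by simp, by simp, by simp⟩
  | cons l C ih =>
    obtain ⟨T, h1, h2, h3⟩ := ih (fun c hc => hlt c (by simp [hc])) fun c hc => hC c (by simp [hc])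
    refine ⟨(⟨_, clauseRel_get_mem hd (hC l (by simp))⟩, l.map fun p => (true, p.2)) :: T,
      List.forall_mem_cons.2 ⟨?_, h1⟩, List.forall_mem_cons.2 ⟨?_, h2⟩, fun τ w => ?_⟩
    · show _ = (l.map Prod.fst).length
      rw [List.length_map, List.length_map]
    · intro s hs
      obtain ⟨p, hp, rfl⟩ := List.mem_map.1 hs
      exact ⟨rfl, hlt l (by simp) p hp⟩
    · rw [List.forall_mem_cons, List.forall_mem_cons, h3]
      refine and_congr_left fun _ => ?_
      rw [holds_clauseRel rfl]
      dsimp only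
      constructor
      · rintro ⟨i, hi, h⟩
        rw [List.length_map] at hi
        refine ⟨l[i], List.getElem_mem hi, ?_⟩
        simpa [slotVal, hi] using h
      · rintro ⟨p, hp, h⟩
        obtain ⟨i, hi, rfl⟩ := List.mem_iff_getElem.1 hp
        exact ⟨i, by simpa using hi, by simpa [slotVal, hi] using h⟩

/-- Relations closed under `x ∨ (y ∧ z)` whose minimal positive implicates have at most `d`
variables are expressed by `d-IHSB₊`. The empty relation is expressed by a unit clause on a
universal variable. -/
theorem exists_gadget_dIhsbPlus {R : BoolRel} (h : R.OrAndClosed) {d : ℕ} (hd : 2 ≤ d)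
    (hmin : ∀ I, R.MinImplicate I → I.card ≤ d) (m : ℕ) :
    ∃ T : List (dIhsbPlus d × List Lit), IsGadget m R T := by
  by_cases hne : ∃ α, R.Holds α
  · obtain ⟨C, h1, h2, h3⟩ := h.exists_clauses hmin hne
    obtain ⟨T, g1, g2, g3⟩ := exists_gadget_clauses hd C h1 h2
    refine ⟨T, g1, fun t ht s hs => ?_, fun τ => ?_⟩
    · rw [(g2 t ht s hs).1]
      exact (g2 t ht s hs).2
    · simp only [g3, h3]
      exact ⟨fun h u => ⟨fun _ => u, rfl, h⟩, fun h => (h true).choose_spec.2⟩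
  · have hmem : clauseRel [true].get ∈ dIhsbPlus d :=
      clauseRel_get_mem hd (l := [(true, 0)]) (Or.inl ⟨by simp, by simp; omega, by simp⟩)
    refine ⟨[(⟨_, hmem⟩, [(false, 0)])], ?_, by simp, fun τ => ?_⟩
    · intro t ht
      rw [List.mem_singleton.1 ht]
      rfl
    · refine iff_of_false (fun h => hne ⟨τ, h⟩) fun h => ?_
      obtain ⟨w, hw, hT⟩ := h false
      have := (holds_clauseRel rfl _).1 (hT _ (List.mem_singleton_self _))
      simp [slotVal, hw] at this

section

variable {Γ : Set BoolRel}

/-- Gadgets with a single constraint `R`, in which `f` assigns slots to some of the variables of `R`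
and the others are existential variables of their own: such a gadget expresses `R'` if the tuples of
`R'` are exactly those for which the values in the slots always extend to a tuple of `R`. -/
theorem exists_gadget_single {R' : BoolRel} {R : Γ} {m : ℕ} (hm : R.1.arity ≤ m)
    (f : Fin R.1.arity → Option Lit)
    (hf : ∀ j s, f j = some s → bif s.1 then s.2 < R'.arity else s.2 = 0)
    (h : ∀ τ, R'.Holds τ ↔ ∀ u, ∃ t ∈ R.1.tuples, ∀ j s, f j = some s →
      t j = bif s.1 then τ s.2 else u) :
    ∃ T : List (Γ × List Lit), IsGadget m R' T := by
  refine ⟨[(R, List.ofFn fun j => (f j).getD (false, j.val + 1))], ?_, ?_, fun τ => ?_⟩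
  · simp
  · simp only [List.mem_singleton, forall_eq, List.mem_ofFn, forall_exists_index,
      forall_apply_eq_imp_iff]
    intro j
    cases hj : f j with
    | none =>
      have := j.2
      show j.val + 1 ≤ m
      omega
    | some s =>
      have := hf j s hj
      simp only [Option.getD_some]
      cases hs : s.1 <;> rw [hs] at this
      · simp only [cond_false] at this ⊢
        omega
      · exact this
  · rw [h]
    simp only [List.mem_singleton, forall_eq, BoolRel.Holds]
    refine forall_congr' fun u => ⟨?_, ?_⟩
    · rintro ⟨t, ht, hts⟩
      refine ⟨fun i => if hi : 0 < i ∧ i - 1 < R.1.arity then t ⟨i - 1, hi.2⟩ else u, by simp, ?_⟩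
      convert ht using 1
      funext j
      simp only [List.getD_eq_getElem?_getD, List.getElem?_ofFn, j.2, dif_pos, Option.getD_some,
        Fin.eta]
      cases hj : f j with
      | none => simp [slotVal]
      | some s =>
        rw [hts j s hj]
        have := hf j s hj
        simp only [Option.getD_some, slotVal]
        cases hs : s.1 <;> rw [hs] at this
        · rw [cond_false] at this
          simp [this]
        · rfl
    · rintro ⟨w, hw, hT⟩
      refine ⟨_, hT, fun j s hj => ?_⟩
      simp only [List.getD_eq_getElem?_getD, List.getElem?_ofFn, j.2, dif_pos, Option.getD_some,
        Fin.eta, hj, slotVal]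
      have := hf j s hj
      cases hs : s.1 <;> rw [hs] at this
      · rw [cond_false] at this
        simp [this, hw]
      · rfl

/-- Positive clauses of at most `d` literals are expressed by a relation that has a minimal
positive implicate of `d` variables; some variables of the clause are repeated. -/
theorem exists_gadget_posClause {R : Γ} (h : R.1.OrAndClosed) {I : Finset (Fin R.1.arity)}
    (hI : R.1.MinImplicate I) {r : ℕ} (hr : 0 < r) (hrd : r ≤ I.card) {m : ℕ}
    (hm : R.1.arity ≤ m) :
    ∃ T : List (Γ × List Lit), IsGadget m (clauseRel fun _ : Fin r => true) T := by
  classical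
  refine exists_gadget_single hm (fun j => if j ∈ I then
    some (true, min ((BoolRel.indices I).idxOf j.val) (r - 1)) else none) (fun j s hs => ?_)
    fun τ => ?_
  · split at hs
    · obtain rfl := Option.some.inj hs
      show min _ (r - 1) < r
      omega
    · simp at hs
  · constructor
    · rintro ⟨i, hi⟩ u
      have hlen : i.val < (BoolRel.indices I).length := by
        rw [BoolRel.length_indices]
        exact lt_of_lt_of_le i.2 hrd
      obtain ⟨j, hj, hji⟩ := BoolRel.mem_indices.1 (List.getElem_mem hlen)
      obtain ⟨t, ht, hts⟩ := hI.exists_extension h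
        (fun j => τ (min ((BoolRel.indices I).idxOf j.val) (r - 1))) ⟨j, hj, by
          have hnd : (BoolRel.indices I).Nodup := List.nodup_range.filter _
          have hir : i.val < r := i.2
          rw [hji, hnd.idxOf_getElem, min_eq_left (by omega)]
          exact hi⟩
      refine ⟨t, ht, fun j s hs => ?_⟩
      split at hs
      · obtain rfl := Option.some.inj hs
        exact hts j ‹_›
      · simp at hs
    · intro H
      obtain ⟨t, ht, hts⟩ := H true
      obtain ⟨j, hj, hjt⟩ := hI.1 t ht
      have := hts j _ (if_pos hj)
      rw [hjt, cond_true] at this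
      exact ⟨⟨min ((BoolRel.indices I).idxOf j.val) (r - 1), by omega⟩, this.symm⟩

/-- An implication between two slots, each of which is a variable of `R'` or the universal variable,
is expressed by a relation with a strict implication. -/
theorem exists_gadget_implication {R' : BoolRel} {R : Γ} {x y : Fin R.1.arity}
    (h : R.1.StrictImplication x y) {m : ℕ} (hm : R.1.arity ≤ m) (a b : Lit)
    (ha : bif a.1 then a.2 < R'.arity else a.2 = 0) (hb : bif b.1 then b.2 < R'.arity else b.2 = 0)
    (hR' : ∀ τ, R'.Holds τ ↔ ∀ u, (bif a.1 then τ a.2 else u) = true →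
      (bif b.1 then τ b.2 else u) = true) :
    ∃ T : List (Γ × List Lit), IsGadget m R' T := by
  classical
  have hxy : y ≠ x := by
    rintro rfl
    obtain ⟨-, -, ⟨t, -, h1, h2⟩, -⟩ := h
    rw [h1] at h2
    exact absurd h2 (by simp)
  refine exists_gadget_single hm (fun j => if j = x then some a else if j = y then some b else none)
    (fun j s hs => ?_) fun τ => ?_
  · split at hs
    · rwa [← Option.some.inj hs]
    · split at hs
      · rwa [← Option.some.inj hs]
      · simp at hs
  · rw [hR']
    refine forall_congr' fun u => ⟨fun hu => ?_, ?_⟩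
    · obtain ⟨t, ht, h1, h2⟩ := h.exists_extension hu
      refine ⟨t, ht, fun j s hs => ?_⟩
      split at hs
      · rw [← Option.some.inj hs, ‹j = x›, h1]
      · split at hs
        · rw [← Option.some.inj hs, ‹j = y›, h2]
        · simp at hs
    · rintro ⟨t, ht, hts⟩
      rw [← hts x a (if_pos rfl), ← hts y b (by rw [if_neg hxy, if_pos rfl])]
      exact h.1 t ht

/-- A minimal positive implicate of `d` variables and a strict implication suffice to express
`d-IHSB₊`. The negative unit on `x` is the implication `x → u` with the universal variable `u`. -/
theorem exists_gadget_of_mem_dIhsbPlus {R₁ R₂ : Γ} (h₁ : R₁.1.OrAndClosed)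
    {I : Finset (Fin R₁.1.arity)} (hI : R₁.1.MinImplicate I) {x y : Fin R₂.1.arity}
    (h₂ : R₂.1.StrictImplication x y) {m : ℕ} (hm₁ : R₁.1.arity ≤ m) (hm₂ : R₂.1.arity ≤ m)
    {R : BoolRel} (hR : R ∈ dIhsbPlus I.card) : ∃ T : List (Γ × List Lit), IsGadget m R T := by
  have two : ∀ (s : Fin 2 → Bool) (τ : ℕ → Bool), (clauseRel s).Holds τ ↔ τ 0 = s 0 ∨ τ 1 = s 1 :=
    fun s τ => Fin.exists_fin_two
  obtain ⟨⟨r, hr, rfl⟩ | rfl | rfl | rfl, hd⟩ := hR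
  · exact exists_gadget_posClause h₁ hI hr hd hm₁
  · refine exists_gadget_implication h₂ hm₂ (true, 0) (false, 0) Nat.one_pos rfl fun τ => ?_
    simp only [cond_true, cond_false, Bool.forall_bool]
    have : (clauseRel ![false]).Holds τ ↔ τ 0 = false :=
      ⟨fun ⟨j, hj⟩ => by rwa [Subsingleton.elim j (0 : Fin 1)] at hj, fun h => ⟨(0 : Fin 1), h⟩⟩
    rw [this]
    simp
  · refine exists_gadget_implication h₂ hm₂ (true, 0) (true, 1) Nat.two_pos Nat.one_lt_two
      fun τ => ?_
    rw [two]
    simp only [cond_true, forall_const]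
    cases τ 0 <;> cases τ 1 <;> simp
  · refine exists_gadget_implication h₂ hm₂ (true, 1) (true, 0) Nat.one_lt_two Nat.two_pos
      fun τ => ?_
    rw [two]
    simp only [cond_true, forall_const]
    cases τ 0 <;> cases τ 1 <;> simp

end

end CCBackdoor

theorem mainTheorem7 (Γ : Set CCBackdoor.BoolRel) (hfin : Γ.Finite)
    (hΓ : CCBackdoor.IsIhsbPlusLanguage Γ) :
    (CCBackdoor.IsPol CCBackdoor.orAndNot Γ ∨ CCBackdoor.IsPol (CCBackdoor.threshold 3) Γ →
      CCBackdoor.IsFPT (CCBackdoor.EV Γ)) ∧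
    (¬ (CCBackdoor.IsPol CCBackdoor.orAndNot Γ ∨ CCBackdoor.IsPol (CCBackdoor.threshold 3) Γ) →
      ∃ d : ℕ, 3 ≤ d ∧ (∃ R ∈ Γ, d ≤ R.arity) ∧
        CCBackdoor.FPTEquivalent (CCBackdoor.EV Γ) (CCBackdoor.EV (CCBackdoor.dIhsbPlus d))) := by
  classical
  have hfin' : Finite Γ := hfin
  have hcl : ∀ R ∈ Γ, R.OrAndClosed := fun R hR =>
    CCBackdoor.BoolRel.orAndClosed_of_preserves (hΓ 3 _ CCBackdoor.isPol_orAnd_ihsbPlus R hR)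
  constructor
  · rintro (hpol | hpol)
    · choose E K h using fun R : Γ =>
        CCBackdoor.BoolRel.exists_definedBy_of_orAndNot (hcl R R.2) (hpol R R.2)
      exact CCBackdoor.isFPT_EV (fun R => (h R).1) (Or.inr fun R => (h R).2)
    · choose E K h using fun R : Γ =>
        CCBackdoor.BoolRel.exists_definedBy_of_threshold (hcl R R.2) (hpol R R.2)
      exact CCBackdoor.isFPT_EV (fun R => (h R).1) (Or.inl fun R => (h R).2)
  · intro hpol
    rw [not_or] at hpol
    obtain ⟨hpol₂, hpol₁⟩ := hpol
    have hbig : ∃ R ∈ Γ, ∃ I, R.MinImplicate I ∧ 3 ≤ I.card := by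
      by_contra hn
      simp only [not_exists, not_and, not_le] at hn
      exact hpol₁ fun R hR => CCBackdoor.BoolRel.preserves_threshold (hcl R hR) fun I hI =>
        Nat.le_of_lt_succ (hn R hR I hI)
    have himp : ∃ R ∈ Γ, ∃ x y, R.StrictImplication x y := by
      by_contra hn
      simp only [not_exists, not_and] at hn
      exact hpol₂ fun R hR => CCBackdoor.BoolRel.preserves_orAndNot (hcl R hR) (hn R hR)
    obtain ⟨M, hM⟩ : ∃ M, ∀ R ∈ Γ, R.arity ≤ M := by
      obtain ⟨M, hM⟩ := (hfin.image CCBackdoor.BoolRel.arity).bddAbove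
      exact ⟨M, fun R hR => hM ⟨R, hR, rfl⟩⟩
    have hcard : ∀ (R : CCBackdoor.BoolRel) (I : Finset (Fin R.arity)), I.card ≤ R.arity :=
      fun R I => by simpa using I.card_le_univ
    -- The number `d` is the largest size of a minimal positive implicate of a relation in `Γ`.
    let p : ℕ → Prop := fun d => ∃ R ∈ Γ, ∃ I, R.MinImplicate I ∧ I.card = d
    obtain ⟨R, hR, I, hI, h3⟩ := hbig
    have hle : I.card ≤ Nat.findGreatest p M :=
      Nat.le_findGreatest ((hcard R I).trans (hM R hR)) ⟨R, hR, I, hI, rfl⟩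
    obtain ⟨R₁, hR₁, I₁, hI₁, hd⟩ : p (Nat.findGreatest p M) :=
      Nat.findGreatest_spec (P := p) ((hcard R I).trans (hM R hR)) ⟨R, hR, I, hI, rfl⟩
    obtain ⟨R₂, hR₂, x, y, hxy⟩ := himp
    have hmax : ∀ R ∈ Γ, ∀ I, R.MinImplicate I → I.card ≤ I₁.card := fun R hR I hI => by
      rw [hd]
      exact Nat.le_findGreatest ((hcard R I).trans (hM R hR)) ⟨R, hR, I, hI, rfl⟩
    have := CCBackdoor.finite_dIhsbPlus I₁.card
    have hfin₂ : Finite (CCBackdoor.dIhsbPlus I₁.card) := this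
    refine ⟨I₁.card, by omega, ⟨R₁, hR₁, hcard R₁ I₁⟩, ?_, ?_⟩
    · choose T hT using fun R : Γ => CCBackdoor.exists_gadget_dIhsbPlus (hcl R R.2)
        (show 2 ≤ I₁.card by omega) (hmax R R.2) 0
      exact CCBackdoor.fptReducible_EV hT
    · choose T hT using fun R : CCBackdoor.dIhsbPlus I₁.card =>
        CCBackdoor.exists_gadget_of_mem_dIhsbPlus (R₁ := ⟨R₁, hR₁⟩) (R₂ := ⟨R₂, hR₂⟩) (hcl R₁ hR₁)
          hI₁ hxy (hM R₁ hR₁) (hM R₂ hR₂) R.2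
      exact CCBackdoor.fptReducible_EV hT
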